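/- **Setting.** Logarithms $\log$ are to base $2$. Let $n,p,Q\in\mathbb Z_{>0}$, $R,c>0$, $\sigma\ge 0$. Let $X\in\mathbb R^{n\times p}$ be a random matrix with iid entries whose common distribution has a density $f$ with $\|f\|_\infty\le c$ and finite first absolute moment $\int|x|f(x)\,dx\le M$. Let $\beta^*\in[-R,R]^p$ have all entries in $\frac1Q\mathbb Z$, and let $Y=X\beta^*+W$, where the noise $W$ is an arbitrary (adversarial) random vector with $\|W\|_\infty\le\sigma$; in particular $W$ may depend on $X$. **The LBR algorithm** has as input $(Y,X,N,\hat Q,\hat R,\hat W)$ with $N,\hat Q,\hat R\in\mathbb Z_{>0}$ and $\hat W>0$ real. For $x\in\mathbb R$ let $x_N=\operatorname{sign}(x)\lfloor 2^N|x|\rfloor/2^N$, and let $Y_N,X_N$ be obtained by truncating every entry in this way. LBR calls the ELO algorithm with input $\bigl(2^N\hat QY_N,\;2^NX_N,\;\hat Q\hat R,\;2\hat Q(2^N\hat W+\hat Rp)\bigr)$ (where $2^N\hat W$ is rounded up to an integer) and divides the resulting vector by $\hat Q$. **The ELO algorithm** with integer input $(Y',X',R',W')$ proceeds as follows. (1)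 Draw $Z\in\{R'+1,\dots,2R'+\lfloor\log p\rfloor\}^p$ with iid uniform coordinates, independent of the data. (2) Set $Y_1=Y'+X'Z$. (3) Let $Y_2$ be $Y_1$ with every coordinate of absolute value less than $3$ replaced by $3$. (4) Set $m=2^{n+\lceil p/2\rceil+3}\,p\,(R'\lceil\sqrt p\rceil+W'\lceil\sqrt n\rceil)$. (5) Run the LLL basis reduction algorithm (parameter $3/4$, exact rational arithmetic, full size reductions alternating with exchanges of consecutive vectors) on the columns of $$A_m=\begin{pmatrix} mX' & -m\,\mathrm{Diag}(Y_2) & mI_n\\ I_p&0&0\\ 0&0&I_n\end{pmatrix}$$ and let $\hat z$ be the first vector of the reduced basis. (6) Compute by Euclid's algorithm $g=\gcd(\hat z_{n+1},\dots,\hat z_{n+p})$, taken with the sign of $\hat z_{n+1}$. (7) If $g\ne0$ output $\frac1g(\hat z_{n+1},\dots,\hat z_{n+p})^t-Z$, otherwise output $0$. Running time is the number of bit operations, integer and rational arithmetic being charged according to the binary length of the operands. Put $S=n+p+N+\log\hat Q+\log\hat R+\max(0,\log\hat W)$. **Theorem.** There are absolute constants $\kappa>0$ and $A,D\in\mathbb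 N$ with the following properties. (a) LBR terminates on all real inputs $Y,X$ (with $n,p,N,\hat Q,\hat R\in\mathbb Z_{>0}$, $\hat W>0$) and all values of $Z$ that can be drawn, in time at most $A\,\bigl(S+\log(2+B)\bigr)^D$ if all entries of $Y$ and $X$ have absolute value at most $B$. (b) For all $c>0$ and $M$ there is a constant $K$ such that, whenever the setting above holds, $\hat Q$ is a multiple of $Q$, $\hat R\ge R$, $\hat W\ge\sigma$ and $$N>\tfrac12(2n+p)\Bigl(2n+p+10\log\hat Q+10\log\bigl(2^N\sigma+\hat Rp\bigr)+20\log\bigl(3(1+c)np\bigr)\Bigr),$$ then, with respect to the randomness of the data and of $Z$, the LBR algorithm with input $(Y,X,N,\hat Q,\hat R,\hat W)$ terminates within time $A\,S^D$ with output exactly $\beta^*$, except with probability at most $K\bigl(\frac1{np}+e^{-\kappa p}\bigr)$; and this exceptional probability is at most $\frac{K}{np}$ whenever $n\le e^{\kappa p}$. -/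

import Mathlib

open MeasureTheory ProbabilityTheory

noncomputable section

namespace LatticeRegression

/-! ### Cost model

A program is a value of type `Timed α`: a result together with the number of bit operations spent.
Every operation on an integer or rational datum is performed through one of the primitives below,
which charge for it according to the binary length of the operands: linearly for addition,
subtraction and comparison of integers, quadratically for multiplication and division of integers,
and cubically for one rational operation (which pays for the cross multiplications and for Euclid's
algorithm that brings the result to lowest terms). Each turn of a loop costs one further step. -/

/-- A result together with the number of bit operations spent on it. -/
structure Timed (α : Type) where
  val : α
  cost : ℕ

instance : Monad Timed where
  pure a := ⟨a, 0⟩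
  bind x f := ⟨(f x.val).val, x.cost + (f x.val).cost⟩

/-- Spend `k` steps. -/
def tick (k : ℕ) : Timed Unit := ⟨(), k⟩

/-- Number of binary digits of an integer, with one more for the sign. -/
def bitLen (z : ℤ) : ℕ := Nat.size z.natAbs + 1

/-- Number of binary digits of a rational number in lowest terms. -/
def ratLen (q : ℚ) : ℕ := bitLen q.num + bitLen q.den

def zAdd (x y : ℤ) : Timed ℤ := ⟨x + y, bitLen x + bitLen y⟩
def zSub (x y : ℤ) : Timed ℤ := ⟨x - y, bitLen x + bitLen y⟩
def zLt (x y : ℤ) : Timed Bool := ⟨decide (x < y), bitLen x + bitLen y⟩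
def zMul (x y : ℤ) : Timed ℤ := ⟨x * y, bitLen x * bitLen y⟩
def zDiv (x y : ℤ) : Timed ℤ := ⟨x / y, bitLen x * bitLen y⟩
def zNeg (x : ℤ) : Timed ℤ := ⟨-x, bitLen x⟩
def zAbs (x : ℤ) : Timed ℤ := ⟨|x|, bitLen x⟩

def qAdd (x y : ℚ) : Timed ℚ := ⟨x + y, (ratLen x + ratLen y) ^ 3⟩
def qSub (x y : ℚ) : Timed ℚ := ⟨x - y, (ratLen x + ratLen y) ^ 3⟩
def qMul (x y : ℚ) : Timed ℚ := ⟨x * y, (ratLen x + ratLen y) ^ 3⟩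
def qDiv (x y : ℚ) : Timed ℚ := ⟨x / y, (ratLen x + ratLen y) ^ 3⟩
def qLt (x y : ℚ) : Timed Bool := ⟨decide (x < y), (ratLen x + ratLen y) ^ 3⟩
/-- Rounding to the nearest integer. -/
def qRound (x : ℚ) : Timed ℤ := ⟨round x, ratLen x ^ 3⟩
/-- Copying an integer into a rational register. -/
def zToRat (x : ℤ) : Timed ℚ := ⟨x, bitLen x⟩

/-- `for i in l do s := f i s`. -/
def loop {ι α : Type} : List ι → α → (ι → α → Timed α) → Timed α
  | [], s, _ => pure s
  | i :: l, s, f => do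
      tick 1
      let s' ← f i s
      loop l s' f

/-- Compute the entries `f 0, …, f (k - 1)` of a vector one after the other. -/
def buildVec {k : ℕ} {α : Type} (f : Fin k → Timed α) : Timed (Fin k → α) :=
  ⟨fun i => (f i).val, ∑ i, ((f i).cost + 1)⟩

/-! ### The Lenstra–Lenstra–Lovász algorithm

The lattice basis is a family `b` of `k` integer vectors of length `l`. The algorithm alternates
between a complete size reduction of the basis and one exchange of two consecutive vectors for which
the Lovász condition with parameter `3 / 4` fails, until there are none. -/

def dot {l : ℕ} (u v : Fin l → ℚ) : Timed ℚ :=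
  loop (List.finRange l) 0 fun t s => do
    let m ← qMul (u t) (v t)
    qAdd s m

/-- The Gram–Schmidt coefficient `⟨v, u⟩ / ⟨u, u⟩`. -/
def gsCoeff {l : ℕ} (v : Fin l → ℤ) (u : Fin l → ℚ) : Timed ℚ := do
  let w ← buildVec fun t => zToRat (v t)
  let a ← dot w u
  let q ← dot u u
  qDiv a q

/-- The Gram–Schmidt orthogonalization (without normalization)
`b*_i = b_i - ∑_{j < i} (⟨b_i, b*_j⟩ / ⟨b*_j, b*_j⟩) b*_j`. -/
def gramSchmidt {k l : ℕ} (b : Fin k → Fin l → ℤ) : Timed (Fin k → Fin l → ℚ) :=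
  loop (List.finRange k) (fun _ _ => 0) fun i G => do
    let w ← buildVec fun t => zToRat (b i t)
    let v ← loop (List.finRange k) w fun j v =>
      if j < i then do
        let c ← gsCoeff (b i) (G j)
        buildVec fun t => do
          let m ← qMul c (G j t)
          qSub (v t) m
      else pure v
    pure (Function.update G i v)

/-- For each `i`, and for `j = i - 1, …, 0`, subtract from `b_i` the multiple of `b_j` by the nearest
integer to the current Gram–Schmidt coefficient; `G` is the orthogonalization of `b`, which this
does not change. -/
def sizeReduce {k l : ℕ} (G : Fin k → Fin l → ℚ) (b : Fin k → Fin l → ℤ) :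
    Timed (Fin k → Fin l → ℤ) :=
  loop (List.finRange k) b fun i b =>
    loop (List.finRange k).reverse b fun j b =>
      if j < i then do
        let c ← gsCoeff (b i) (G j)
        let r ← qRound c
        let v ← buildVec fun t => do
          let m ← zMul r (b j t)
          zSub (b i t) m
        pure (Function.update b i v)
      else pure b

/-- Test whether `|b*_j + μ b*_i|² < (3/4) |b*_i|²`, where `j = i + 1` and `μ` is the Gram–Schmidt
coefficient of `b_j` along `b*_i`. -/
def lovaszFails {k l : ℕ} (G : Fin k → Fin l → ℚ) (b : Fin k → Fin l → ℤ) (i j : Fin k) :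
    Timed Bool := do
  let Bi ← dot (G i) (G i)
  let Bj ← dot (G j) (G j)
  let c ← gsCoeff (b j) (G i)
  let c2 ← qMul c c
  let m ← qMul c2 Bi
  let lhs ← qAdd Bj m
  let rhs ← qMul (3 / 4) Bi
  qLt lhs rhs

/-- The first index `j ≥ 1` such that the Lovász condition fails for `j - 1` and `j`, as the pair
`(j - 1, j)`. -/
def findSwap {k l : ℕ} (G : Fin k → Fin l → ℚ) (b : Fin k → Fin l → ℤ) :
    Timed (Option (Fin k × Fin k)) :=
  loop (List.finRange k) none fun j r =>
    match r with
    | some s => pure (some s)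
    | none =>
      if 0 < j.val then do
        let i : Fin k := ⟨j.val - 1, by omega⟩
        let t ← lovaszFails G b i j
        if t then pure (some (i, j)) else pure none
      else pure none

/-- The LLL algorithm. It is a loop without an a priori bound; `fuel` is the number of turns after
which its execution is given up, with result `none`. If the result is `some _`, then result and cost
are the same for every larger `fuel`. -/
def lll {k l : ℕ} : ℕ → (Fin k → Fin l → ℤ) → Timed (Option (Fin k → Fin l → ℤ))
  | 0, _ => pure none
  | fuel + 1, b => do
      let G ← gramSchmidt b
      let b' ← sizeReduce G b
      let s ← findSwap G b'
      match s with
      | none => pure (some b')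
      | some (i, j) => do
          tick (k + l)
          lll fuel (b' ∘ Equiv.swap i j)

theorem lll_succ {k l : ℕ} (fuel : ℕ) : ∀ (b o : Fin k → Fin l → ℤ) (t : ℕ),
    lll fuel b = ⟨some o, t⟩ → lll (fuel + 1) b = ⟨some o, t⟩ := by
  induction fuel with
  | zero => intro b o t h; simp [lll, pure] at h
  | succ m ih =>
    intro b o t h
    rw [lll] at h ⊢
    simp only [bind] at h ⊢
    cases hs : (findSwap (gramSchmidt b).val (sizeReduce (gramSchmidt b).val b).val).val with
    | none => simpa [hs] using h
    | some s =>
      obtain ⟨i, j⟩ := s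
      simp only [hs] at h ⊢
      simp only [Timed.mk.injEq] at h ⊢
      have := ih _ o _ (show lll m _ = ⟨some o, _⟩ by rw [← h.1])
      rw [this]
      exact ⟨rfl, h.2⟩

/-! ### The extended Lagarias–Odlyzko algorithm -/

/-- Euclid's algorithm. -/
def euclid (a b : ℕ) : Timed ℕ :=
  if h : b = 0 then pure a
  else do
    tick (bitLen a * bitLen b)
    euclid b (a % b)
termination_by b
decreasing_by exact Nat.mod_lt _ (Nat.pos_of_ne_zero h)

/-- A generator of the ideal generated by the entries of an integer vector: the greatest common
divisor, computed by Euclid's algorithm, with the sign of the first entry of the vector. -/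
def gcdVec {p : ℕ} (x : Fin p → ℤ) : Timed ℤ := do
  let g ← loop (List.finRange p) 0 fun j g => euclid (x j).natAbs g
  if h : 0 < p then do
    let neg ← zLt (x ⟨0, h⟩) 0
    if neg then zNeg g else pure (g : ℤ)
  else pure (g : ℤ)

/-- `⌈√k⌉`, as the least `s` such that `k ≤ s ^ 2`, by linear search. -/
def ceilSqrt (k : ℕ) : Timed ℤ :=
  loop (List.range k) 0 fun _ s => do
    let q ← zMul s s
    let t ← zLt q k
    if t then zAdd s 1 else pure s

/-- `2 ^ k`, by repeated doubling. -/
def twoPow (k : ℕ) : Timed ℤ :=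
  loop (List.range k) 1 fun _ s => zAdd s s

/-- The columns of the `(n + p + n) × (n + p + n)` matrix
```
  m X   -m Diag(Y)   m I
   I        0         0
   0        0         I
```
The arguments are `mX = m X` and `mY = -m Y`. -/
def latticeBasis {n p : ℕ} (m : ℤ) (mX : Fin n → Fin p → ℤ) (mY : Fin n → ℤ) :
    Fin (p + n + n) → Fin (n + p + n) → ℤ :=
  Fin.append
    (Fin.append
      (fun j : Fin p => Fin.append (Fin.append (fun i => mX i j) (Pi.single j 1)) 0)
      (fun i : Fin n => Fin.append (Fin.append (Pi.single i (mY i)) 0) 0))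
    (fun i : Fin n => Fin.append (Fin.append (Pi.single i m) 0) (Pi.single i 1))

/-- The ELO algorithm with input `(Y, X, R, W)`, when the random vector drawn in its first step is
`Z`; `fuel` is passed to the LLL algorithm. The first charge is for drawing `p` random integers of
the size of `2 R + log p`. -/
def elo {n p : ℕ} (fuel : ℕ) (Y : Fin n → ℤ) (X : Fin n → Fin p → ℤ) (R W : ℤ) (Z : Fin p → ℤ) :
    Timed (Option (Fin p → ℤ)) := do
  tick (p * bitLen (2 * R + Nat.log 2 p))
  let Y₁ ← buildVec fun i => loop (List.finRange p) (Y i) fun j s => do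
    let t ← zMul (X i j) (Z j)
    zAdd s t
  let Y₂ ← buildVec fun i => do
    let a ← zAbs (Y₁ i)
    let small ← zLt a 3
    if small then pure 3 else pure (Y₁ i)
  -- `m = 2 ^ (n + ⌈p / 2⌉ + 3) * p * (R ⌈√p⌉ + W ⌈√n⌉)`
  let e ← twoPow (n + (p + 1) / 2 + 3)
  let rp ← ceilSqrt p
  let rn ← ceilSqrt n
  let u ← zMul R rp
  let v ← zMul W rn
  let w ← zAdd u v
  let ep ← zMul e p
  let m ← zMul ep w
  let mX ← buildVec fun i => buildVec fun j => zMul m (X i j)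
  let mY ← buildVec fun i => zMul (-m) (Y₂ i)
  tick ((n + p + n) * (n + p + n))
  let out ← lll fuel (latticeBasis m mX mY)
  match out with
  | none => pure none
  | some b => do
      -- the coordinates `n + 1, …, n + p` of the first vector of the reduced basis
      let x : Fin p → ℤ := fun j =>
        b ⟨0, by have := j.isLt; omega⟩ (Fin.castAdd n (Fin.natAdd n j))
      let g ← gcdVec x
      if g ≠ 0 then do
        let r ← buildVec fun j => do
          let q ← zDiv (x j) g
          zSub q (Z j)
        pure (some r)
      else pure (some 0)

/-- The distribution of the random vector drawn by the ELO algorithm with parameter `R`: independent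
coordinates, uniform in `{R + 1, …, 2 R + ⌊log₂ p⌋}`. -/
def seedLaw (p : ℕ) (R : ℤ) : Measure (Fin p → ℤ) :=
  Measure.pi fun _ => uniformOn (Set.Icc (R + 1) (2 * R + Nat.log 2 p))

/-! ### The lattice-based regression algorithm -/

/-- `x_N = sign(x) ⌊2 ^ N |x|⌋ / 2 ^ N`: the number `x` with only its first `N` bits after zero. -/
def trunc (N : ℕ) (x : ℝ) : ℝ := SignType.sign x * ⌊2 ^ N * |x|⌋ / 2 ^ N

/-- The integer `2 ^ N x_N`. -/
def truncInt (N : ℕ) (x : ℝ) : ℤ := SignType.sign x * ⌊2 ^ N * |x|⌋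

theorem truncInt_eq (N : ℕ) (x : ℝ) : (truncInt N x : ℝ) = 2 ^ N * trunc N x := by
  unfold truncInt trunc
  push_cast
  rcases lt_trichotomy x 0 with h | h | h
  · simp [h]; field_simp
  · simp [h]
  · simp [h]; field_simp

/-- Reading a real number up to its first `N` bits after zero. -/
def readReal (N : ℕ) (x : ℝ) : Timed ℤ := ⟨truncInt N x, N + bitLen (truncInt N x)⟩

/-- Reading a real number up to its first `N` bits after zero, rounded up. -/
def readRealUp (N : ℕ) (x : ℝ) : Timed ℤ := ⟨⌈2 ^ N * x⌉, N + bitLen ⌈2 ^ N * x⌉⟩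

/-- The LBR algorithm with input `(Y, X, N, Q, R, W)`: the result of the ELO algorithm for the input
`(2 ^ N Q Y_N, 2 ^ N X_N, Q R, 2 Q (2 ^ N W + R p))`, divided by `Q`. -/
def lbr {n p : ℕ} (fuel : ℕ) (Y : Fin n → ℝ) (X : Fin n → Fin p → ℝ) (N Q R : ℕ) (W : ℝ)
    (Z : Fin p → ℤ) : Timed (Option (Fin p → ℚ)) := do
  let Y' ← buildVec fun i => do
    let y ← readReal N (Y i)
    zMul Q y
  let X' ← buildVec fun i => buildVec fun j => readReal N (X i j)
  let R' ← zMul Q R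
  let w ← readRealUp N W
  let u ← zMul R p
  let v ← zAdd w u
  let Q₂ ← zMul 2 Q
  let W' ← zMul Q₂ v
  let out ← elo fuel Y' X' R' W' Z
  match out with
  | none => pure none
  | some b => do
      let r ← buildVec fun j => qDiv (b j) Q
      pure (some r)

/-- The LBR algorithm with input `(Y, X, N, Q, R, W)` and random vector `Z` terminates after `t` bit
operations with output `out`. -/
def LBRReturns {n p : ℕ} (Y : Fin n → ℝ) (X : Fin n → Fin p → ℝ) (N Q R : ℕ) (W : ℝ)
    (Z : Fin p → ℤ) (out : Fin p → ℚ) (t : ℕ) : Prop :=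
  ∃ fuel, lbr fuel Y X N Q R W Z = ⟨some out, t⟩

/-- `n + p + N + log Q + log R + log W` (with `0` in place of `log W` if `W < 1`); logarithms are to
base 2. -/
def sizeParam (n p N Q R : ℕ) (W : ℝ) : ℝ :=
  n + p + N + Real.logb 2 Q + Real.logb 2 R + max 0 (Real.logb 2 W)

/-! ### The regression model -/

/-- The `Q`-rationality assumption. -/
def QRational {p : ℕ} (Q : ℕ) (β : Fin p → ℝ) : Prop := ∀ j, ∃ k : ℤ, β j = k / Q

/-- The entries of the random matrix `X` are independent, each distributed with density `f`, where
`0 ≤ f ≤ c` (almost everywhere) and a random variable with density `f` has a finite first absolute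
moment that is at most `M`. -/
structure IsDesign {Ω : Type*} [MeasurableSpace Ω] (μ : Measure Ω) {n p : ℕ}
    (X : Ω → Fin n → Fin p → ℝ) (f : ℝ → ℝ) (c M : ℝ) : Prop where
  measurable_density : Measurable f
  nonneg : ∀ x, 0 ≤ f x
  bounded : ∀ᵐ x, f x ≤ c
  integrable : Integrable fun x => |x| * f x
  moment_le : ∫ x, |x| * f x ≤ M
  measurable : ∀ i j, Measurable fun ω => X ω i j
  indep : iIndepFun (fun (ij : Fin n × Fin p) ω => X ω ij.1 ij.2) μ
  law : ∀ i j, μ.map (fun ω => X ω i j) = volume.withDensity fun x => ENNReal.ofReal (f x)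

/-- The event, in terms of the data `ω` and the internal randomness `Z` of the algorithm, that it is
not the case that LBR terminates with output `β` within `T` bit operations. -/
def failure {Ω : Type*} {n p : ℕ} (Y : Ω → Fin n → ℝ) (X : Ω → Fin n → Fin p → ℝ) (N Q R : ℕ)
    (W : ℝ) (β : Fin p → ℝ) (T : ℝ) : Set (Ω × (Fin p → ℤ)) :=
  {ω | ¬ ∃ (out : Fin p → ℚ) (t : ℕ), LBRReturns (Y ω.1) (X ω.1) N Q R W ω.2 out t ∧
    (∀ j, (out j : ℝ) = β j) ∧ (t : ℝ) ≤ T}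

end LatticeRegression

end

/-!
The idea is that the regression vector, scaled by `Q` and shifted by the random vector `Z`, gives a
very short vector in a lattice in which there are no other short vectors except its multiples.

*Running time.* All computations are carried out in a monad that counts bit operations, so that
termination and polynomial time are statements about the Lean program of the algorithm. The analysis
of lattice reduction rests on the Gram determinants `d_s` of the initial segments of a basis. They are
positive integers, they do not change in size reductions, and an exchange multiplies one of them by
less than `3 / 4` and keeps the others (`potential_swap_lt`). Hence their product bounds the number of
exchanges. By Cramer's rule, `d_i` is a common denominator of the `i`th orthogonalized vector
(`gramDet_mul_int`), and `1 / d_i` bounds its squared norm from below. This bounds the numerators and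
denominators of all rational numbers that occur, also during a size reduction, where the vector under
reduction grows by a bounded factor in each step (`sizeReduce_spec`). The number of bit operations is
at most a power of the size of the input (`lll_spec`, `exists_lll_eq`, `exists_elo_eq`,
`exists_lbr_eq_sizeParam`). The first vector of the reduced basis is a shortest nonzero lattice vector
up to an exponential factor (`IsReduced.normSq_le`).

*Recovery.* Put `γ = Q β + Z`, an integer vector with positive entries. The lattice contains a vector
with the coordinates `0`, `γ` and the noise of the integer problem. So the vector found by the
algorithm is short: its coordinates are at most `M₀` (`coordBound`) and less than the multiplier `m`.
Its first block consists of multiples of `m` and therefore vanishes, which means that its middle block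
`x` satisfies `X' x = λ y - w` with integers `λ_i` and a short vector `w`, where `y ≈ X' γ` are the
shifted observations. If `x` is a nonzero multiple of `γ` and `γ` is primitive, then the greatest
common divisor of the entries of `x`, with the sign of the first one, recovers `γ` and hence the
regression vector (`eloOutput_eq_sub`). If `x` is not a multiple of `γ`, then
`X_i (x - λ_i γ)` is tiny for each row `X_i` of the design, although `x - λ_i γ` is a nonzero integer
vector (`eloOutput_eq_of_good`).

*Probability.* A linear form in a row of the design with some coefficient of absolute value at least
1 has a density bounded by `c` (`DensityLE.pi_abs_sum_le`). The rows being independent, a union bound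
over `x` and, in each row, over `λ_i` shows that the last case is improbable, as soon as the precision
`N` is as large as assumed (`DensityLE.measure_hasSpurious_le`, `PrecisionLarge.union_bound`). By the
same bound for densities and Markov's inequality, the probability that some form `X_i γ` is too small
or some entry of the design is too large is of the order of `1 / (n p)`. All of this concerns the
design for a fixed `Z` and makes no assumption on the noise beyond its size. Finally, for a fixed `β`
and `p ≥ 2`, an integer `l ≥ 2` not larger than the possible entries of `γ` divides all of them with
probability at most `min (3 / 4) (4 / l) ^ p`, so `γ` is primitive except with probability `O((3 / 4) ^ p)` (`seedLaw_gcd_ne_one_le`).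
-/

namespace LatticeRegression

/-! ### Timed computations -/

@[simp] theorem val_pure {α : Type} (a : α) : (pure a : Timed α).val = a := rfl
@[simp] theorem cost_pure {α : Type} (a : α) : (pure a : Timed α).cost = 0 := rfl
@[simp] theorem val_bind {α β : Type} (x : Timed α) (f : α → Timed β) :
    (x >>= f).val = (f x.val).val := rfl
@[simp] theorem cost_bind {α β : Type} (x : Timed α) (f : α → Timed β) :
    (x >>= f).cost = x.cost + (f x.val).cost := rfl
@[simp] theorem cost_tick (k : ℕ) : (tick k).cost = k := rfl
@[simp] theorem val_buildVec {k : ℕ} {α : Type} (f : Fin k → Timed α) :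
    (buildVec f).val = fun i => (f i).val := rfl

theorem Timed.eq_mk {α : Type} (x : Timed α) : x = ⟨x.val, x.cost⟩ := rfl

theorem cost_buildVec_le {k : ℕ} {α : Type} (f : Fin k → Timed α) {C : ℕ}
    (h : ∀ i, (f i).cost ≤ C) : (buildVec f).cost ≤ k * (C + 1) := by
  have : ∑ i : Fin k, ((f i).cost + 1) ≤ ∑ _i : Fin k, (C + 1) :=
    Finset.sum_le_sum fun i _ => Nat.succ_le_succ (h i)
  simpa [buildVec] using this

theorem val_loop_cons {ι α : Type} (i : ι) (l : List ι) (s : α) (f : ι → α → Timed α) :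
    (loop (i :: l) s f).val = (loop l (f i s).val f).val := rfl

theorem cost_loop_cons {ι α : Type} (i : ι) (l : List ι) (s : α) (f : ι → α → Timed α) :
    (loop (i :: l) s f).cost = 1 + ((f i s).cost + (loop l (f i s).val f).cost) := rfl

theorem loop_map {ι κ α : Type} (g : ι → κ) (l : List ι) (f : κ → α → Timed α) :
    ∀ s : α, loop (l.map g) s f = loop l s fun i => f (g i) := by
  induction l with
  | nil => intro s; rfl
  | cons i l ih =>
    intro s
    simp only [List.map_cons, loop, ih]

/-- Invariants for a loop: if `P t` holds after `t` turns and each turn costs at most `C`. -/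
theorem loop_invariant {ι α : Type} (C : ℕ) (f : ι → α → Timed α) (l : List ι) :
    ∀ (P : ℕ → α → Prop) (s : α), P 0 s →
      (∀ t < l.length, ∀ i ∈ l, ∀ s, P t s → P (t + 1) (f i s).val ∧ (f i s).cost ≤ C) →
      P l.length (loop l s f).val ∧ (loop l s f).cost ≤ l.length * (C + 1) := by
  induction l with
  | nil => intro P s h0 _; exact ⟨h0, by simp [loop]⟩
  | cons i l ih =>
    intro P s h0 h
    have h1 := h 0 (by simp) i (by simp) s h0
    have h2 := ih (fun t => P (t + 1)) (f i s).val h1.1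
      (fun t ht j hj s hs => h (t + 1) (by simpa using ht) j (by simp [hj]) s hs)
    rw [val_loop_cons, cost_loop_cons, List.length_cons]
    refine ⟨h2.1, ?_⟩
    have := h1.2
    have := h2.2
    rw [Nat.succ_mul]
    omega

/-- Invariants for a loop over `0, …, k - 1`. -/
theorem loop_finRange {k : ℕ} {α : Type} (C : ℕ) :
    ∀ (P : ℕ → α → Prop) (f : Fin k → α → Timed α) (s : α), P 0 s →
      (∀ (i : Fin k) (s : α), P i s → P (i + 1) (f i s).val ∧ (f i s).cost ≤ C) →
      P k (loop (List.finRange k) s f).val ∧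
        (loop (List.finRange k) s f).cost ≤ k * (C + 1) := by
  induction k with
  | zero => intro P f s h0 _; exact ⟨h0, by simp [loop]⟩
  | succ k ih =>
    intro P f s h0 h
    have h1 := h 0 s h0
    have h2 := ih (fun t => P (t + 1)) (fun i => f i.succ) (f 0 s).val h1.1
      (fun i s hs => by simpa using h i.succ s (by simpa using hs))
    rw [List.finRange_succ, val_loop_cons, cost_loop_cons, loop_map]
    refine ⟨h2.1, ?_⟩
    have := h1.2
    have := h2.2
    rw [Nat.succ_mul]
    omega

/-- Invariants for a loop over `k - 1, …, 0`. -/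
theorem loop_finRange_reverse {k : ℕ} {α : Type} (C : ℕ) :
    ∀ (P : ℕ → α → Prop) (f : Fin k → α → Timed α) (s : α), P k s →
      (∀ (i : Fin k) (s : α), P (i + 1) s → P i (f i s).val ∧ (f i s).cost ≤ C) →
      P 0 (loop (List.finRange k).reverse s f).val ∧
        (loop (List.finRange k).reverse s f).cost ≤ k * (C + 1) := by
  induction k with
  | zero => intro P f s h0 _; exact ⟨h0, by simp [loop]⟩
  | succ k ih =>
    intro P f s h0 h
    have h1 := h (Fin.last k) s h0
    have h2 := ih P (fun i => f i.castSucc) (f (Fin.last k) s).val h1.1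
      (fun i s hs => by simpa using h i.castSucc s (by simpa using hs))
    rw [List.finRange_succ_last, List.reverse_append, List.reverse_singleton,
      List.singleton_append, ← List.map_reverse, val_loop_cons, cost_loop_cons, loop_map]
    refine ⟨h2.1, ?_⟩
    have := h1.2
    have := h2.2
    rw [Nat.succ_mul]
    omega

/-! ### Binary lengths and heights -/

theorem bitLen_le {z : ℤ} {s : ℕ} (h : |z| ≤ 2 ^ s) : bitLen z ≤ s + 2 := by
  have : z.natAbs ≤ 2 ^ s := by
    zify; simpa using h
  have := Nat.size_le_size this
  rw [Nat.size_pow] at this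
  unfold bitLen; omega

/-- Numerator and denominator of `q` are at most `2 ^ s` in absolute value. -/
def HeightLE (s : ℕ) (q : ℚ) : Prop := |q.num| ≤ 2 ^ s ∧ (q.den : ℤ) ≤ 2 ^ s

theorem ratLen_le {q : ℚ} {s : ℕ} (h : HeightLE s q) : ratLen q ≤ 2 * s + 4 := by
  have h1 := bitLen_le h.1
  have h2 : bitLen (q.den : ℤ) ≤ s + 2 := bitLen_le (by simpa using h.2)
  unfold ratLen; omega

theorem two_pow_mono {s t : ℕ} (h : s ≤ t) : (2 : ℤ) ^ s ≤ 2 ^ t :=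
  pow_le_pow_right₀ (by norm_num) h

theorem HeightLE.mono {s t : ℕ} {q : ℚ} (h : HeightLE s q) (hst : s ≤ t) : HeightLE t q :=
  ⟨h.1.trans (two_pow_mono hst), h.2.trans (two_pow_mono hst)⟩

/-- The height of a fraction is bounded by any of its representations. -/
theorem heightLE_of_eq_div {q : ℚ} {a b : ℤ} {s : ℕ} (hb : b ≠ 0) (hq : q = a / b)
    (ha : |a| ≤ 2 ^ s) (hb' : |b| ≤ 2 ^ s) : HeightLE s q := by
  rw [← Rat.divInt_eq_div] at hq
  subst hq
  constructor
  · rcases eq_or_ne a 0 with h | h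
    · subst h; simp
    · exact (Int.le_of_dvd (abs_pos.2 h) ((abs_dvd_abs _ _).2 (Rat.num_dvd a hb))).trans ha
  · exact (Int.le_of_dvd (abs_pos.2 hb) ((dvd_abs _ _).2 (Rat.den_dvd a b))).trans hb'

theorem heightLE_intCast {z : ℤ} {s : ℕ} : HeightLE s (z : ℚ) ↔ |z| ≤ 2 ^ s := by
  simp only [HeightLE, Rat.num_intCast, Rat.den_intCast, Nat.cast_one, and_iff_left_iff_imp]
  intro _
  exact one_le_pow₀ (by norm_num)

theorem heightLE_zero (s : ℕ) : HeightLE s 0 := by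
  have := (heightLE_intCast (z := 0) (s := s)).2 (by simp)
  simpa using this

theorem HeightLE.mul {s t : ℕ} {x y : ℚ} (hx : HeightLE s x) (hy : HeightLE t y) :
    HeightLE (s + t) (x * y) := by
  refine heightLE_of_eq_div (a := x.num * y.num) (b := x.den * y.den)
    (mul_ne_zero (by exact_mod_cast x.den_nz) (by exact_mod_cast y.den_nz)) ?_ ?_ ?_
  · conv_lhs => rw [← Rat.num_div_den x, ← Rat.num_div_den y]
    push_cast
    rw [div_mul_div_comm]
  · rw [abs_mul, pow_add]
    exact mul_le_mul hx.1 hy.1 (abs_nonneg _) (by positivity)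
  · rw [abs_mul, pow_add, Nat.abs_cast, Nat.abs_cast]
    exact mul_le_mul hx.2 hy.2 (by positivity) (by positivity)

theorem HeightLE.neg {s : ℕ} {x : ℚ} (hx : HeightLE s x) : HeightLE s (-x) := by
  simpa [HeightLE] using hx

theorem HeightLE.inv {s : ℕ} {x : ℚ} (hx : HeightLE s x) : HeightLE s x⁻¹ := by
  rcases eq_or_ne x 0 with h | h
  · subst h; simpa using hx
  · refine heightLE_of_eq_div (a := x.den) (b := x.num) (by simpa using h) ?_
      (by simpa using hx.2) hx.1
    conv_lhs => rw [← Rat.num_div_den x]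
    rw [inv_div]; norm_cast

theorem HeightLE.div {s t : ℕ} {x y : ℚ} (hx : HeightLE s x) (hy : HeightLE t y) :
    HeightLE (s + t) (x / y) := by
  rw [div_eq_mul_inv]
  exact hx.mul hy.inv

theorem HeightLE.add {s t : ℕ} {x y : ℚ} (hx : HeightLE s x) (hy : HeightLE t y) :
    HeightLE (s + t + 1) (x + y) := by
  have hx0 : (x.den : ℚ) ≠ 0 := by exact_mod_cast x.den_nz
  have hy0 : (y.den : ℚ) ≠ 0 := by exact_mod_cast y.den_nz
  refine heightLE_of_eq_div (a := x.num * y.den + y.num * x.den) (b := x.den * y.den)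
    (mul_ne_zero (by exact_mod_cast x.den_nz) (by exact_mod_cast y.den_nz)) ?_ ?_ ?_
  · conv_lhs => rw [← Rat.num_div_den x, ← Rat.num_div_den y]
    push_cast
    field_simp
    try ring
  · refine (abs_add_le _ _).trans ?_
    rw [abs_mul, abs_mul, Nat.abs_cast, Nat.abs_cast, pow_succ, pow_add, mul_two]
    refine add_le_add (mul_le_mul hx.1 hy.2 (by positivity) (by positivity)) ?_
    rw [mul_comm]
    exact mul_le_mul hx.2 hy.1 (by positivity) (by positivity)
  · rw [abs_mul, Nat.abs_cast, Nat.abs_cast]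
    calc (x.den : ℤ) * y.den ≤ 2 ^ s * 2 ^ t := mul_le_mul hx.2 hy.2 (by positivity) (by positivity)
      _ = 2 ^ (s + t) := (pow_add _ _ _).symm
      _ ≤ _ := two_pow_mono (by omega)

theorem HeightLE.sub {s t : ℕ} {x y : ℚ} (hx : HeightLE s x) (hy : HeightLE t y) :
    HeightLE (s + t + 1) (x - y) := by
  rw [sub_eq_add_neg]
  exact hx.add hy.neg

/-! ### Arithmetic of polynomial bounds

All costs are bounded by powers of one number `T ≥ 16`, to which end a sum of at most sixteen powers
of `T` is bounded by the next higher power. -/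

theorem cube_ratLen_le {T a s t : ℕ} (hT : 16 ≤ T) {x y : ℚ} (hx : HeightLE s x)
    (hy : HeightLE t y) (hs : s ≤ T ^ a) (ht : t ≤ T ^ a) :
    (ratLen x + ratLen y) ^ 3 ≤ T ^ (3 * a + 3) := by
  have h1 := ratLen_le hx
  have h2 := ratLen_le hy
  have h3 : 1 ≤ T ^ a := Nat.one_le_pow _ _ (by omega)
  have h4 : 16 * T ^ a ≤ T ^ (a + 1) := by
    rw [pow_succ, mul_comm]; exact Nat.mul_le_mul_left _ hT
  calc (ratLen x + ratLen y) ^ 3 ≤ (T ^ (a + 1)) ^ 3 := Nat.pow_le_pow_left (by omega) 3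
    _ = T ^ (3 * a + 3) := by rw [← pow_mul]; ring_nf

theorem mul_pow_le {T c a : ℕ} (hc : c ≤ T) : c * T ^ a ≤ T ^ (a + 1) := by
  rw [pow_succ, mul_comm]; exact Nat.mul_le_mul_left _ hc

theorem mul_succ_pow_le {T c a C : ℕ} (hT : 16 ≤ T) (hc : c ≤ T) (hC : C ≤ T ^ a) :
    c * (C + 1) ≤ T ^ (a + 2) := by
  have h3 : 1 ≤ T ^ a := Nat.one_le_pow _ _ (by omega)
  have h4 : 16 * T ^ a ≤ T ^ (a + 1) := mul_pow_le hT
  calc c * (C + 1) ≤ T * T ^ (a + 1) := Nat.mul_le_mul hc (by omega)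
    _ = T ^ (a + 2) := by ring


/-! ### Gram–Schmidt orthogonalization over the rational numbers -/

section GSO

open Finset Matrix

variable {k l : ℕ}

/-- The coefficient of the orthogonal projection of `v` to the line spanned by `u`. -/
def gs (v u : Fin l → ℚ) : ℚ := (v ⬝ᵥ u) / (u ⬝ᵥ u)

/-- `G` is the Gram–Schmidt orthogonalization of the linearly independent family `b`. -/
structure IsGSO (b G : Fin k → Fin l → ℚ) : Prop where
  orth : ∀ i j, i ≠ j → G i ⬝ᵥ G j = 0
  pos : ∀ i, 0 < G i ⬝ᵥ G i
  mem : ∀ i, b i - G i ∈ Submodule.span ℚ (G '' Set.Iio i)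

theorem dot_self_nonneg (v : Fin l → ℚ) : 0 ≤ v ⬝ᵥ v :=
  Finset.sum_nonneg fun _ _ => mul_self_nonneg _

theorem dot_sq_le (u v : Fin l → ℚ) : (u ⬝ᵥ v) ^ 2 ≤ (u ⬝ᵥ u) * (v ⬝ᵥ v) := by
  have := Finset.sum_mul_sq_le_sq_mul_sq (R := ℚ) univ u v
  simpa only [dotProduct, sq] using this

/-- A vector orthogonal to a set is orthogonal to its span. -/
theorem dot_eq_zero_of_mem_span {S : Set (Fin l → ℚ)} {v w : Fin l → ℚ}
    (hv : v ∈ Submodule.span ℚ S) (h : ∀ u ∈ S, u ⬝ᵥ w = 0) : v ⬝ᵥ w = 0 := by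
  induction hv using Submodule.span_induction with
  | mem x hx => exact h x hx
  | zero => simp
  | add x y _ _ hx hy => rw [add_dotProduct, hx, hy, add_zero]
  | smul a x _ hx => rw [smul_dotProduct, hx, smul_zero]

namespace IsGSO

variable {b G : Fin k → Fin l → ℚ}

theorem sub_dot (h : IsGSO b G) {i j : Fin k} (hij : i ≤ j) : (b i - G i) ⬝ᵥ G j = 0 := by
  refine dot_eq_zero_of_mem_span (h.mem i) ?_
  rintro _ ⟨s, hs, rfl⟩
  exact h.orth s j (ne_of_lt (lt_of_lt_of_le hs hij))

theorem dot_self (h : IsGSO b G) (i : Fin k) : b i ⬝ᵥ G i = G i ⬝ᵥ G i := by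
  have := h.sub_dot (le_refl i)
  rwa [sub_dotProduct, sub_eq_zero] at this

theorem dot_of_lt (h : IsGSO b G) {i j : Fin k} (hij : i < j) : b i ⬝ᵥ G j = 0 := by
  have := h.sub_dot hij.le
  rwa [sub_dotProduct, h.orth i j hij.ne, sub_zero] at this

theorem gs_self (h : IsGSO b G) (i : Fin k) : gs (b i) (G i) = 1 := by
  rw [gs, h.dot_self, div_self (h.pos i).ne']

theorem gs_of_lt (h : IsGSO b G) {i j : Fin k} (hij : i < j) : gs (b i) (G j) = 0 := by
  rw [gs, h.dot_of_lt hij, zero_div]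

/-- Vectors in the span of an orthogonal family are the sums of their projections. -/
theorem eq_sum_of_mem_span (h : IsGSO b G) (S : Finset (Fin k)) {v : Fin l → ℚ}
    (hv : v ∈ Submodule.span ℚ (G '' S)) : v = ∑ j ∈ S, gs v (G j) • G j := by
  induction hv using Submodule.span_induction with
  | mem x hx =>
    obtain ⟨i, hi, rfl⟩ := hx
    rw [Finset.sum_eq_single_of_mem i hi]
    · rw [gs, div_self (h.pos i).ne', one_smul]
    · intro j _ hj
      rw [gs, h.orth i j hj.symm, zero_div, zero_smul]
  | zero => simp [gs]
  | add x y _ _ hx hy =>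
    conv_lhs => rw [hx, hy]
    rw [← Finset.sum_add_distrib]
    refine Finset.sum_congr rfl fun j _ => ?_
    rw [gs, gs, gs, add_dotProduct, add_div, add_smul]
  | smul a x _ hx =>
    conv_lhs => rw [hx]
    rw [Finset.smul_sum]
    refine Finset.sum_congr rfl fun j _ => ?_
    rw [gs, gs, smul_dotProduct, smul_eq_mul, mul_div_assoc, mul_smul]

theorem rep (h : IsGSO b G) (i : Fin k) :
    b i = G i + ∑ j ∈ Iio i, gs (b i) (G j) • G j := by
  have h1 := h.eq_sum_of_mem_span (Iio i) (v := b i - G i) (by simpa using h.mem i)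
  rw [← sub_eq_iff_eq_add', h1]
  refine Finset.sum_congr rfl fun j hj => ?_
  rw [gs, gs, sub_dotProduct, h.orth i j (ne_of_gt (Finset.mem_Iio.1 hj)), sub_zero]

theorem rep_univ (h : IsGSO b G) (i : Fin k) : b i = ∑ j, gs (b i) (G j) • G j := by
  conv_lhs => rw [h.rep i]
  have h1 : ∑ j ∈ Iic i, gs (b i) (G j) • G j = ∑ j, gs (b i) (G j) • G j := by
    refine Finset.sum_subset (Finset.subset_univ _) fun j _ hj => ?_
    rw [h.gs_of_lt (by simpa using hj), zero_smul]
  rw [← h1, ← Finset.Iio_insert, Finset.sum_insert (by simp), h.gs_self, one_smul]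

/-- Pythagoras. -/
theorem dot_sum (h : IsGSO b G) (S : Finset (Fin k)) (a c : Fin k → ℚ) :
    (∑ j ∈ S, a j • G j) ⬝ᵥ (∑ j ∈ S, c j • G j) = ∑ j ∈ S, a j * c j * (G j ⬝ᵥ G j) := by
  rw [sum_dotProduct]
  refine Finset.sum_congr rfl fun i hi => ?_
  rw [dotProduct_sum, Finset.sum_eq_single_of_mem i hi]
  · rw [smul_dotProduct, dotProduct_smul, smul_eq_mul, smul_eq_mul, mul_assoc]
  · intro j _ hj
    rw [smul_dotProduct, dotProduct_smul, h.orth i j hj.symm, smul_zero, smul_zero]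

theorem normSq (h : IsGSO b G) (i : Fin k) :
    b i ⬝ᵥ b i = G i ⬝ᵥ G i + ∑ j ∈ Iio i, gs (b i) (G j) ^ 2 * (G j ⬝ᵥ G j) := by
  have h1 : b i = ∑ j ∈ Iic i, gs (b i) (G j) • G j := by
    rw [← Finset.Iio_insert, Finset.sum_insert (by simp), h.gs_self, one_smul]
    exact h.rep i
  have h2 := h.dot_sum (Iic i) (fun j => gs (b i) (G j)) (fun j => gs (b i) (G j))
  rw [← h1, ← Finset.Iio_insert, Finset.sum_insert (by simp), h.gs_self] at h2
  simpa only [sq, one_mul] using h2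

theorem normSq_le (h : IsGSO b G) (i : Fin k) : G i ⬝ᵥ G i ≤ b i ⬝ᵥ b i := by
  rw [h.normSq i]
  exact le_add_of_nonneg_right
    (Finset.sum_nonneg fun j _ => mul_nonneg (sq_nonneg _) (h.pos j).le)

end IsGSO

theorem orth_mem_span {b G : Fin k → Fin l → ℚ}
    (h : ∀ i, b i - G i ∈ Submodule.span ℚ (G '' Set.Iio i)) (i : Fin k) :
    G i ∈ Submodule.span ℚ (b '' Set.Iic i) ∧ b i - G i ∈ Submodule.span ℚ (b '' Set.Iio i) := by
  induction i using WellFoundedLT.induction with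
  | ind i ih =>
  have h1 : b i - G i ∈ Submodule.span ℚ (b '' Set.Iio i) := by
    refine Submodule.span_le.2 ?_ (h i)
    rintro _ ⟨j, hj, rfl⟩
    refine Submodule.span_mono (Set.image_mono ?_) (ih j hj).1
    intro s hs
    exact lt_of_le_of_lt (Set.mem_Iic.1 hs) (Set.mem_Iio.1 hj)
  refine ⟨?_, h1⟩
  have h2 : b i ∈ Submodule.span ℚ (b '' Set.Iic i) :=
    Submodule.subset_span ⟨i, le_refl i, rfl⟩
  have h3 := Submodule.span_mono (R := ℚ)
    (Set.image_mono (f := b) (Set.Iio_subset_Iic_self (a := i))) h1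
  have := Submodule.sub_mem _ h2 h3
  rwa [sub_sub_cancel] at this

/-- The Gram–Schmidt orthogonalization, by its recursion. -/
def gso (b : Fin k → Fin l → ℚ) (i : Fin k) : Fin l → ℚ :=
  b i - ∑ j : Finset.Iio i, gs (b i) (gso b j) • gso b j
termination_by i
decreasing_by exact Fin.lt_def.1 (Finset.mem_Iio.1 j.2)

theorem gso_eq (b : Fin k → Fin l → ℚ) (i : Fin k) :
    gso b i = b i - ∑ j ∈ Finset.Iio i, gs (b i) (gso b j) • gso b j := by
  rw [gso, ← Finset.sum_coe_sort (Finset.Iio i) fun j => gs (b i) (gso b j) • gso b j]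

theorem isGSO_gso {b : Fin k → Fin l → ℚ} (hb : LinearIndependent ℚ b) : IsGSO b (gso b) := by
  have hmem : ∀ i, b i - gso b i ∈ Submodule.span ℚ (gso b '' Set.Iio i) := by
    intro i
    rw [gso_eq, sub_sub_cancel]
    exact Submodule.sum_mem _ fun j hj => Submodule.smul_mem _ _
      (Submodule.subset_span ⟨j, Finset.mem_Iio.1 hj, rfl⟩)
  have hne : ∀ i, gso b i ≠ 0 := by
    intro i h0
    have h1 := (orth_mem_span hmem i).2
    rw [h0, sub_zero] at h1
    exact hb.notMem_span_image (s := Set.Iio i) (x := i) (by simp) h1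
  have hpos : ∀ i, 0 < gso b i ⬝ᵥ gso b i := fun i =>
    lt_of_le_of_ne (dot_self_nonneg _) (Ne.symm (dotProduct_self_eq_zero.not.2 (hne i)))
  have horth : ∀ i j, j < i → gso b i ⬝ᵥ gso b j = 0 := by
    intro i
    induction i using WellFoundedLT.induction with
    | ind i ih =>
    intro j hj
    have hsum : (∑ s ∈ Finset.Iio i, gs (b i) (gso b s) • gso b s) ⬝ᵥ gso b j
        = b i ⬝ᵥ gso b j := by
      rw [sum_dotProduct, Finset.sum_eq_single_of_mem j (Finset.mem_Iio.2 hj)]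
      · rw [smul_dotProduct, gs, smul_eq_mul, div_mul_cancel₀ _ (hpos j).ne']
      · intro s hs hsj
        rw [smul_dotProduct]
        rcases lt_or_gt_of_ne hsj with h | h
        · rw [dotProduct_comm, ih j hj s h, smul_zero]
        · rw [ih s (Finset.mem_Iio.1 hs) j h, smul_zero]
    rw [gso_eq b i, sub_dotProduct, hsum, sub_self]
  refine ⟨fun i j hij => ?_, hpos, hmem⟩
  rcases lt_or_gt_of_ne hij with h | h
  · rw [dotProduct_comm, horth j i h]
  · exact horth i j h

/-! ### Gram determinants -/

/-- The Gram determinant of the first `s` vectors of the basis with orthogonalization `G`. -/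
def gramDet (G : Fin k → Fin l → ℚ) (s : ℕ) : ℚ :=
  ∏ j : Fin k, if (j : ℕ) < s then G j ⬝ᵥ G j else 1

/-- The integer vector `v` as a rational vector. -/
def ratVec (v : Fin l → ℤ) : Fin l → ℚ := fun t => v t

/-- The integer basis `b` as a rational basis. -/
def ratBasis (b : Fin k → Fin l → ℤ) : Fin k → Fin l → ℚ := fun i => ratVec (b i)

theorem ratVec_dot (u v : Fin l → ℤ) : ratVec u ⬝ᵥ ratVec v = ((u ⬝ᵥ v : ℤ) : ℚ) := by
  simp [ratVec, dotProduct]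

/-- The Gram matrix of the first `s` vectors of an integer basis. -/
def gramMat (b : Fin k → Fin l → ℤ) {s : ℕ} (hs : s ≤ k) : Matrix (Fin s) (Fin s) ℤ :=
  Matrix.of fun a c => b (Fin.castLE hs a) ⬝ᵥ b (Fin.castLE hs c)

/-- The Gram determinant is the determinant of the Gram matrix, and hence an integer. -/
theorem gramDet_eq_det {b : Fin k → Fin l → ℤ} {G : Fin k → Fin l → ℚ}
    (h : IsGSO (ratBasis b) G) {s : ℕ} (hs : s ≤ k) :
    gramDet G s = ((gramMat b hs).det : ℤ) := by
  set e : Fin s → Fin k := Fin.castLE hs with he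
  have hinj : Function.Injective e := Fin.castLE_injective hs
  have hrange : ∀ j : Fin k, j ∉ Set.range e ↔ ¬ (j : ℕ) < s := by
    intro j
    rw [not_iff_not]
    constructor
    · rintro ⟨a, rfl⟩; simp [he]
    · intro hj; exact ⟨⟨j, hj⟩, by simp [he]⟩
  let U : Matrix (Fin s) (Fin s) ℚ := Matrix.of fun a c => gs (ratBasis b (e a)) (G (e c))
  let D : Matrix (Fin s) (Fin s) ℚ := Matrix.diagonal fun c => G (e c) ⬝ᵥ G (e c)
  have hU' : ∀ a c, U a c = gs (ratBasis b (e a)) (G (e c)) := fun _ _ => rfl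
  -- `U` is unitriangular, so the determinant of `U D Uᵀ` is the one of the diagonal matrix `D`
  have hmat : (gramMat b hs).map (Int.castRingHom ℚ) = U * D * Uᵀ := by
    ext a c
    have h1 : (((b (e a) ⬝ᵥ b (e c) : ℤ)) : ℚ)
        = ∑ j : Fin k, gs (ratBasis b (e a)) (G j) * gs (ratBasis b (e c)) (G j)
          * (G j ⬝ᵥ G j) := by
      rw [← ratVec_dot, ← h.dot_sum univ, ← h.rep_univ, ← h.rep_univ]; rfl
    have h2 := Fintype.sum_of_injective e hinj
      (fun c' => gs (ratBasis b (e a)) (G (e c')) * gs (ratBasis b (e c)) (G (e c'))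
          * (G (e c') ⬝ᵥ G (e c')))
      (fun j => gs (ratBasis b (e a)) (G j) * gs (ratBasis b (e c)) (G j) * (G j ⬝ᵥ G j))
      (by
        intro j hj
        rw [hrange] at hj
        rw [h.gs_of_lt (i := e a), zero_mul, zero_mul]
        exact Fin.lt_def.2 (lt_of_lt_of_le (by simp [he]) (not_lt.1 hj)))
      (fun _ => rfl)
    simp only [Matrix.map_apply, gramMat, Matrix.of_apply, ← he, eq_intCast, h1, ← h2]
    rw [Matrix.mul_apply]
    refine Finset.sum_congr rfl fun j _ => ?_
    rw [Matrix.mul_diagonal, Matrix.transpose_apply, hU', hU']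
    ring
  have hU : U.det = 1 := by
    rw [Matrix.det_of_isLowerTriangular]
    · exact Finset.prod_eq_one fun a _ => h.gs_self _
    · intro a c hac
      exact h.gs_of_lt (Fin.lt_def.2 (by simpa [he] using hac))
  have hdet := congrArg Matrix.det hmat
  rw [Matrix.det_mul, Matrix.det_mul, Matrix.det_transpose, hU, Matrix.det_diagonal, one_mul,
    mul_one] at hdet
  have h3 : gramDet G s = ∏ c : Fin s, G (e c) ⬝ᵥ G (e c) := by
    rw [gramDet]
    refine (Fintype.prod_of_injective e hinj _ _ ?_ ?_).symm
    · intro j hj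
      rw [hrange] at hj
      rw [if_neg hj]
    · intro c
      rw [if_pos (by simp [he])]
  rw [h3, ← hdet]
  exact (RingHom.map_det (Int.castRingHom ℚ) (gramMat b hs)).symm

theorem gramDet_pos {b G : Fin k → Fin l → ℚ} (h : IsGSO b G) (s : ℕ) : 0 < gramDet G s := by
  refine Finset.prod_pos fun j _ => ?_
  split_ifs
  · exact h.pos j
  · exact one_pos

theorem one_le_gramDet {b : Fin k → Fin l → ℤ} {G : Fin k → Fin l → ℚ}
    (h : IsGSO (ratBasis b) G) {s : ℕ} (hs : s ≤ k) : 1 ≤ gramDet G s := by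
  have h1 := gramDet_pos h s
  rw [gramDet_eq_det h hs] at h1 ⊢
  exact_mod_cast h1

theorem gramDet_le {b : Fin k → Fin l → ℤ} {G : Fin k → Fin l → ℚ} (h : IsGSO (ratBasis b) G)
    {M : ℚ} (hM : ∀ i, G i ⬝ᵥ G i ≤ M) (hM1 : 1 ≤ M) (s : ℕ) : gramDet G s ≤ M ^ k := by
  have : gramDet G s ≤ ∏ _j : Fin k, M := by
    refine Finset.prod_le_prod (fun j _ => ?_) fun j _ => ?_
    · split_ifs
      · exact (h.pos j).le
      · exact zero_le_one
    · split_ifs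
      · exact hM j
      · exact hM1
  simpa using this

theorem gramDet_succ (G : Fin k → Fin l → ℚ) (i : Fin k) :
    gramDet G (i + 1) = gramDet G i * (G i ⬝ᵥ G i) := by
  rw [gramDet, gramDet, ← Finset.mul_prod_erase univ _ (Finset.mem_univ i),
    ← Finset.mul_prod_erase univ (fun j : Fin k => if (j : ℕ) < i then G j ⬝ᵥ G j else 1)
      (Finset.mem_univ i), if_pos (by simp), if_neg (by simp), one_mul, mul_comm]
  congr 1
  refine Finset.prod_congr rfl fun j hj => ?_
  have : (j : ℕ) ≠ i := fun hji => (Finset.mem_erase.1 hj).1 (Fin.ext hji)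
  by_cases hlt : (j : ℕ) < i
  · rw [if_pos hlt, if_pos (by omega)]
  · rw [if_neg hlt, if_neg (by omega)]

/-- The orthogonalized vectors cannot be very short. -/
theorem inv_le_normSq {b : Fin k → Fin l → ℤ} {G : Fin k → Fin l → ℚ}
    (h : IsGSO (ratBasis b) G) (i : Fin k) : 1 ≤ gramDet G i * (G i ⬝ᵥ G i) := by
  rw [← gramDet_succ]
  exact one_le_gramDet h i.isLt

/-- By Cramer's rule, the Gram determinant of the preceding vectors is a common denominator of an
orthogonalized vector. -/
theorem gramDet_mul_int {b : Fin k → Fin l → ℤ} {G : Fin k → Fin l → ℚ}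
    (h : IsGSO (ratBasis b) G) (i : Fin k) (t : Fin l) :
    ∃ z : ℤ, gramDet G i * G i t = z := by
  have hs : (i : ℕ) ≤ k := i.isLt.le
  set e : Fin (i : ℕ) → Fin k := Fin.castLE hs with he
  have hlt : ∀ a, e a < i := fun a => Fin.lt_def.2 (by simp [he])
  have hset : ratBasis b '' Set.Iio i = Set.range fun a => ratBasis b (e a) := by
    ext v
    constructor
    · rintro ⟨j, hj, rfl⟩
      exact ⟨⟨j, hj⟩, rfl⟩
    · rintro ⟨a, rfl⟩
      exact ⟨e a, hlt a, rfl⟩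
  -- `b_i - G_i` is a combination of the preceding vectors, and its coefficients `c` solve a system
  -- of linear equations whose matrix is the Gram matrix
  have hmem := (orth_mem_span h.mem i).2
  rw [hset, Submodule.mem_span_range_iff_exists_fun] at hmem
  obtain ⟨c, hc⟩ := hmem
  set A := gramMat b hs with hA
  let r : Fin (i : ℕ) → ℤ := fun a => b (e a) ⬝ᵥ b i
  have hAc : A.map (Int.castRingHom ℚ) *ᵥ c = fun a => ((r a : ℤ) : ℚ) := by
    ext a
    have h1 : ratBasis b (e a) ⬝ᵥ G i = 0 := h.dot_of_lt (hlt a)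
    have h2 : ratBasis b (e a) ⬝ᵥ (ratBasis b i - G i) = ratBasis b (e a) ⬝ᵥ ratBasis b i := by
      rw [dotProduct_sub, h1, sub_zero]
    rw [← hc, dotProduct_sum] at h2
    have h3 : ((r a : ℤ) : ℚ) = ratBasis b (e a) ⬝ᵥ ratBasis b i := (ratVec_dot _ _).symm
    rw [h3, ← h2]
    simp only [Matrix.mulVec, hA, gramMat, dotProduct_smul, smul_eq_mul]
    refine Finset.sum_congr rfl fun d _ => ?_
    rw [mul_comm]
    congr 1
    exact (ratVec_dot _ _).symm
  -- multiplication by the adjugate shows that the determinant is a denominator of the solution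
  have hadj : ∀ a, gramDet G i * c a = (((A.adjugate *ᵥ r) a : ℤ) : ℚ) := by
    intro a
    have h1 := congrArg (fun v => (A.map (Int.castRingHom ℚ)).adjugate *ᵥ v) hAc
    simp only [Matrix.mulVec_mulVec, Matrix.adjugate_mul] at h1
    have h2 := congrFun h1 a
    rw [Matrix.smul_mulVec, Matrix.one_mulVec, Pi.smul_apply, smul_eq_mul] at h2
    rw [gramDet_eq_det h hs, ← hA]
    have h3 : ((A.det : ℤ) : ℚ) = (A.map (Int.castRingHom ℚ)).det :=
      RingHom.map_det (Int.castRingHom ℚ) A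
    have h4 : (A.map (Int.castRingHom ℚ)).adjugate = A.adjugate.map (Int.castRingHom ℚ) :=
      (RingHom.map_adjugate (Int.castRingHom ℚ) A).symm
    rw [h3, h2, h4]
    simp [Matrix.mulVec, dotProduct]
  have hG : gramDet G i * G i t
      = gramDet G i * ratBasis b i t - ∑ a, gramDet G i * c a * ratBasis b (e a) t := by
    have h1 := congrFun hc t
    simp only [Finset.sum_apply, Pi.smul_apply, smul_eq_mul, Pi.sub_apply] at h1
    have : G i t = ratBasis b i t - ∑ a, c a * ratBasis b (e a) t := by rw [h1]; ring
    rw [this, mul_sub, Finset.mul_sum]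
    simp only [mul_assoc]
  rw [hG, gramDet_eq_det h hs, ← hA]
  refine ⟨A.det * b i t - ∑ a, (A.adjugate *ᵥ r) a * b (e a) t, ?_⟩
  rw [Int.cast_sub, Int.cast_mul, Int.cast_sum]
  congr 1
  refine Finset.sum_congr rfl fun a _ => ?_
  rw [Int.cast_mul, ← hadj, gramDet_eq_det h hs, ← hA]
  rfl

end GSO


/-! ### Size reduction and exchange steps -/

section Steps

open Finset Matrix

variable {k l : ℕ}

theorem gs_sub (u v w : Fin l → ℚ) : gs (u - v) w = gs u w - gs v w := by
  simp only [gs, sub_dotProduct, sub_div]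

theorem gs_smul (a : ℚ) (v w : Fin l → ℚ) : gs (a • v) w = a * gs v w := by
  simp only [gs, smul_dotProduct, smul_eq_mul, mul_div_assoc]

/-- Subtracting a multiple of an earlier vector does not change the orthogonalization. -/
theorem IsGSO.update_sub_smul {b G : Fin k → Fin l → ℚ} (h : IsGSO b G) {i j : Fin k}
    (hji : j < i) (r : ℚ) : IsGSO (Function.update b i (b i - r • b j)) G := by
  refine ⟨h.orth, h.pos, fun s => ?_⟩
  rcases eq_or_ne s i with rfl | hs
  · rw [Function.update_self]
    have h1 : b j ∈ Submodule.span ℚ (G '' Set.Iio s) := by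
      have h2 : b j - G j ∈ Submodule.span ℚ (G '' Set.Iio s) :=
        Submodule.span_mono (Set.image_mono (Set.Iio_subset_Iio hji.le)) (h.mem j)
      have h3 : G j ∈ Submodule.span ℚ (G '' Set.Iio s) :=
        Submodule.subset_span ⟨j, hji, rfl⟩
      simpa using Submodule.add_mem _ h2 h3
    have h4 := Submodule.sub_mem _ (h.mem s) (Submodule.smul_mem _ r h1)
    rwa [sub_right_comm] at h4
  · rw [Function.update_of_ne hs]
    exact h.mem s

/-- The orthogonalization after the exchange of `b_i` and `b_j`, where `j = i + 1`. -/
def swapGSO (b G : Fin k → Fin l → ℚ) (i j : Fin k) : Fin k → Fin l → ℚ :=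
  let u := G j + gs (b j) (G i) • G i
  Function.update (Function.update G i u) j (G i - gs (G i) u • u)

section Swap

variable {b G : Fin k → Fin l → ℚ} {i j : Fin k}

theorem swapGSO_left (hij : (j : ℕ) = i + 1) :
    swapGSO b G i j i = G j + gs (b j) (G i) • G i := by
  have : i ≠ j := fun h => by rw [h] at hij; omega
  rw [swapGSO, Function.update_of_ne this, Function.update_self]

theorem swapGSO_right :
    swapGSO b G i j j = G i - gs (G i) (G j + gs (b j) (G i) • G i)
      • (G j + gs (b j) (G i) • G i) := by
  rw [swapGSO, Function.update_self]

theorem swapGSO_of_ne {s : Fin k} (hi : s ≠ i) (hj : s ≠ j) : swapGSO b G i j s = G s := by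
  rw [swapGSO, Function.update_of_ne hj, Function.update_of_ne hi]

theorem dot_add_smul_self (h : IsGSO b G) (hne : j ≠ i) (c : ℚ) :
    (G j + c • G i) ⬝ᵥ (G j + c • G i) = G j ⬝ᵥ G j + c ^ 2 * (G i ⬝ᵥ G i) := by
  simp only [add_dotProduct, dotProduct_add, smul_dotProduct, dotProduct_smul, smul_eq_mul,
    h.orth j i hne, h.orth i j hne.symm]
  ring

theorem dot_add_smul_right (h : IsGSO b G) (hne : j ≠ i) (c : ℚ) :
    G i ⬝ᵥ (G j + c • G i) = c * (G i ⬝ᵥ G i) := by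
  simp only [dotProduct_add, dotProduct_smul, smul_eq_mul, h.orth i j hne.symm]
  ring

theorem dot_add_smul_self_pos (h : IsGSO b G) (hne : j ≠ i) (c : ℚ) :
    0 < (G j + c • G i) ⬝ᵥ (G j + c • G i) := by
  rw [dot_add_smul_self h hne]
  exact add_pos_of_pos_of_nonneg (h.pos j) (mul_nonneg (sq_nonneg _) (h.pos i).le)

theorem sub_gs_smul_dot {u v : Fin l → ℚ} (hu : 0 < u ⬝ᵥ u) : (v - gs v u • u) ⬝ᵥ u = 0 := by
  rw [sub_dotProduct, smul_dotProduct, smul_eq_mul, gs, div_mul_cancel₀ _ hu.ne', sub_self]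

/-- The product of the two squared norms involved does not change in an exchange. -/
theorem normSq_swap_mul (h : IsGSO b G) (hij : (j : ℕ) = i + 1) :
    (swapGSO b G i j i ⬝ᵥ swapGSO b G i j i) * (swapGSO b G i j j ⬝ᵥ swapGSO b G i j j)
      = (G i ⬝ᵥ G i) * (G j ⬝ᵥ G j) := by
  have hne : j ≠ i := fun h => by rw [h] at hij; omega
  rw [swapGSO_left hij, swapGSO_right]
  set c := gs (b j) (G i)
  have hpos := dot_add_smul_self_pos h hne c
  have h1 := dot_add_smul_self h hne c
  have h2 := dot_add_smul_right h hne c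
  set u := G j + c • G i
  have h3 : (G i - gs (G i) u • u) ⬝ᵥ (G i - gs (G i) u • u)
      = G i ⬝ᵥ G i - (G i ⬝ᵥ u) ^ 2 / (u ⬝ᵥ u) := by
    have h4 := sub_gs_smul_dot (v := G i) hpos
    rw [dotProduct_sub, dotProduct_smul, h4, smul_zero, sub_zero, sub_dotProduct, smul_dotProduct,
      smul_eq_mul, dotProduct_comm u (G i), gs]
    ring
  rw [h3, h2, mul_sub, mul_div_cancel₀ _ hpos.ne', h1]
  ring

theorem normSq_swap_right_le (h : IsGSO b G) (hij : (j : ℕ) = i + 1) :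
    swapGSO b G i j j ⬝ᵥ swapGSO b G i j j ≤ G i ⬝ᵥ G i := by
  have hne : j ≠ i := fun h => by rw [h] at hij; omega
  have h1 := normSq_swap_mul h hij
  have h2 : G j ⬝ᵥ G j ≤ swapGSO b G i j i ⬝ᵥ swapGSO b G i j i := by
    rw [swapGSO_left hij, dot_add_smul_self h hne]
    exact le_add_of_nonneg_right (mul_nonneg (sq_nonneg _) (h.pos i).le)
  have h3 := h.pos j
  have h4 := h.pos i
  by_contra! hlt
  have := mul_lt_mul_of_pos_left hlt h3
  have h5 := mul_le_mul_of_nonneg_right h2 (h4.le.trans hlt.le)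
  nlinarith

/-- `swapGSO` is the orthogonalization of the basis after the exchange. -/
theorem IsGSO.swap (h : IsGSO b G) (hij : (j : ℕ) = i + 1) :
    IsGSO (b ∘ Equiv.swap i j) (swapGSO b G i j) := by
  have hne : j ≠ i := fun h => by rw [h] at hij; omega
  have hlt : i < j := Fin.lt_def.2 (by omega)
  have hL := swapGSO_left (b := b) (G := G) hij
  have hR := swapGSO_right (b := b) (G := G) (i := i) (j := j)
  set c := gs (b j) (G i) with hc
  have hpos := dot_add_smul_self_pos h hne c
  set u := G j + c • G i with hu
  set w := G i - gs (G i) u • u with hw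
  have hN : ∀ s, s ≠ i → s ≠ j → swapGSO b G i j s = G s := fun s => swapGSO_of_ne
  have huw : w ⬝ᵥ u = 0 := sub_gs_smul_dot hpos
  have hou : ∀ s, s ≠ i → s ≠ j → G s ⬝ᵥ u = 0 := fun s h1 h2 => by
    rw [hu, dotProduct_add, dotProduct_smul, h.orth s j h2, h.orth s i h1, smul_zero, add_zero]
  have how : ∀ s, s ≠ i → s ≠ j → G s ⬝ᵥ w = 0 := fun s h1 h2 => by
    rw [hw, dotProduct_sub, dotProduct_smul, hou s h1 h2, h.orth s i h1, smul_zero, sub_zero]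
  have horth : ∀ s t, s < t → swapGSO b G i j s ⬝ᵥ swapGSO b G i j t = 0 := by
    intro s t hst
    rcases eq_or_ne s i with hs | hs
    · subst hs
      rw [hL]
      rcases eq_or_ne t j with ht | ht
      · subst ht; rw [hR, dotProduct_comm, huw]
      · rw [hN t hst.ne' ht, dotProduct_comm, hou t hst.ne' ht]
    · rcases eq_or_ne s j with hs' | hs'
      · subst hs'
        rw [hR, hN t (hlt.trans hst).ne' hst.ne', dotProduct_comm,
          how t (hlt.trans hst).ne' hst.ne']
      · rw [hN s hs hs']
        rcases eq_or_ne t i with ht | ht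
        · subst ht; rw [hL, hou s hs hs']
        · rcases eq_or_ne t j with ht' | ht'
          · subst ht'; rw [hR, how s hs hs']
          · rw [hN t ht ht', h.orth s t hst.ne]
  have hmul := normSq_swap_mul h hij
  rw [hL, hR] at hmul
  have hwpos : 0 < w ⬝ᵥ w := by
    have := mul_pos (h.pos i) (h.pos j)
    rw [← hmul] at this
    exact (mul_pos_iff_of_pos_left hpos).1 this
  -- the span of an initial segment of `G` that contains both `i` and `j` does not change
  have hspan : ∀ s, j < s → Submodule.span ℚ (G '' Set.Iio s)
      ≤ Submodule.span ℚ (swapGSO b G i j '' Set.Iio s) := by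
    intro s hs
    have hum : u ∈ Submodule.span ℚ (swapGSO b G i j '' Set.Iio s) :=
      Submodule.subset_span ⟨i, hlt.trans hs, hL⟩
    have hwm : w ∈ Submodule.span ℚ (swapGSO b G i j '' Set.Iio s) :=
      Submodule.subset_span ⟨j, hs, hR⟩
    have him : G i ∈ Submodule.span ℚ (swapGSO b G i j '' Set.Iio s) := by
      have := Submodule.add_mem _ hwm (Submodule.smul_mem _ (gs (G i) u) hum)
      rwa [hw, sub_add_cancel] at this
    refine Submodule.span_le.2 ?_
    rintro _ ⟨t, ht, rfl⟩
    rcases eq_or_ne t i with rfl | hti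
    · exact him
    · rcases eq_or_ne t j with rfl | htj
      · have := Submodule.sub_mem _ hum (Submodule.smul_mem _ c him)
        rwa [hu, add_sub_cancel_right] at this
      · exact Submodule.subset_span ⟨t, ht, hN t hti htj⟩
  have hspan' : ∀ s, s ≤ i → Submodule.span ℚ (G '' Set.Iio s)
      ≤ Submodule.span ℚ (swapGSO b G i j '' Set.Iio s) := by
    intro s hs
    refine Submodule.span_mono ?_
    rintro _ ⟨t, ht, rfl⟩
    have : t < i := lt_of_lt_of_le ht hs
    exact ⟨t, ht, hN t this.ne (this.trans hlt).ne⟩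
  refine ⟨fun s t hst => ?_, fun s => ?_, fun s => ?_⟩
  · rcases lt_or_gt_of_ne hst with h1 | h1
    · exact horth s t h1
    · rw [dotProduct_comm]; exact horth t s h1
  · rcases eq_or_ne s i with rfl | hs
    · rw [hL]; exact hpos
    · rcases eq_or_ne s j with rfl | hs'
      · rw [hR]; exact hwpos
      · rw [hN s hs hs']; exact h.pos s
  · rcases eq_or_ne s i with rfl | hs
    · rw [hL, Function.comp_apply, Equiv.swap_apply_left]
      refine hspan' _ le_rfl ?_
      have h1 : b j - u = ∑ t ∈ Iio s, gs (b j) (G t) • G t := by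
        have h2 := h.rep j
        have h3 : Iio j = insert s (Iio s) := by
          ext t
          simp only [Finset.mem_insert, Finset.mem_Iio, Fin.lt_def, Fin.ext_iff]
          omega
        rw [h3, Finset.sum_insert (by simp)] at h2
        rw [sub_eq_iff_eq_add]
        conv_lhs => rw [h2]
        rw [hu]
        abel
      rw [h1]
      exact Submodule.sum_mem _ fun t ht => Submodule.smul_mem _ _
        (Submodule.subset_span ⟨t, Finset.mem_Iio.1 ht, rfl⟩)
    · rcases eq_or_ne s j with rfl | hs'
      · rw [hR, Function.comp_apply, Equiv.swap_apply_right]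
        have h1 : b i - w = (b i - G i) + gs (G i) u • u := by rw [hw]; abel
        rw [h1]
        refine Submodule.add_mem _ ?_ (Submodule.smul_mem _ _ (Submodule.subset_span ⟨i, hlt, hL⟩))
        exact Submodule.span_mono (Set.image_mono (Set.Iio_subset_Iio hlt.le))
          (hspan' _ le_rfl (h.mem i))
      · rw [hN s hs hs', Function.comp_apply, Equiv.swap_apply_of_ne_of_ne hs hs']
        have h1 : s < i ∨ j < s := by
          simp only [Fin.lt_def, ne_eq, Fin.ext_iff] at hs hs' ⊢
          omega
        rcases h1 with h1 | h1
        · exact hspan' s h1.le (h.mem s)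
        · exact hspan s h1 (h.mem s)

end Swap

/-! ### The potential function of the LLL algorithm -/

/-- The product of all Gram determinants. -/
def potential (G : Fin k → Fin l → ℚ) : ℚ := ∏ s ∈ Finset.range (k + 1), gramDet G s

theorem potential_eq (G : Fin k → Fin l → ℚ) :
    potential G = ∏ j : Fin k, (G j ⬝ᵥ G j) ^ (k - j : ℕ) := by
  unfold potential gramDet
  rw [Finset.prod_comm]
  refine Finset.prod_congr rfl fun j _ => ?_
  rw [Finset.prod_ite, Finset.prod_const_one, mul_one, Finset.prod_const]
  congr 1
  have : Finset.filter (fun s => (j : ℕ) < s) (Finset.range (k + 1)) = Finset.Ioc (j : ℕ) k := by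
    ext s; simp; omega
  rw [this, Nat.card_Ioc]

theorem one_le_potential {b : Fin k → Fin l → ℤ} {G : Fin k → Fin l → ℚ}
    (h : IsGSO (ratBasis b) G) : 1 ≤ potential G :=
  Finset.one_le_prod fun s hs => one_le_gramDet h (by simp at hs; omega)

theorem potential_le {b : Fin k → Fin l → ℤ} {G : Fin k → Fin l → ℚ} (h : IsGSO (ratBasis b) G)
    {M : ℚ} (hM : ∀ i, G i ⬝ᵥ G i ≤ M) (hM1 : 1 ≤ M) : potential G ≤ (M ^ k) ^ (k + 1) := by
  have : potential G ≤ ∏ _s ∈ Finset.range (k + 1), M ^ k :=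
    Finset.prod_le_prod (fun s _ => (gramDet_pos h s).le) fun s _ => gramDet_le h hM hM1 s
  simpa using this

/-- If the Lovász condition fails for `i` and `j = i + 1`, their exchange decreases the potential by
a constant factor. -/
theorem potential_swap_lt {b G : Fin k → Fin l → ℚ} (h : IsGSO b G) {i j : Fin k}
    (hij : (j : ℕ) = i + 1)
    (hlov : G j ⬝ᵥ G j + gs (b j) (G i) ^ 2 * (G i ⬝ᵥ G i) < 3 / 4 * (G i ⬝ᵥ G i)) :
    potential (swapGSO b G i j) < 3 / 4 * potential G := by
  have hne : j ≠ i := fun h => by rw [h] at hij; omega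
  have hji : j ∈ (univ : Finset (Fin k)).erase i := by simp [hne]
  rw [potential_eq, potential_eq, ← Finset.mul_prod_erase univ _ (Finset.mem_univ i),
    ← Finset.mul_prod_erase _ _ hji,
    ← Finset.mul_prod_erase univ (fun j : Fin k => (G j ⬝ᵥ G j) ^ (k - j : ℕ))
      (Finset.mem_univ i),
    ← Finset.mul_prod_erase _ (fun j : Fin k => (G j ⬝ᵥ G j) ^ (k - j : ℕ)) hji]
  have hrest : ∏ s ∈ (univ.erase i).erase j,
      (swapGSO b G i j s ⬝ᵥ swapGSO b G i j s) ^ (k - s : ℕ)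
      = ∏ s ∈ (univ.erase i).erase j, (G s ⬝ᵥ G s) ^ (k - s : ℕ) := by
    refine Finset.prod_congr rfl fun s hs => ?_
    simp only [Finset.mem_erase, Finset.mem_univ, and_true] at hs
    rw [swapGSO_of_ne hs.2 hs.1]
  rw [hrest]
  have hk : (k - i : ℕ) = (k - j : ℕ) + 1 := by have := j.isLt; omega
  have hmul := normSq_swap_mul h hij
  have hu : swapGSO b G i j i ⬝ᵥ swapGSO b G i j i < 3 / 4 * (G i ⬝ᵥ G i) := by
    rw [swapGSO_left hij, dot_add_smul_self h hne]
    exact hlov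
  set u := swapGSO b G i j i ⬝ᵥ swapGSO b G i j i
  set w := swapGSO b G i j j ⬝ᵥ swapGSO b G i j j
  have hP : 0 < ∏ s ∈ (univ.erase i).erase j, (G s ⬝ᵥ G s) ^ (k - s : ℕ) :=
    Finset.prod_pos fun s _ => pow_pos (h.pos s) _
  set P := ∏ s ∈ (univ.erase i).erase j, (G s ⬝ᵥ G s) ^ (k - s : ℕ)
  have h1 : u ^ (k - i : ℕ) * (w ^ (k - j : ℕ) * P)
      = u * (((G i ⬝ᵥ G i) * (G j ⬝ᵥ G j)) ^ (k - j : ℕ) * P) := by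
    rw [hk, ← hmul, mul_pow]; ring
  have h2 : (G i ⬝ᵥ G i) ^ (k - i : ℕ) * ((G j ⬝ᵥ G j) ^ (k - j : ℕ) * P)
      = (G i ⬝ᵥ G i) * (((G i ⬝ᵥ G i) * (G j ⬝ᵥ G j)) ^ (k - j : ℕ) * P) := by
    rw [hk, mul_pow]; ring
  rw [h1, h2, ← mul_assoc (3 / 4 : ℚ)]
  exact mul_lt_mul_of_pos_right hu
    (mul_pos (pow_pos (mul_pos (h.pos i) (h.pos j)) _) hP)

/-- An exchange does not increase the largest norm of an orthogonalized vector. -/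
theorem normSq_swap_le {b G : Fin k → Fin l → ℚ} (h : IsGSO b G) {i j : Fin k}
    (hij : (j : ℕ) = i + 1)
    (hlov : G j ⬝ᵥ G j + gs (b j) (G i) ^ 2 * (G i ⬝ᵥ G i) < 3 / 4 * (G i ⬝ᵥ G i)) {M : ℚ}
    (hM : ∀ s, G s ⬝ᵥ G s ≤ M) (s : Fin k) :
    swapGSO b G i j s ⬝ᵥ swapGSO b G i j s ≤ M := by
  have hne : j ≠ i := fun h => by rw [h] at hij; omega
  rcases eq_or_ne s i with rfl | hs
  · rw [swapGSO_left hij, dot_add_smul_self h hne]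
    have := h.pos s
    linarith [hM s]
  · rcases eq_or_ne s j with rfl | hs'
    · exact (normSq_swap_right_le h hij).trans (hM i)
    · rw [swapGSO_of_ne hs hs']; exact hM s

/-! ### Reduced bases -/

/-- `b` is a reduced basis with orthogonalization `G`: all Gram–Schmidt coefficients are at most
`1 / 2` in absolute value, and the Lovász condition holds. -/
structure IsReduced (b G : Fin k → Fin l → ℚ) : Prop where
  size : ∀ i j, j < i → |gs (b i) (G j)| ≤ 1 / 2
  lovasz : ∀ i j : Fin k, (j : ℕ) = i + 1 →
    3 / 4 * (G i ⬝ᵥ G i) ≤ G j ⬝ᵥ G j + gs (b j) (G i) ^ 2 * (G i ⬝ᵥ G i)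

theorem sq_le_quarter {x : ℚ} (h : |x| ≤ 1 / 2) : x ^ 2 ≤ 1 / 4 := by
  have := abs_le.1 h
  nlinarith

/-- The vectors of a size reduced basis are not much longer than their orthogonalizations. -/
theorem IsGSO.normSq_le_of_size {b G : Fin k → Fin l → ℚ} (h : IsGSO b G) {i : Fin k}
    (hsize : ∀ j, j < i → |gs (b i) (G j)| ≤ 1 / 2) {M : ℚ} (hM : ∀ s, G s ⬝ᵥ G s ≤ M) :
    b i ⬝ᵥ b i ≤ k * M := by
  have hM0 : 0 ≤ M := (h.pos i).le.trans (hM i)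
  rw [h.normSq i]
  have h1 : ∑ j ∈ Iio i, gs (b i) (G j) ^ 2 * (G j ⬝ᵥ G j) ≤ ∑ _j ∈ Iio i, M := by
    refine Finset.sum_le_sum fun j hj => ?_
    have h2 := sq_le_quarter (hsize j (Finset.mem_Iio.1 hj))
    have := h.pos j
    nlinarith [hM j]
  rw [Finset.sum_const, Fin.card_Iio, nsmul_eq_mul] at h1
  have h3 : ((i : ℕ) : ℚ) + 1 ≤ k := by exact_mod_cast i.isLt
  nlinarith [hM i]

theorem IsReduced.normSq_zero_le {b G : Fin k → Fin l → ℚ} (h : IsGSO b G) (hr : IsReduced b G)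
    (hk : 0 < k) : ∀ (s : ℕ) (hs : s < k),
      b ⟨0, hk⟩ ⬝ᵥ b ⟨0, hk⟩ ≤ 2 ^ s * (G ⟨s, hs⟩ ⬝ᵥ G ⟨s, hs⟩) := by
  intro s
  induction s with
  | zero =>
    intro hs
    have : Iio (⟨0, hk⟩ : Fin k) = ∅ := by
      ext t; simp [Fin.lt_def]
    rw [h.normSq, this]
    simp
  | succ s ih =>
    intro hs
    refine (ih (by omega)).trans ?_
    have h1 := hr.lovasz ⟨s, by omega⟩ ⟨s + 1, hs⟩ rfl
    have h2 := sq_le_quarter (hr.size ⟨s + 1, hs⟩ ⟨s, by omega⟩ (Fin.lt_def.2 (by simp)))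
    have h3 := h.pos ⟨s, by omega⟩
    have h4 : G ⟨s, by omega⟩ ⬝ᵥ G ⟨s, by omega⟩ ≤ 2 * (G ⟨s + 1, hs⟩ ⬝ᵥ G ⟨s + 1, hs⟩) := by
      nlinarith
    have h5 := mul_le_mul_of_nonneg_left h4 (show (0 : ℚ) ≤ 2 ^ s by positivity)
    rw [pow_succ]
    linarith

/-- A nonzero lattice vector is at least as long as some orthogonalized vector. -/
theorem IsGSO.exists_normSq_le {b : Fin k → Fin l → ℤ} {G : Fin k → Fin l → ℚ}
    (h : IsGSO (ratBasis b) G) {v : Fin l → ℤ} (hv : v ∈ Submodule.span ℤ (Set.range b))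
    (hv0 : v ≠ 0) : ∃ i, G i ⬝ᵥ G i ≤ ((v ⬝ᵥ v : ℤ) : ℚ) := by
  rw [Submodule.mem_span_range_iff_exists_fun] at hv
  obtain ⟨z, rfl⟩ := hv
  have hz : ∃ i, z i ≠ 0 := by
    by_contra! hz
    exact hv0 (by simp [hz])
  -- the projection of `v` to `G_i` is at least as long as `G_i` for the last `i` with `z_i ≠ 0`
  let S : Finset (Fin k) := univ.filter fun i => z i ≠ 0
  have hS : S.Nonempty := by
    obtain ⟨i, hi⟩ := hz
    exact ⟨i, by simp [S, hi]⟩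
  let i := S.max' hS
  have hzi : z i ≠ 0 := by
    have := S.max'_mem hS
    exact (Finset.mem_filter.1 this).2
  have hgt : ∀ j, i < j → z j = 0 := by
    intro j hj
    by_contra hne
    have : j ≤ i := S.le_max' j (by simp [S, hne])
    exact absurd hj (not_lt.2 this)
  refine ⟨i, ?_⟩
  set v := ∑ j, z j • b j with hvdef
  have hvq : ratVec v = ∑ j, (z j : ℚ) • ratBasis b j := by
    ext t
    simp [ratVec, ratBasis, hvdef, Finset.sum_apply]
  have hdot : ratVec v ⬝ᵥ G i = z i * (G i ⬝ᵥ G i) := by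
    rw [hvq, sum_dotProduct, Finset.sum_eq_single_of_mem i (Finset.mem_univ _)]
    · rw [smul_dotProduct, h.dot_self, smul_eq_mul]
    · intro j _ hj
      rw [smul_dotProduct]
      rcases lt_or_gt_of_ne hj with h1 | h1
      · rw [h.dot_of_lt h1, smul_zero]
      · rw [hgt j h1, Int.cast_zero, zero_smul]
  have hcs := dot_sq_le (ratVec v) (G i)
  rw [hdot, ratVec_dot, mul_pow] at hcs
  have hpos := h.pos i
  have hz1 : (1 : ℚ) ≤ (z i : ℚ) ^ 2 := by
    have : (1 : ℤ) ≤ z i ^ 2 := by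
      have := sq_nonneg (z i)
      have h2 : z i ^ 2 ≠ 0 := pow_ne_zero 2 hzi
      omega
    exact_mod_cast this
  have h6 : (G i ⬝ᵥ G i) * (G i ⬝ᵥ G i) ≤ ((v ⬝ᵥ v : ℤ) : ℚ) * (G i ⬝ᵥ G i) := by
    refine le_trans ?_ hcs
    nlinarith [mul_pos hpos hpos]
  exact le_of_mul_le_mul_right h6 hpos

/-- The first vector of a reduced basis is a shortest nonzero lattice vector up to an exponential
factor. -/
theorem IsReduced.normSq_le {b : Fin k → Fin l → ℤ} {G : Fin k → Fin l → ℚ}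
    (h : IsGSO (ratBasis b) G) (hr : IsReduced (ratBasis b) G) (hk : 0 < k) {v : Fin l → ℤ}
    (hv : v ∈ Submodule.span ℤ (Set.range b)) (hv0 : v ≠ 0) :
    b ⟨0, hk⟩ ⬝ᵥ b ⟨0, hk⟩ ≤ 2 ^ (k - 1) * (v ⬝ᵥ v) := by
  obtain ⟨i, hi⟩ := h.exists_normSq_le hv hv0
  have h1 := IsReduced.normSq_zero_le h hr hk i i.isLt
  have h2 : (2 : ℚ) ^ (i : ℕ) ≤ 2 ^ (k - 1) :=
    pow_le_pow_right₀ (by norm_num) (by have := i.isLt; omega)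
  have h3 : ((b ⟨0, hk⟩ ⬝ᵥ b ⟨0, hk⟩ : ℤ) : ℚ) ≤ 2 ^ (k - 1) * ((v ⬝ᵥ v : ℤ) : ℚ) := by
    rw [← ratVec_dot (b ⟨0, hk⟩)]
    exact h1.trans (mul_le_mul h2 hi (h.pos i).le (by positivity))
  exact_mod_cast h3

end Steps


/-! ### Cost of Gram–Schmidt orthogonalization and size reduction -/

section LLLCost

open Finset Matrix

variable {k l : ℕ}

theorem sum_ite_lt_succ {M : Type*} [AddCommMonoid M] (f : Fin k → M) (i : Fin k) :
    (∑ j : Fin k, if (j : ℕ) < i + 1 then f j else 0)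
      = (∑ j : Fin k, if (j : ℕ) < i then f j else 0) + f i := by
  rw [← Finset.add_sum_erase univ _ (Finset.mem_univ i), if_pos (by simp),
    ← Finset.add_sum_erase univ (fun j : Fin k => if (j : ℕ) < i then f j else 0)
      (Finset.mem_univ i), if_neg (by simp), zero_add, add_comm]
  congr 1
  refine Finset.sum_congr rfl fun j hj => ?_
  have : (j : ℕ) ≠ i := fun hji => (Finset.mem_erase.1 hj).1 (Fin.ext hji)
  by_cases hlt : (j : ℕ) < i
  · rw [if_pos hlt, if_pos (by omega)]
  · rw [if_neg hlt, if_neg (by omega)]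

theorem sum_ite_lt_card {M : Type*} [AddCommMonoid M] (f : Fin k → M) :
    (∑ j : Fin k, if (j : ℕ) < k then f j else 0) = ∑ j, f j :=
  Finset.sum_congr rfl fun j _ => if_pos j.isLt

theorem dot_spec {T a : ℕ} (hT : 16 ≤ T) (hl : l ≤ T) {u v : Fin l → ℚ}
    (hu : ∀ t, HeightLE (T ^ a) (u t)) (hv : ∀ t, HeightLE (T ^ a) (v t)) :
    (dot u v).val = u ⬝ᵥ v ∧ HeightLE (T ^ (a + 2)) (u ⬝ᵥ v) ∧
      (dot u v).cost ≤ T ^ (3 * a + 12) := by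
  have ha : 1 ≤ T ^ a := Nat.one_le_pow _ _ (by omega)
  have hpow : ∀ t, t ≤ l → t * (2 * T ^ a + 1) ≤ T ^ (a + 2) := by
    intro t ht
    have h4 : 16 * T ^ a ≤ T ^ (a + 1) := mul_pow_le hT
    calc t * (2 * T ^ a + 1) ≤ T * T ^ (a + 1) := Nat.mul_le_mul (ht.trans hl) (by omega)
      _ = T ^ (a + 2) := by ring
  have hmono : T ^ a ≤ T ^ (a + 2) := Nat.pow_le_pow_right (by omega) (by omega)
  have h := loop_finRange (k := l) (T ^ (3 * a + 10))
    (fun t (s : ℚ) => (s = ∑ i : Fin l, if (i : ℕ) < t then u i * v i else 0) ∧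
      HeightLE (t * (2 * T ^ a + 1)) s)
    (fun t s => do
      let m ← qMul (u t) (v t)
      qAdd s m) 0 (by simp [heightLE_zero]) (by
    rintro i s ⟨hs, hh⟩
    have hm : HeightLE (T ^ a + T ^ a) (u i * v i) := (hu i).mul (hv i)
    have hadd := hh.add hm
    refine ⟨⟨?_, ?_⟩, ?_⟩
    · rw [sum_ite_lt_succ, ← hs]; rfl
    · refine HeightLE.mono hadd ?_
      rw [add_one_mul (i : ℕ)]; omega
    · have h1 := cube_ratLen_le (a := a) hT (hu i) (hv i) le_rfl le_rfl
      have h2 := cube_ratLen_le (a := a + 2) hT hh hm (hpow i i.isLt.le) (by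
        have := mul_pow_le (T := T) (c := 2) (a := a) (by omega)
        have h5 : T ^ (a + 1) ≤ T ^ (a + 2) := Nat.pow_le_pow_right (by omega) (by omega)
        omega)
      have h3 : T ^ (3 * a + 3) ≤ T ^ (3 * a + 9) := Nat.pow_le_pow_right (by omega) (by omega)
      have h4 : 2 * T ^ (3 * a + 9) ≤ T ^ (3 * a + 10) := mul_pow_le (by omega)
      have h5 : 3 * (a + 2) + 3 = 3 * a + 9 := by ring
      rw [h5] at h2
      simp only [cost_bind, qMul, qAdd]
      omega)
  have hval : (dot u v).val = u ⬝ᵥ v := by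
    rw [dot, h.1.1, sum_ite_lt_card]; rfl
  refine ⟨hval, ?_, ?_⟩
  · rw [← hval]
    exact HeightLE.mono h.1.2 (hpow l le_rfl)
  · exact h.2.trans (mul_succ_pow_le hT hl le_rfl)

theorem gsCoeff_spec {T a : ℕ} (hT : 16 ≤ T) (hl : l ≤ T) {v : Fin l → ℤ} {u : Fin l → ℚ}
    (hv : ∀ t, HeightLE (T ^ a) (ratVec v t)) (hu : ∀ t, HeightLE (T ^ a) (u t)) :
    (gsCoeff v u).val = gs (ratVec v) u ∧ HeightLE (T ^ (a + 3)) (gs (ratVec v) u) ∧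
      (gsCoeff v u).cost ≤ T ^ (3 * a + 13) := by
  have h1 := dot_spec hT hl hv hu
  have h2 := dot_spec hT hl hu hu
  have hq : (buildVec fun t => zToRat (v t)).val = ratVec v := rfl
  have ha : 1 ≤ T ^ a := Nat.one_le_pow _ _ (by omega)
  have hb : (buildVec fun t => zToRat (v t)).cost ≤ T ^ (3 * a + 12) := by
    have h3 : ∀ t, (zToRat (v t)).cost ≤ T ^ (a + 1) := fun t => by
      have := bitLen_le (heightLE_intCast.1 (hv t))
      have h4 : 16 * T ^ a ≤ T ^ (a + 1) := mul_pow_le hT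
      simp only [zToRat]
      omega
    exact (cost_buildVec_le _ h3).trans ((mul_succ_pow_le hT hl le_rfl).trans
      (Nat.pow_le_pow_right (by omega) (by omega)))
  have hval : (gsCoeff v u).val = gs (ratVec v) u := by
    simp only [gsCoeff, val_bind, hq, h1.1, h2.1]; rfl
  refine ⟨hval, ?_, ?_⟩
  · refine (h1.2.1.div h2.2.1).mono ?_
    have : 2 * T ^ (a + 2) ≤ T ^ (a + 3) := mul_pow_le (by omega)
    omega
  · have h3 := cube_ratLen_le (a := a + 2) hT h1.2.1 h2.2.1 le_rfl le_rfl
    have h4 : T ^ (3 * (a + 2) + 3) ≤ T ^ (3 * a + 12) :=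
      Nat.pow_le_pow_right (by omega) (by omega)
    have h5 : 16 * T ^ (3 * a + 12) ≤ T ^ (3 * a + 13) := mul_pow_le hT
    have h6 := h1.2.2
    have h7 := h2.2.2
    simp only [gsCoeff, cost_bind, hq, h1.1, h2.1, qDiv]
    omega

/-- The subtraction of one projection in the Gram–Schmidt recursion. -/
theorem gramSchmidt_step {T : ℕ} (hT : 16 ≤ T) (hl : l ≤ T) {w v G : Fin l → ℚ} {c : ℚ}
    {h : ℕ} (hh : h ≤ T ^ 6) (hc : HeightLE (T ^ 4) c) (hG : ∀ t, HeightLE (T ^ 1) (G t))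
    (hv : ∀ t, HeightLE h (v t)) (hw : w = v - c • G) :
    (buildVec fun t => do
        let m ← qMul c (G t)
        qSub (v t) m).val = w ∧
      (∀ t, HeightLE (h + T ^ 5) (w t)) ∧
      (buildVec fun t => do
        let m ← qMul c (G t)
        qSub (v t) m).cost ≤ T ^ 24 := by
  subst hw
  have h14 : T ^ 1 ≤ T ^ 4 := Nat.pow_le_pow_right (by omega) (by omega)
  have h45 : 16 * T ^ 4 ≤ T ^ 5 := mul_pow_le hT
  have h1 : 1 ≤ T ^ 4 := Nat.one_le_pow _ _ (by omega)
  have hm : ∀ t, HeightLE (T ^ 4 + T ^ 1) (c * G t) := fun t => hc.mul (hG t)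
  refine ⟨rfl, fun t => ?_, ?_⟩
  · exact ((hv t).sub (hm t)).mono (by omega)
  · refine (cost_buildVec_le _ (C := T ^ 22) fun t => ?_).trans (mul_succ_pow_le hT hl le_rfl)
    have h56 : T ^ 5 ≤ T ^ 6 := Nat.pow_le_pow_right (by omega) (by omega)
    have h2 : _ ≤ T ^ 21 := cube_ratLen_le (a := 6) hT (hv t) (hm t) hh (by omega)
    have h3 : _ ≤ T ^ 21 := cube_ratLen_le (a := 6) hT hc (hG t) (by omega) (by omega)
    have h4 : 16 * T ^ 21 ≤ T ^ 22 := mul_pow_le hT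
    simp only [cost_bind, qMul, qSub]
    omega

/-- The Gram–Schmidt recursion computes the orthogonalization in polynomial time. -/
theorem gramSchmidt_spec {T : ℕ} (hT : 16 ≤ T) (hk : k ≤ T) (hl : l ≤ T)
    {b : Fin k → Fin l → ℤ} {G : Fin k → Fin l → ℚ} (h : IsGSO (ratBasis b) G)
    (hb : ∀ i t, HeightLE (T ^ 1) (ratBasis b i t)) (hG : ∀ i t, HeightLE (T ^ 1) (G i t)) :
    (gramSchmidt b).val = G ∧ (gramSchmidt b).cost ≤ T ^ 31 := by
  have hpow : ∀ t, t ≤ k → T ^ 1 + t * T ^ 5 ≤ T ^ 6 + T ^ 5 := by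
    intro t ht
    have h1 : T ^ 1 ≤ T ^ 5 := Nat.pow_le_pow_right (by omega) (by omega)
    have h2 : t * T ^ 5 ≤ T ^ 6 := mul_pow_le (ht.trans hk)
    omega
  have hpow' : ∀ t, t < k → T ^ 1 + t * T ^ 5 ≤ T ^ 6 := by
    intro t ht
    have h1 : T ^ 1 ≤ T ^ 5 := Nat.pow_le_pow_right (by omega) (by omega)
    have h2 : (t + 1) * T ^ 5 ≤ T ^ 6 := mul_pow_le (by omega)
    rw [Nat.succ_mul] at h2
    omega
  have hmain := loop_finRange (k := k) (T ^ 29)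
    (fun t (G' : Fin k → Fin l → ℚ) => ∀ s : Fin k, (s : ℕ) < t → G' s = G s)
    (fun i G => do
      let w ← buildVec fun t => zToRat (b i t)
      let v ← loop (List.finRange k) w fun j v =>
        if j < i then do
          let c ← gsCoeff (b i) (G j)
          buildVec fun t => do
            let m ← qMul c (G j t)
            qSub (v t) m
        else pure v
      pure (Function.update G i v)) (fun _ _ => 0) (by simp) (by
    intro i G' hG'
    let f : Fin k → Fin l → ℚ := fun j =>
      if j < i then gs (ratBasis b i) (G j) • G j else 0
    -- all projections have heights at most `T ^ 5`, so the heights of the partial sums grow only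
    -- linearly
    have hinner := loop_finRange (k := k) (T ^ 26)
      (fun t (v : Fin l → ℚ) =>
        v = ratBasis b i - (∑ j : Fin k, if (j : ℕ) < t then f j else 0) ∧
          ∀ r, HeightLE (T ^ 1 + t * T ^ 5) (v r))
      (fun j v =>
        if j < i then do
          let c ← gsCoeff (b i) (G' j)
          buildVec fun t => do
            let m ← qMul c (G' j t)
            qSub (v t) m
        else pure v) (buildVec fun t => zToRat (b i t)).val
      ⟨by simp only [not_lt_zero, if_false, Finset.sum_const_zero, sub_zero]; rfl,
        fun r => (hb i r).mono (Nat.le_add_right _ _)⟩ (by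
      rintro j v ⟨hv, hvh⟩
      by_cases hji : j < i
      · have hGj := hG' j hji
        have hgs := gsCoeff_spec (a := 1) hT hl (hb i) (hG j)
        have hstep := gramSchmidt_step (c := gs (ratBasis b i) (G j)) hT hl
          (w := v - gs (ratBasis b i) (G j) • G j)
          (hpow' j j.isLt) hgs.2.1 (hG j) hvh rfl
        have hgv : (gsCoeff (b i) (G j)).val = gs (ratBasis b i) (G j) := hgs.1
        simp only [hji, if_true, val_bind, cost_bind, hGj, hgv]
        refine ⟨⟨?_, fun r => ?_⟩, ?_⟩
        · refine hstep.1.trans ?_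
          rw [sum_ite_lt_succ, hv, sub_sub]
          simp only [f, hji, if_true]
        · refine HeightLE.mono (hstep.2.1 r) ?_
          rw [Nat.succ_mul]; omega
        · have h1 := hgs.2.2
          have h2 := hstep.2.2
          have h3 : T ^ (3 * 1 + 13) ≤ T ^ 25 := Nat.pow_le_pow_right (by omega) (by omega)
          have h4 : T ^ 24 ≤ T ^ 25 := Nat.pow_le_pow_right (by omega) (by omega)
          have h5 : 16 * T ^ 25 ≤ T ^ 26 := mul_pow_le hT
          omega
      · simp only [hji, if_false, val_pure, cost_pure]
        refine ⟨⟨?_, fun r => HeightLE.mono (hvh r) ?_⟩, Nat.zero_le _⟩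
        · rw [sum_ite_lt_succ, hv]
          simp only [f, hji, if_false, add_zero]
        · rw [Nat.succ_mul]; omega)
    have hval := hinner.1.1
    rw [sum_ite_lt_card] at hval
    have hf : ratBasis b i - ∑ j, f j = G i := by
      have h1 := h.rep i
      have h2 : ∑ j, f j = ∑ j ∈ Iio i, gs (ratBasis b i) (G j) • G j := by
        rw [← Finset.sum_filter]
        congr 1
        ext j; simp
      rw [h2, sub_eq_iff_eq_add]
      exact h1
    rw [hf] at hval
    refine ⟨fun s hs => ?_, ?_⟩
    · simp only [val_bind, val_pure]
      rcases eq_or_ne s i with rfl | hne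
      · rw [Function.update_self]; exact hval
      · rw [Function.update_of_ne hne]
        exact hG' s (by
          have : (s : ℕ) ≠ i := fun h => hne (Fin.ext h)
          omega)
    · have h1 : (buildVec fun t => zToRat (b i t)).cost ≤ T ^ 28 := by
        have h3 : ∀ t, (zToRat (b i t)).cost ≤ T ^ 2 := fun t => by
          have := bitLen_le (heightLE_intCast.1 (hb i t))
          have h4 : 16 * T ^ 1 ≤ T ^ 2 := mul_pow_le hT
          rw [pow_one] at h4 this
          simp only [zToRat]
          omega
        exact (cost_buildVec_le _ h3).trans ((mul_succ_pow_le hT hl le_rfl).trans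
          (Nat.pow_le_pow_right (by omega) (by omega)))
      have h2 : _ ≤ T ^ 28 := hinner.2.trans (mul_succ_pow_le hT hk le_rfl)
      have h3 : 16 * T ^ 28 ≤ T ^ 29 := mul_pow_le hT
      simp only [cost_bind, cost_pure]
      omega)
  refine ⟨?_, ?_⟩
  · funext i
    exact hmain.1 i i.isLt
  · exact hmain.2.trans (mul_succ_pow_le hT hk le_rfl)

/-! ### The run of the size reduction -/

theorem span_update_sub_smul_le (b : Fin k → Fin l → ℤ) {i j : Fin k} (hij : j ≠ i) (r : ℤ) :
    Submodule.span ℤ (Set.range (Function.update b i (b i - r • b j)))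
      ≤ Submodule.span ℤ (Set.range b) := by
  refine Submodule.span_le.2 ?_
  rintro _ ⟨s, rfl⟩
  have hmem : ∀ s, b s ∈ Submodule.span ℤ (Set.range b) := fun s =>
    Submodule.subset_span ⟨s, rfl⟩
  rcases eq_or_ne s i with rfl | hs
  · rw [Function.update_self]
    exact Submodule.sub_mem _ (hmem s) (Submodule.smul_mem _ _ (hmem j))
  · rw [Function.update_of_ne hs]
    exact hmem s

theorem span_update_sub_smul (b : Fin k → Fin l → ℤ) {i j : Fin k} (hij : j ≠ i) (r : ℤ) :
    Submodule.span ℤ (Set.range (Function.update b i (b i - r • b j)))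
      = Submodule.span ℤ (Set.range b) := by
  refine le_antisymm (span_update_sub_smul_le b hij r) ?_
  have h := span_update_sub_smul_le (Function.update b i (b i - r • b j)) hij (-r)
  rw [Function.update_self, Function.update_of_ne hij, neg_smul, sub_neg_eq_add, sub_add_cancel,
    Function.update_idem, Function.update_eq_self] at h
  exact h

theorem ratBasis_update (b : Fin k → Fin l → ℤ) (i j : Fin k) (r : ℤ) :
    ratBasis (Function.update b i (b i - r • b j))
      = Function.update (ratBasis b) i (ratBasis b i - (r : ℚ) • ratBasis b j) := by
  funext s
  rcases eq_or_ne s i with rfl | hs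
  · rw [Function.update_self]
    ext t
    simp [ratBasis, ratVec]
  · rw [Function.update_of_ne hs, ratBasis, Function.update_of_ne hs, ratBasis]

theorem abs_le_of_normSq_le {v : Fin l → ℚ} {s : ℕ} (h : v ⬝ᵥ v ≤ 2 ^ s) (t : Fin l) :
    |v t| ≤ 2 ^ s := by
  have h1 : v t * v t ≤ v ⬝ᵥ v :=
    Finset.single_le_sum (f := fun t => v t * v t) (fun _ _ => mul_self_nonneg _)
      (Finset.mem_univ t)
  have h2 : (1 : ℚ) ≤ 2 ^ s := one_le_pow₀ (by norm_num)
  have h3 : |v t| * |v t| = v t * v t := abs_mul_abs_self _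
  by_contra! hlt
  nlinarith [abs_nonneg (v t)]

theorem heightLE_of_normSq_le {v : Fin l → ℤ} {s T : ℕ} (h : ratVec v ⬝ᵥ ratVec v ≤ 2 ^ s)
    (hs : s ≤ T) (t : Fin l) : HeightLE T (ratVec v t) := by
  refine HeightLE.mono ?_ hs
  rw [ratVec, heightLE_intCast]
  have := abs_le_of_normSq_le h t
  rw [ratVec] at this
  exact_mod_cast this

theorem normSq_sub_smul_le {x y : Fin l → ℚ} (r : ℚ) :
    (x - r • y) ⬝ᵥ (x - r • y) ≤ 2 * (x ⬝ᵥ x) + 2 * r ^ 2 * (y ⬝ᵥ y) := by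
  have h1 := dot_self_nonneg (x + r • y)
  simp only [add_dotProduct, dotProduct_add, sub_dotProduct, dotProduct_sub, smul_dotProduct,
    dotProduct_smul, smul_eq_mul, dotProduct_comm y x] at h1 ⊢
  nlinarith

theorem gs_sq_mul_le (x : Fin l → ℚ) {g : Fin l → ℚ} (hg : 0 < g ⬝ᵥ g) :
    gs x g ^ 2 * (g ⬝ᵥ g) ≤ x ⬝ᵥ x := by
  have := dot_sq_le x g
  rw [gs, div_pow, sq (g ⬝ᵥ g), div_mul_eq_mul_div, div_le_iff₀ (by positivity)]
  nlinarith

/-- Growth of a vector in one step of the size reduction. -/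
theorem normSq_sub_round_le {x y g : Fin l → ℚ} (hg : 0 < g ⬝ᵥ g) {d e f : ℕ}
    (hd : 1 ≤ 2 ^ d * (g ⬝ᵥ g)) (hx : x ⬝ᵥ x ≤ 2 ^ e) (hy : y ⬝ᵥ y ≤ 2 ^ f) :
    (x - (round (gs x g) : ℚ) • y) ⬝ᵥ (x - (round (gs x g) : ℚ) • y) ≤ 2 ^ (e + (d + f + 3)) := by
  set c := gs x g with hc
  have h1 : c ^ 2 ≤ 2 ^ d * 2 ^ e := by
    have h2 := gs_sq_mul_le x hg
    have h3 : c ^ 2 * 1 ≤ c ^ 2 * (2 ^ d * (g ⬝ᵥ g)) :=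
      mul_le_mul_of_nonneg_left hd (sq_nonneg _)
    have h4 : (2 : ℚ) ^ d * (c ^ 2 * (g ⬝ᵥ g)) ≤ 2 ^ d * 2 ^ e :=
      mul_le_mul_of_nonneg_left (h2.trans hx) (by positivity)
    linarith
  have h2 : (round c : ℚ) ^ 2 ≤ 2 * c ^ 2 + 1 / 2 := by
    have h3 := sq_le_quarter (abs_sub_round c)
    nlinarith [sq_nonneg (c + (c - round c)), sq_nonneg (c - (c - round c))]
  have he : (1 : ℚ) ≤ 2 ^ e := one_le_pow₀ (by norm_num)
  have hdf : (1 : ℚ) ≤ 2 ^ d := one_le_pow₀ (by norm_num)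
  have hff : (1 : ℚ) ≤ 2 ^ f := one_le_pow₀ (by norm_num)
  have hy0 := dot_self_nonneg y
  refine (normSq_sub_smul_le _).trans ?_
  have h3 : 2 * (round c : ℚ) ^ 2 * (y ⬝ᵥ y) ≤ (4 * (2 ^ d * 2 ^ e) + 1) * 2 ^ f :=
    mul_le_mul (by linarith) hy hy0 (by positivity)
  have h4 : (2 : ℚ) ^ (e + (d + f + 3)) = 8 * (2 ^ e * 2 ^ d * 2 ^ f) := by
    rw [pow_add, pow_add, pow_add]; ring
  rw [h4]
  have h5 : (2 : ℚ) ^ e ≤ 2 ^ e * 2 ^ d * 2 ^ f := by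
    have := one_le_mul_of_one_le_of_one_le hdf hff
    nlinarith
  have h6 : (2 : ℚ) ^ f ≤ 2 ^ e * 2 ^ d * 2 ^ f := by
    have := one_le_mul_of_one_le_of_one_le he hdf
    nlinarith
  nlinarith

end LLLCost


section LLLRun

open Finset Matrix

variable {k l : ℕ}

/-- The costs of the operations in one step of the size reduction. -/
theorem sizeReduce_step_cost {T : ℕ} (hT : 16 ≤ T) (hl : l ≤ T) {x y : Fin l → ℤ} {c : ℚ}
    (hc : HeightLE (T ^ 4) c) (hx : ∀ t, HeightLE T (ratVec x t))
    (hy : ∀ t, HeightLE T (ratVec y t)) :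
    (qRound c).cost + (buildVec fun t => do
      let m ← zMul (round c) (y t)
      zSub (x t) m).cost ≤ T ^ 16 := by
  have hT1 : T ≤ T ^ 4 := Nat.le_self_pow (by omega) T
  have h45 : 16 * T ^ 4 ≤ T ^ 5 := mul_pow_le hT
  have h1 : (qRound c).cost ≤ T ^ 15 := by
    have h2 := ratLen_le hc
    calc (qRound c).cost = ratLen c ^ 3 := rfl
      _ ≤ (T ^ 5) ^ 3 := Nat.pow_le_pow_left (by omega) 3
      _ = T ^ 15 := by ring
  have hr : |round c| ≤ 2 ^ (T ^ 4 + 1) := by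
    have h2 : |c| ≤ 2 ^ T ^ 4 := by
      have h3 : |c| * c.den = |(c.num : ℚ)| := by
        conv_lhs => rw [← Rat.num_div_den c]
        have : (c.den : ℚ) ≠ 0 := by exact_mod_cast c.den_nz
        rw [abs_div, Nat.abs_cast, Rat.num_div_den c, div_mul_cancel₀ _ this]
      have h4 : |(c.num : ℚ)| ≤ 2 ^ T ^ 4 := by exact_mod_cast hc.1
      have h5 : (1 : ℚ) ≤ c.den := by exact_mod_cast c.den_pos
      rw [← h3] at h4
      refine le_trans ?_ h4
      exact le_mul_of_one_le_right (abs_nonneg _) h5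
    have h3 : |(round c : ℚ)| ≤ 2 ^ (T ^ 4 + 1) := by
      have h4 := abs_sub_round c
      have h5 : (1 : ℚ) ≤ 2 ^ T ^ 4 := one_le_pow₀ (by norm_num)
      have h6 : |(round c : ℚ)| ≤ |c| + |c - round c| := by
        have := abs_sub (c) (c - round c)
        rwa [sub_sub_cancel] at this
      rw [pow_succ]
      linarith
    exact_mod_cast h3
  have hb : ∀ t, ((do
      let m ← zMul (round c) (y t)
      zSub (x t) m) : Timed ℤ).cost ≤ T ^ 10 := by
    intro t
    have hx' : |x t| ≤ 2 ^ T := heightLE_intCast.1 (hx t)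
    have hy' : |y t| ≤ 2 ^ T := heightLE_intCast.1 (hy t)
    have hm : |round c * y t| ≤ 2 ^ (T ^ 4 + 1 + T) := by
      rw [abs_mul, pow_add]
      exact mul_le_mul hr hy' (abs_nonneg _) (by positivity)
    have e1 := bitLen_le hr
    have e2 := bitLen_le hx'
    have e3 := bitLen_le hy'
    have e4 := bitLen_le hm
    have e5 : bitLen (round c) * bitLen (y t) ≤ T ^ 5 * T ^ 4 :=
      Nat.mul_le_mul (by omega) (by
        have : T ^ 4 = T ^ 3 * T := by ring
        have h3 : 16 ≤ T ^ 3 := hT.trans (Nat.le_self_pow (by omega) T)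
        nlinarith)
    have e6 : T ^ 5 * T ^ 4 = T ^ 9 := by ring
    have e7 : 16 * T ^ 9 ≤ T ^ 10 := mul_pow_le hT
    have e8 : T ^ 5 ≤ T ^ 9 := Nat.pow_le_pow_right (by omega) (by omega)
    simp only [cost_bind, zMul, zSub]
    omega
  have h2 := (cost_buildVec_le _ hb).trans (mul_succ_pow_le hT hl le_rfl)
  have h3 : T ^ (10 + 2) ≤ T ^ 15 := Nat.pow_le_pow_right (by omega) (by omega)
  have h4 : 16 * T ^ 15 ≤ T ^ 16 := mul_pow_le hT
  omega

/-- What `sizeReduce` has achieved after the vectors with index less than `i` have been treated. -/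
structure SizeReducedBelow (b₀ b : Fin k → Fin l → ℤ) (G : Fin k → Fin l → ℚ) (i : ℕ) : Prop where
  gso : IsGSO (ratBasis b) G
  span : Submodule.span ℤ (Set.range b) = Submodule.span ℤ (Set.range b₀)
  size : ∀ s : Fin k, (s : ℕ) < i → ∀ j, j < s → |gs (ratBasis b s) (G j)| ≤ 1 / 2
  keep : ∀ s : Fin k, i ≤ s → b s = b₀ s

/-- The numerical hypotheses under which the runs of `sizeReduce` and `lll` are analyzed: the
orthogonalized vectors have squared norms at most `2 ^ s`, and `T` bounds all binary lengths. -/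
structure LLLBound (k l s T : ℕ) : Prop where
  sixteen_le : 16 ≤ T
  k_le : k ≤ T
  l_le : l ≤ T
  le : (s + k) + k * (s * k + (s + k) + 3) ≤ T

theorem natCast_mul_two_pow_le (k s : ℕ) : (k : ℚ) * 2 ^ s ≤ 2 ^ (s + k) := by
  have : (k : ℚ) ≤ 2 ^ k := by exact_mod_cast (Nat.lt_two_pow_self (n := k)).le
  rw [pow_add, mul_comm]
  exact mul_le_mul_of_nonneg_left this (by positivity)

/-- A lower bound for the norms of the orthogonalized vectors in terms of an upper bound. -/
theorem one_le_mul_normSq {b : Fin k → Fin l → ℤ} {G : Fin k → Fin l → ℚ} {s : ℕ}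
    (h : IsGSO (ratBasis b) G) (hG : ∀ i, G i ⬝ᵥ G i ≤ 2 ^ s) (i : Fin k) :
    1 ≤ 2 ^ (s * k) * (G i ⬝ᵥ G i) := by
  have h1 := gramDet_le h hG (one_le_pow₀ (by norm_num)) i
  rw [← pow_mul] at h1
  exact (inv_le_normSq h i).trans (mul_le_mul_of_nonneg_right h1 (h.pos i).le)

/-- Bounds for the numerators and denominators of the orthogonalized vectors, with the Gram
determinant as the denominator. -/
theorem heightLE_gso {b : Fin k → Fin l → ℤ} {G : Fin k → Fin l → ℚ} {s T : ℕ}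
    (h : IsGSO (ratBasis b) G) (hG : ∀ i, G i ⬝ᵥ G i ≤ 2 ^ s) (hT : s * k + s ≤ T)
    (i : Fin k) (t : Fin l) : HeightLE T (G i t) := by
  have h1 := gramDet_le h hG (one_le_pow₀ (by norm_num)) i
  rw [← pow_mul] at h1
  have hpos := gramDet_pos h i
  obtain ⟨z, hz⟩ := gramDet_mul_int h i t
  have hdet := gramDet_eq_det h i.isLt.le
  rw [hdet] at h1 hz hpos
  set d := (gramMat b i.isLt.le).det
  have habs := abs_le_of_normSq_le (hG i) t
  refine (heightLE_of_eq_div (a := z) (b := d) (s := s * k + s) ?_ ?_ ?_ ?_).mono hT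
  · intro h0; rw [h0] at hpos; simp at hpos
  · rw [← hz, mul_div_cancel_left₀ _ hpos.ne']
  · have h2 : |(z : ℚ)| ≤ 2 ^ (s * k + s) := by
      rw [← hz, abs_mul, abs_of_pos hpos, pow_add]
      exact mul_le_mul h1 habs (abs_nonneg _) (by positivity)
    exact_mod_cast h2
  · have h2 : |(d : ℚ)| ≤ 2 ^ (s * k + s) := by
      rw [abs_of_pos hpos]
      exact h1.trans (pow_le_pow_right₀ (by norm_num) (by omega))
    exact_mod_cast h2

/-- The size reduction keeps the lattice and the orthogonalization, and it runs in polynomial time.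
The vector under reduction grows, but the binary lengths of its entries grow only linearly with the
number of steps. -/
theorem sizeReduce_spec {s T : ℕ} (hB : LLLBound k l s T) {b : Fin k → Fin l → ℤ}
    {G : Fin k → Fin l → ℚ} (h : IsGSO (ratBasis b) G) (hG : ∀ i, G i ⬝ᵥ G i ≤ 2 ^ s)
    (hb : ∀ i, ratBasis b i ⬝ᵥ ratBasis b i ≤ 2 ^ (s + k)) :
    SizeReducedBelow b (sizeReduce G b).val G k ∧ (sizeReduce G b).cost ≤ T ^ 21 := by
  have hT := hB.sixteen_le
  have hk := hB.k_le
  have hl := hB.l_le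
  have hTb := hB.le
  set δ := s * k + (s + k) + 3 with hδ
  have hGT : ∀ i t, HeightLE (T ^ 1) (G i t) := fun i t => by
    rw [pow_one]
    refine heightLE_gso h hG ?_ i t
    have hkpos : 0 < k := i.pos
    have : δ ≤ k * δ := Nat.le_mul_of_pos_left _ hkpos
    omega
  unfold sizeReduce
  refine (fun hx => ⟨hx.1, hx.2.trans (mul_succ_pow_le hT hk le_rfl)⟩)
    (loop_finRange (k := k) (T ^ 19) (fun i b' => SizeReducedBelow b b' G i) _ b
    ⟨h, rfl, by simp, fun _ _ => rfl⟩ ?_)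
  intro i b' hb'
  have hnorm : ∀ t, ratBasis b' t ⬝ᵥ ratBasis b' t ≤ 2 ^ (s + k) := by
    intro t
    rcases lt_or_ge (t : ℕ) i with ht | ht
    · exact (hb'.gso.normSq_le_of_size (hb'.size t ht) hG).trans (natCast_mul_two_pow_le k s)
    · rw [ratBasis, hb'.keep t ht]; exact hb t
  -- the vectors that precede `b_i` are already size reduced and hence short, so the squared norm of
  -- `b_i` grows by a factor of at most `2 ^ δ` when a multiple of one of them is subtracted
  have hinner := loop_finRange_reverse (k := k) (T ^ 17)
    (fun t b'' => IsGSO (ratBasis b'') G ∧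
      Submodule.span ℤ (Set.range b'') = Submodule.span ℤ (Set.range b') ∧
      (∀ r, r ≠ i → b'' r = b' r) ∧
      (∀ j : Fin k, j < i → t ≤ j → |gs (ratBasis b'' i) (G j)| ≤ 1 / 2) ∧
      ratBasis b'' i ⬝ᵥ ratBasis b'' i ≤ 2 ^ ((s + k) + (k - t) * δ))
    (fun j b =>
      if j < i then do
        let c ← gsCoeff (b i) (G j)
        let r ← qRound c
        let v ← buildVec fun t => do
          let m ← zMul r (b j t)
          zSub (b i t) m
        pure (Function.update b i v)
      else pure b) b'
    ⟨hb'.gso, rfl, fun _ _ => rfl, fun j _ hj => absurd j.isLt (not_lt.2 hj), by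
      simpa using hnorm i⟩ (by
    rintro j b'' ⟨h1, h2, h3, h4, h5⟩
    have hexp : (s + k) + (k - (j + 1 : ℕ)) * δ + δ = (s + k) + (k - (j : ℕ)) * δ := by
      have : k - (j : ℕ) = (k - (j + 1 : ℕ)) + 1 := by have := j.isLt; omega
      rw [this, add_one_mul]; ring
    by_cases hji : j < i
    · have hbi : ∀ t, HeightLE (T ^ 1) (ratVec (b'' i) t) := fun t => by
        rw [pow_one]
        refine heightLE_of_normSq_le h5 ?_ t
        have : (k - (j + 1 : ℕ)) * δ ≤ k * δ := Nat.mul_le_mul_right _ (by omega)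
        omega
      have hyj : ratBasis b'' j ⬝ᵥ ratBasis b'' j ≤ 2 ^ (s + k) := by
        rw [ratBasis, h3 j hji.ne]; exact hnorm j
      have hbj : ∀ t, HeightLE T (ratVec (b'' j) t) := fun t =>
        heightLE_of_normSq_le hyj (by omega) t
      have hgs := gsCoeff_spec (a := 1) hT hl hbi (hGT j)
      have hcost := sizeReduce_step_cost hT hl hgs.2.1 (by simpa using hbi) hbj
      have hgv : (gsCoeff (b'' i) (G j)).val = gs (ratVec (b'' i)) (G j) := hgs.1
      set c := gs (ratVec (b'' i)) (G j) with hc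
      have hupd : Function.update b'' i (fun t => b'' i t - round c * b'' j t)
          = Function.update b'' i (b'' i - round c • b'' j) := rfl
      simp only [hji, if_true, val_bind, cost_bind, hgv, val_pure, cost_pure]
      have hqr : (qRound c).val = round c := rfl
      rw [hqr]
      refine ⟨?_, ?_⟩
      · simp only [val_buildVec, val_bind, zMul, zSub]
        rw [hupd]
        have hself : ratBasis (Function.update b'' i (b'' i - round c • b'' j)) i
            = ratBasis b'' i - (round c : ℚ) • ratBasis b'' j := by
          rw [ratBasis_update, Function.update_self]
        refine ⟨?_, ?_, ?_, ?_, ?_⟩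
        · rw [ratBasis_update]
          exact h1.update_sub_smul hji _
        · rw [span_update_sub_smul _ hji.ne, h2]
        · intro r hr
          rw [Function.update_of_ne hr, h3 r hr]
        · intro j' hj' hjj'
          rw [hself, gs_sub, gs_smul]
          rcases eq_or_ne j' j with rfl | hne
          · rw [h1.gs_self, mul_one]
            exact abs_sub_round _
          · have hlt : j < j' := lt_of_le_of_ne (Fin.le_def.2 hjj') hne.symm
            rw [h1.gs_of_lt hlt, mul_zero, sub_zero]
            exact h4 j' hj' hlt
        · rw [hself, ← hexp]
          exact normSq_sub_round_le (h.pos j) (one_le_mul_normSq h hG j) h5 hyj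
      · have e1 := hgs.2.2
        have e2 : T ^ (3 * 1 + 13) = T ^ 16 := by norm_num
        have e3 : 16 * T ^ 16 ≤ T ^ 17 := mul_pow_le hT
        rw [e2] at e1
        omega
    · simp only [hji, if_false, val_pure, cost_pure]
      refine ⟨⟨h1, h2, h3, fun j' hj' hjj' => ?_, h5.trans ?_⟩, Nat.zero_le _⟩
      · exact absurd (lt_of_le_of_lt (Fin.le_def.2 hjj') hj') hji
      · exact pow_le_pow_right₀ (by norm_num) (by rw [← hexp]; omega))
  obtain ⟨⟨h1, h2, h3, h4, -⟩, hcost⟩ := hinner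
  refine ⟨⟨h1, h2.trans hb'.span, fun r hr j hj => ?_, fun r hr => ?_⟩,
    hcost.trans (mul_succ_pow_le hT hk le_rfl)⟩
  · rcases eq_or_ne r i with rfl | hne
    · exact h4 j hj (Nat.zero_le _)
    · have : (r : ℕ) ≠ i := fun h => hne (Fin.ext h)
      have hrb := h3 r hne
      rw [ratBasis, hrb]
      exact hb'.size r (by omega) j hj
  · have hne : r ≠ i := fun h => by rw [h] at hr; omega
    rw [h3 r hne]
    exact hb'.keep r (by omega)

/-! ### The run of the LLL algorithm -/

theorem lovaszFails_spec {T : ℕ} (hT : 16 ≤ T) (hl : l ≤ T) {b : Fin k → Fin l → ℤ}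
    {G : Fin k → Fin l → ℚ} (hb : ∀ i t, HeightLE (T ^ 1) (ratBasis b i t))
    (hG : ∀ i t, HeightLE (T ^ 1) (G i t)) (i j : Fin k) :
    (lovaszFails G b i j).val = decide (G j ⬝ᵥ G j + gs (ratBasis b j) (G i) ^ 2 * (G i ⬝ᵥ G i)
      < 3 / 4 * (G i ⬝ᵥ G i)) ∧ (lovaszFails G b i j).cost ≤ T ^ 25 := by
  have hi := dot_spec (a := 1) hT hl (hG i) (hG i)
  have hj := dot_spec (a := 1) hT hl (hG j) (hG j)
  have hc := gsCoeff_spec (a := 1) hT hl (hb j) (hG i)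
  have hcv : (gsCoeff (b j) (G i)).val = gs (ratBasis b j) (G i) := hc.1
  have hch : HeightLE (T ^ 4) (gs (ratBasis b j) (G i)) := hc.2.1
  have hih : HeightLE (T ^ 3) (G i ⬝ᵥ G i) := hi.2.1
  have hjh : HeightLE (T ^ 3) (G j ⬝ᵥ G j) := hj.2.1
  have hic : _ ≤ T ^ 16 := hi.2.2.trans (Nat.pow_le_pow_right (by omega) (by omega))
  have hjc : _ ≤ T ^ 16 := hj.2.2.trans (Nat.pow_le_pow_right (by omega) (by omega))
  have hcc : _ ≤ T ^ 16 := hc.2.2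
  have hval : (lovaszFails G b i j).val = decide (G j ⬝ᵥ G j + gs (ratBasis b j) (G i) ^ 2 *
      (G i ⬝ᵥ G i) < 3 / 4 * (G i ⬝ᵥ G i)) := by
    simp only [lovaszFails, val_bind, hi.1, hj.1, hcv, qMul, qAdd, qLt, sq]
  refine ⟨hval, ?_⟩
  have e34 : 16 * T ^ 3 ≤ T ^ 4 := mul_pow_le hT
  have e45 : 16 * T ^ 4 ≤ T ^ 5 := mul_pow_le hT
  have h1 := hch.mul hch
  have h2 := h1.mul hih
  have h3 := hjh.add h2
  have h34 : HeightLE 2 (3 / 4 : ℚ) :=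
    heightLE_of_eq_div (a := 3) (b := 4) (by norm_num) (by norm_num) (by norm_num) (by norm_num)
  have h4 := h34.mul hih
  have hT4 : 16 ≤ T ^ 4 := hT.trans (Nat.le_self_pow (by omega) T)
  have c1 : _ ≤ T ^ 18 := cube_ratLen_le (a := 5) hT hch hch (by omega) (by omega)
  have c2 : _ ≤ T ^ 18 := cube_ratLen_le (a := 5) hT h1 hih (by omega) (by omega)
  have c3 : _ ≤ T ^ 18 := cube_ratLen_le (a := 5) hT hjh h2 (by omega) (by omega)
  have c4 : _ ≤ T ^ 18 := cube_ratLen_le (a := 5) hT h34 hih (by omega) (by omega)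
  have c5 : _ ≤ T ^ 18 := cube_ratLen_le (a := 5) hT h3 h4 (by omega) (by omega)
  have e1 : T ^ 16 ≤ T ^ 18 := Nat.pow_le_pow_right (by omega) (by omega)
  have e2 : 16 * T ^ 18 ≤ T ^ 19 := mul_pow_le hT
  have e3 : T ^ 19 ≤ T ^ 25 := Nat.pow_le_pow_right (by omega) (by omega)
  simp only [lovaszFails, cost_bind, hi.1, hj.1, hcv, qMul, qAdd, qLt]
  omega

/-- The search for a place where the Lovász condition fails is exhaustive. -/
theorem findSwap_spec {T : ℕ} (hT : 16 ≤ T) (hk : k ≤ T) (hl : l ≤ T) {b : Fin k → Fin l → ℤ}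
    {G : Fin k → Fin l → ℚ} (hb : ∀ i t, HeightLE (T ^ 1) (ratBasis b i t))
    (hG : ∀ i t, HeightLE (T ^ 1) (G i t)) :
    ((findSwap G b).val = none → ∀ i j : Fin k, (j : ℕ) = i + 1 →
      3 / 4 * (G i ⬝ᵥ G i) ≤ G j ⬝ᵥ G j + gs (ratBasis b j) (G i) ^ 2 * (G i ⬝ᵥ G i)) ∧
    (∀ i j, (findSwap G b).val = some (i, j) → (j : ℕ) = i + 1 ∧
      G j ⬝ᵥ G j + gs (ratBasis b j) (G i) ^ 2 * (G i ⬝ᵥ G i) < 3 / 4 * (G i ⬝ᵥ G i)) ∧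
    (findSwap G b).cost ≤ T ^ 27 := by
  have hmain := loop_finRange (k := k) (T ^ 25)
    (fun t (r : Option (Fin k × Fin k)) =>
      (r = none → ∀ i j : Fin k, (j : ℕ) = i + 1 → (j : ℕ) < t →
        3 / 4 * (G i ⬝ᵥ G i) ≤ G j ⬝ᵥ G j + gs (ratBasis b j) (G i) ^ 2 * (G i ⬝ᵥ G i)) ∧
      (∀ i j, r = some (i, j) → (j : ℕ) = i + 1 ∧
        G j ⬝ᵥ G j + gs (ratBasis b j) (G i) ^ 2 * (G i ⬝ᵥ G i) < 3 / 4 * (G i ⬝ᵥ G i)))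
    (fun j r =>
      match r with
      | some s => pure (some s)
      | none =>
        if 0 < j.val then do
          let i : Fin k := ⟨j.val - 1, by omega⟩
          let t ← lovaszFails G b i j
          if t then pure (some (i, j)) else pure none
        else pure none) none (by simp) (by
    rintro j r ⟨h1, h2⟩
    match r with
    | some s =>
      simp only [val_pure, cost_pure]
      exact ⟨⟨by simp, h2⟩, Nat.zero_le _⟩
    | none =>
      by_cases hj : 0 < j.val
      · simp only [hj, if_true, val_bind, cost_bind]
        set i : Fin k := ⟨j.val - 1, by omega⟩ with hi
        have hij : (j : ℕ) = i + 1 := by simp only [hi]; omega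
        obtain ⟨hv, hc⟩ := lovaszFails_spec hT hl hb hG i j
        by_cases hlov : G j ⬝ᵥ G j + gs (ratBasis b j) (G i) ^ 2 * (G i ⬝ᵥ G i)
            < 3 / 4 * (G i ⬝ᵥ G i)
        · have hvt : (lovaszFails G b i j).val = true := by rw [hv]; simpa using hlov
          simp only [hvt, if_true, val_pure, cost_pure, add_zero]
          refine ⟨⟨by simp, ?_⟩, hc⟩
          rintro i' j' heq
          simp only [Option.some.injEq, Prod.mk.injEq] at heq
          obtain ⟨rfl, rfl⟩ := heq
          exact ⟨hij, hlov⟩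
        · have hvt : (lovaszFails G b i j).val = false := by rw [hv]; simpa using hlov
          simp only [hvt, Bool.false_eq_true, if_false, val_pure, cost_pure, add_zero]
          refine ⟨⟨fun _ i' j' hij' hj' => ?_, by simp⟩, hc⟩
          by_cases hjj : j' = j
          · subst hjj
            have : i' = i := Fin.ext (by omega)
            subst this
            exact not_lt.1 hlov
          · have : (j' : ℕ) ≠ j := fun h => hjj (Fin.ext h)
            exact h1 rfl i' j' hij' (by omega)
      · simp only [hj, if_false, val_pure, cost_pure]
        refine ⟨⟨fun _ i' j' hij' hj' => ?_, by simp⟩, Nat.zero_le _⟩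
        omega)
  refine ⟨fun h i j hij => hmain.1.1 h i j hij j.isLt, hmain.1.2,
    hmain.2.trans (mul_succ_pow_le hT hk le_rfl)⟩

theorem span_comp_perm (b : Fin k → Fin l → ℤ) (σ : Equiv.Perm (Fin k)) :
    Submodule.span ℤ (Set.range (b ∘ σ)) = Submodule.span ℤ (Set.range b) := by
  rw [Set.range_comp, σ.surjective.range_eq, Set.image_univ]

/-- The LLL algorithm terminates with a reduced basis of the lattice if the potential of the given
basis is less than `(4 / 3) ^ fuel`. -/
theorem lll_spec {s T : ℕ} (hB : LLLBound k l s T) : ∀ (fuel : ℕ) (b : Fin k → Fin l → ℤ)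
    (G : Fin k → Fin l → ℚ), IsGSO (ratBasis b) G → (∀ i, G i ⬝ᵥ G i ≤ 2 ^ s) →
    (∀ i, ratBasis b i ⬝ᵥ ratBasis b i ≤ 2 ^ (s + k)) → potential G < (4 / 3) ^ fuel →
    ∃ o G', (lll fuel b).val = some o ∧ (lll fuel b).cost ≤ fuel * T ^ 32 ∧
      IsGSO (ratBasis o) G' ∧ IsReduced (ratBasis o) G' ∧
      Submodule.span ℤ (Set.range o) = Submodule.span ℤ (Set.range b) ∧
      ∀ i, ratBasis o i ⬝ᵥ ratBasis o i ≤ 2 ^ (s + k) := by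
  have hT := hB.sixteen_le
  have hk := hB.k_le
  have hl := hB.l_le
  have hTb := hB.le
  intro fuel
  induction fuel with
  | zero =>
    intro b G h _ _ hpot
    exact absurd (one_le_potential h) (not_le.2 (by simpa using hpot))
  | succ fuel ih =>
    intro b G h hG hb hpot
    have hbT : ∀ b' : Fin k → Fin l → ℤ,
        (∀ i, ratBasis b' i ⬝ᵥ ratBasis b' i ≤ 2 ^ (s + k)) →
        ∀ i t, HeightLE (T ^ 1) (ratBasis b' i t) := fun b' hb' i t => by
      rw [pow_one]
      exact heightLE_of_normSq_le (hb' i) (by omega) t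
    have hGT : ∀ i t, HeightLE (T ^ 1) (G i t) := fun i t => by
      rw [pow_one]
      refine heightLE_gso h hG ?_ i t
      have hkpos : 0 < k := i.pos
      have := Nat.le_mul_of_pos_left (s * k + (s + k) + 3) hkpos
      omega
    obtain ⟨g1, g2⟩ := gramSchmidt_spec hT hk hl h (hbT b hb) hGT
    obtain ⟨r1, r2⟩ := sizeReduce_spec hB h hG hb
    set b' := (sizeReduce G b).val with hb'
    have hnorm : ∀ t, ratBasis b' t ⬝ᵥ ratBasis b' t ≤ 2 ^ (s + k) := fun t =>
      (r1.gso.normSq_le_of_size (r1.size t t.isLt) hG).trans (natCast_mul_two_pow_le k s)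
    obtain ⟨f1, f2, f3⟩ := findSwap_spec hT hk hl (hbT b' hnorm) hGT
    have e1 : T ^ 21 ≤ T ^ 31 := Nat.pow_le_pow_right (by omega) (by omega)
    have e2 : T ^ 27 ≤ T ^ 31 := Nat.pow_le_pow_right (by omega) (by omega)
    have e3 : 16 * T ^ 31 ≤ T ^ 32 := mul_pow_le hT
    have e4 : T ≤ T ^ 31 := Nat.le_self_pow (by omega) T
    rw [lll, add_one_mul]
    simp only [val_bind, cost_bind, g1, ← hb']
    rcases hs : (findSwap G b').val with _ | ⟨i, j⟩
    · refine ⟨b', G, rfl, ?_, r1.gso, ⟨fun i j hij => r1.size i i.isLt j hij, f1 hs⟩, r1.span,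
        hnorm⟩
      simp only [cost_pure]
      omega
    · obtain ⟨hij, hlov⟩ := f2 i j hs
      have hsw : IsGSO (ratBasis (b' ∘ Equiv.swap i j)) (swapGSO (ratBasis b') G i j) :=
        r1.gso.swap hij
      -- the potential decreases by the factor `3 / 4`, so one unit of fuel less suffices
      obtain ⟨o, G', o1, o2, o3, o4, o5, o6⟩ := ih (b' ∘ Equiv.swap i j)
        (swapGSO (ratBasis b') G i j) hsw (normSq_swap_le r1.gso hij hlov hG)
        (fun t => hnorm _) (by
          have h1 := potential_swap_lt r1.gso hij hlov
          rw [pow_succ] at hpot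
          linarith)
      refine ⟨o, G', o1, ?_, o3, o4, ?_, o6⟩
      · simp only [cost_bind, cost_tick]
        omega
      · rw [o5, span_comp_perm, r1.span]

/-- On a linearly independent family of integer vectors, the LLL algorithm finds a basis of the
lattice that starts with a shortest nonzero vector up to an exponential factor, in a number of steps
that is polynomial in the dimensions and the binary lengths of the entries. -/
theorem exists_lll_eq {s U : ℕ} (hU : s + k + l + 16 ≤ U) {b : Fin k → Fin l → ℤ}
    (hb : LinearIndependent ℚ (ratBasis b)) (hs : ∀ i, b i ⬝ᵥ b i ≤ 2 ^ s) (hk : 0 < k) :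
    ∃ fuel o, (lll fuel b).val = some o ∧ (lll fuel b).cost ≤ U ^ 132 ∧ o ⟨0, hk⟩ ≠ 0 ∧
      o ⟨0, hk⟩ ∈ Submodule.span ℤ (Set.range b) ∧
      o ⟨0, hk⟩ ⬝ᵥ o ⟨0, hk⟩ ≤ 2 ^ (s + k) ∧
      ∀ v ∈ Submodule.span ℤ (Set.range b), v ≠ 0 →
        o ⟨0, hk⟩ ⬝ᵥ o ⟨0, hk⟩ ≤ 2 ^ (k - 1) * (v ⬝ᵥ v) := by
  have hG := isGSO_gso hb
  set G := gso (ratBasis b)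
  have hsq : ∀ i, ratBasis b i ⬝ᵥ ratBasis b i ≤ 2 ^ s := fun i => by
    rw [ratBasis, ratVec_dot]; exact_mod_cast hs i
  have hGs : ∀ i, G i ⬝ᵥ G i ≤ 2 ^ s := fun i => (hG.normSq_le i).trans (hsq i)
  have hU1 : U ≤ U ^ 3 := Nat.le_self_pow (by omega) U
  have hB : LLLBound k l s (U ^ 4) := by
    have hU4 : U ≤ U ^ 4 := Nat.le_self_pow (by omega) U
    refine ⟨by omega, by omega, by omega, ?_⟩
    have h1 : s * k ≤ U * U := Nat.mul_le_mul (by omega) (by omega)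
    have h2 : k * (s * k + (s + k) + 3) ≤ U * (U * U + U) :=
      Nat.mul_le_mul (by omega) (by omega)
    calc s + k + k * (s * k + (s + k) + 3) ≤ U + U * (U * U + U) := by omega
      _ ≤ U * U ^ 3 := by nlinarith
      _ = U ^ 4 := by ring
  -- the Gram determinants are at most `2 ^ (s k)`, and `2 ≤ (4 / 3) ^ 3`
  have hpot : potential G < (4 / 3 : ℚ) ^ (3 * (s * (k * (k + 1))) + 1) := by
    have h1 := potential_le hG hGs (one_le_pow₀ (by norm_num))
    rw [← pow_mul, ← pow_mul] at h1
    have h2 : (2 : ℚ) ^ (s * (k * (k + 1))) ≤ (4 / 3) ^ (3 * (s * (k * (k + 1)))) := by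
      rw [pow_mul (4 / 3 : ℚ) 3]
      exact pow_le_pow_left₀ (by norm_num) (by norm_num) _
    refine lt_of_le_of_lt (h1.trans h2) ?_
    exact pow_lt_pow_right₀ (by norm_num) (Nat.lt_succ_self _)
  obtain ⟨o, G', h1, h2, h3, h4, h5, h6⟩ := lll_spec hB _ b G hG hGs
    (fun i => (hsq i).trans (pow_le_pow_right₀ (by norm_num) (by omega))) hpot
  refine ⟨_, o, h1, h2.trans ?_, ?_, ?_, ?_, ?_⟩
  · have e1 : k * (k + 1) ≤ U * U := Nat.mul_le_mul (by omega) (by omega)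
    have e2 : s * (k * (k + 1)) ≤ U * (U * U) := Nat.mul_le_mul (by omega) e1
    have e3 : 3 * (s * (k * (k + 1))) + 1 ≤ U ^ 4 := by
      calc 3 * (s * (k * (k + 1))) + 1 ≤ 3 * (U * (U * U)) + 1 := by omega
        _ ≤ 16 * U ^ 3 := by
          have : U * (U * U) = U ^ 3 := by ring
          omega
        _ ≤ U ^ 4 := mul_pow_le (by omega)
    calc (3 * (s * (k * (k + 1))) + 1) * (U ^ 4) ^ 32 ≤ U ^ 4 * (U ^ 4) ^ 32 :=
          Nat.mul_le_mul_right _ e3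
      _ = U ^ 132 := by rw [← pow_mul, ← pow_add]
  · intro h0
    have h7 := (h3.pos ⟨0, hk⟩).trans_le (h3.normSq_le ⟨0, hk⟩)
    rw [ratBasis, ratVec_dot, h0] at h7
    simp at h7
  · rw [← h5]; exact Submodule.subset_span ⟨_, rfl⟩
  · have := h6 ⟨0, hk⟩
    rw [ratBasis, ratVec_dot] at this
    exact_mod_cast this
  · intro v hv hv0
    rw [← h5] at hv
    exact h4.normSq_le h3 hk hv hv0

end LLLRun


/-! ### Euclid's algorithm and other arithmetic subroutines -/

theorem val_euclid (b : ℕ) : ∀ a, (euclid a b).val = Nat.gcd a b := by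
  induction b using Nat.strong_induction_on with
  | _ b ih =>
  intro a
  rw [euclid]
  split_ifs with h
  · subst h; simp
  · simp only [val_bind]
    rw [ih (a % b) (Nat.mod_lt _ (Nat.pos_of_ne_zero h)), Nat.gcd_comm b, ← Nat.gcd_rec,
      Nat.gcd_comm]

theorem bitLen_natCast_le {a s : ℕ} (h : a < 2 ^ s) : bitLen (a : ℤ) ≤ s + 1 := by
  have : Nat.size a ≤ s := Nat.size_le.2 h
  simpa [bitLen] using this

theorem cost_euclid_step (a b : ℕ) (h : b ≠ 0) :
    (euclid a b).cost = bitLen a * bitLen b + (euclid b (a % b)).cost := by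
  rw [euclid, dif_neg h]
  rfl

/-- The product of the two arguments is at least halved in every step but the first. -/
theorem cost_euclid_le_of_le (s b : ℕ) : ∀ a, b ≤ a → a < 2 ^ s →
    (euclid a b).cost ≤ Nat.size (a * b) * (s + 1) ^ 2 := by
  induction b using Nat.strong_induction_on with
  | _ b ih =>
  intro a hba ha
  rcases eq_or_ne b 0 with h | h
  · subst h
    rw [euclid]
    simp
  · have hmod := Nat.mod_lt a (Nat.pos_of_ne_zero h)
    have h1 := ih (a % b) hmod b hmod.le (hba.trans_lt ha)
    have h2 : 2 * (a % b) ≤ a := by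
      have h3 := Nat.div_add_mod a b
      have h4 : 1 ≤ a / b := (Nat.one_le_div_iff (Nat.pos_of_ne_zero h)).2 hba
      nlinarith
    have hsize : Nat.size (b * (a % b)) + 1 ≤ Nat.size (a * b) := by
      have hpos : 0 < Nat.size (a * b) := Nat.size_pos.2
        (Nat.mul_pos (lt_of_lt_of_le (Nat.pos_of_ne_zero h) hba) (Nat.pos_of_ne_zero h))
      have h5 : b * (a % b) < 2 ^ (Nat.size (a * b) - 1) := by
        have h6 := Nat.lt_size_self (a * b)
        have h7 : 2 ^ Nat.size (a * b) = 2 ^ (Nat.size (a * b) - 1) * 2 := by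
          rw [← pow_succ]; congr 1; omega
        rw [h7] at h6
        nlinarith
      have := Nat.size_le.2 h5
      omega
    have h8 : bitLen (a : ℤ) * bitLen (b : ℤ) ≤ (s + 1) ^ 2 := by
      rw [sq]
      exact Nat.mul_le_mul (bitLen_natCast_le ha) (bitLen_natCast_le (hba.trans_lt ha))
    rw [cost_euclid_step a b h]
    have h9 := Nat.mul_le_mul_right ((s + 1) ^ 2) hsize
    rw [add_one_mul] at h9
    omega

theorem cost_euclid_le {s a b : ℕ} (ha : a < 2 ^ s) (hb : b < 2 ^ s) :
    (euclid a b).cost ≤ (2 * s + 1) * (s + 1) ^ 2 := by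
  have hsize : ∀ c d : ℕ, c < 2 ^ s → d < 2 ^ s → Nat.size (c * d) ≤ 2 * s := by
    intro c d hc hd
    rw [Nat.size_le, two_mul, pow_add]
    exact Nat.mul_lt_mul'' hc hd
  rcases le_or_gt b a with h | h
  · refine (cost_euclid_le_of_le s b a h ha).trans (Nat.mul_le_mul_right _ ?_)
    have := hsize a b ha hb
    omega
  · have hb0 : b ≠ 0 := by omega
    rw [cost_euclid_step a b hb0, Nat.mod_eq_of_lt h]
    have h1 := cost_euclid_le_of_le s a b h.le hb
    have h2 := Nat.mul_le_mul_right ((s + 1) ^ 2) (hsize b a hb ha)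
    have h8 : bitLen (a : ℤ) * bitLen (b : ℤ) ≤ (s + 1) ^ 2 := by
      rw [sq]
      exact Nat.mul_le_mul (bitLen_natCast_le ha) (bitLen_natCast_le hb)
    rw [add_one_mul]
    omega

theorem gcdVec_spec {p s : ℕ} (hp : 0 < p) {x : Fin p → ℤ} (hx : ∀ j, |x j| < 2 ^ s) :
    (gcdVec x).val = (if x ⟨0, hp⟩ < 0 then -1 else 1) *
        (((Finset.univ.gcd fun j => (x j).natAbs : ℕ)) : ℤ) ∧
      |(gcdVec x).val| < 2 ^ s ∧
      (gcdVec x).cost ≤ p * ((2 * s + 1) * (s + 1) ^ 2 + 1) + 3 * s + 8 := by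
  have hxn : ∀ j, (x j).natAbs < 2 ^ s := fun j => by
    zify; simpa using hx j
  have hloop := loop_finRange (k := p) ((2 * s + 1) * (s + 1) ^ 2)
    (fun t (g : ℕ) => g < 2 ^ s ∧ (∀ j : Fin p, (j : ℕ) < t → g ∣ (x j).natAbs) ∧
      ∀ d : ℕ, (∀ j : Fin p, (j : ℕ) < t → d ∣ (x j).natAbs) → d ∣ g)
    (fun j g => euclid (x j).natAbs g) 0 (by simp) (by
    rintro j g ⟨h1, h2, h3⟩
    refine ⟨⟨?_, ?_, ?_⟩, cost_euclid_le (hxn j) h1⟩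
    · rw [val_euclid]
      rcases Nat.eq_zero_or_pos g with h | h
      · rw [h, Nat.gcd_zero_right]; exact hxn j
      · exact (Nat.gcd_le_right _ h).trans_lt h1
    · intro i hi
      rw [val_euclid]
      rcases Nat.lt_succ_iff_lt_or_eq.1 hi with h | h
      · exact (Nat.gcd_dvd_right _ _).trans (h2 i h)
      · rw [Fin.ext h]; exact Nat.gcd_dvd_left _ _
    · intro d hd
      rw [val_euclid]
      exact Nat.dvd_gcd (hd j (Nat.lt_succ_self _))
        (h3 d fun i hi => hd i (Nat.lt_succ_of_lt hi)))
  set G := loop (List.finRange p) 0 fun j g => euclid (x j).natAbs g with hG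
  obtain ⟨⟨h1, h2, h3⟩, hc⟩ := hloop
  have hgcd : G.val = Finset.univ.gcd fun j => (x j).natAbs :=
    Nat.dvd_antisymm (Finset.dvd_gcd fun j _ => h2 j j.isLt)
      (h3 _ fun j _ => Finset.gcd_dvd (Finset.mem_univ j))
  have hg1 : |((G.val : ℕ) : ℤ)| ≤ 2 ^ s := by
    rw [Nat.abs_cast]; exact_mod_cast h1.le
  have hb := bitLen_le hg1
  have hx0 := bitLen_le (hx ⟨0, hp⟩).le
  have hz : bitLen 0 = 1 := by simp [bitLen]
  have hval : (gcdVec x).val = (if x ⟨0, hp⟩ < 0 then -1 else 1) * ((G.val : ℕ) : ℤ) := by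
    simp only [gcdVec, val_bind, ← hG, dif_pos hp, zLt]
    by_cases hneg : x ⟨0, hp⟩ < 0
    · simp [hneg, zNeg]
    · simp [hneg]
  refine ⟨by rw [hval, hgcd], ?_, ?_⟩
  · rw [hval, abs_mul, Nat.abs_cast]
    have : |(if x ⟨0, hp⟩ < 0 then (-1 : ℤ) else 1)| = 1 := by split_ifs <;> simp
    rw [this, one_mul]
    exact_mod_cast h1
  · simp only [gcdVec, cost_bind, ← hG, dif_pos hp, zLt]
    by_cases hneg : x ⟨0, hp⟩ < 0
    · simp only [hneg, decide_true, if_true, zNeg]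
      omega
    · simp only [hneg, decide_false, Bool.false_eq_true, if_false, cost_pure]
      omega

/-- The signed greatest common divisor recovers the factor of a multiple of a primitive vector with
positive first entry. -/
theorem val_gcdVec_mul {p : ℕ} (hp : 0 < p) {γ : Fin p → ℤ} (hγ : 0 < γ ⟨0, hp⟩)
    (hgcd : (Finset.univ.gcd fun j => (γ j).natAbs) = 1) (a : ℤ) :
    (gcdVec fun j => a * γ j).val = a := by
  obtain ⟨s, hs⟩ : ∃ s : ℕ, ∀ j, |a * γ j| < 2 ^ s := by
    obtain ⟨B, hB⟩ := (Set.finite_range fun j => (a * γ j).natAbs).bddAbove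
    refine ⟨B, fun j => ?_⟩
    have h1 : (a * γ j).natAbs ≤ B := hB ⟨j, rfl⟩
    have h2 := h1.trans_lt (Nat.lt_two_pow_self (n := B))
    zify at h2
    exact h2
  rw [(gcdVec_spec hp hs).1]
  have h1 : (Finset.univ.gcd fun j => (a * γ j).natAbs) = a.natAbs := by
    simp only [Int.natAbs_mul]
    rw [Finset.gcd_mul_left, hgcd]
    simp
  rw [h1]
  rcases lt_trichotomy a 0 with h | h | h
  · rw [if_pos (mul_neg_of_neg_of_pos h hγ)]
    omega
  · subst h; simp
  · rw [if_neg (not_lt.2 (mul_nonneg h.le hγ.le))]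
    omega

theorem twoPow_spec (k : ℕ) :
    (twoPow k).val = 2 ^ k ∧ (twoPow k).cost ≤ k * (2 * (k + 2) + 1) := by
  have h := loop_invariant (2 * (k + 2)) (fun _ s => zAdd s s) (List.range k)
    (fun t (s : ℤ) => s = 2 ^ t) 1 (by simp) (by
    rintro t ht _ _ s rfl
    rw [List.length_range] at ht
    refine ⟨by simp only [zAdd]; ring, ?_⟩
    have := bitLen_le (z := 2 ^ t) (s := k) (by
      rw [abs_of_pos (by positivity)]; exact two_pow_mono ht.le)
    simp only [zAdd]
    omega)
  rw [List.length_range] at h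
  exact h

theorem ceilSqrt_spec {k T : ℕ} (hT : 16 ≤ T) (hk : k ≤ T) :
    0 ≤ (ceilSqrt k).val ∧ (ceilSqrt k).val ≤ k ∧ (k : ℤ) ≤ (ceilSqrt k).val ^ 2 ∧
      (ceilSqrt k).cost ≤ T ^ 6 := by
  -- after `t` turns, the counter equals `t` unless its square has reached `k` before
  have h := loop_invariant (T ^ 4) (fun _ s => do
      let q ← zMul s s
      let t ← zLt q k
      if t then zAdd s 1 else pure s) (List.range k)
    (fun t (s : ℤ) => 0 ≤ s ∧ s ≤ t ∧ ((k : ℤ) ≤ s ^ 2 ∨ s = t)) 0 (by simp) (by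
    rintro t ht _ _ s ⟨h1, h2, h3⟩
    rw [List.length_range] at ht
    have hkT : (k : ℤ) ≤ 2 ^ T := by
      have := hk.trans (Nat.lt_two_pow_self (n := T)).le
      exact_mod_cast this
    have hsk : s ≤ k := by omega
    have hs : |s| ≤ 2 ^ T := by rw [abs_of_nonneg h1]; exact hsk.trans hkT
    have hss : |s * s| ≤ 2 ^ (T + T) := by
      rw [abs_mul, pow_add]
      exact mul_le_mul hs hs (abs_nonneg _) (by positivity)
    have b1 := bitLen_le hs
    have b2 := bitLen_le hss
    have b3 : bitLen (k : ℤ) ≤ T + 2 := bitLen_le (by rw [Nat.abs_cast]; exact hkT)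
    have b4 : bitLen 1 = 2 := by simp [bitLen]
    have b5 : bitLen s * bitLen s ≤ T ^ 3 := by
      calc bitLen s * bitLen s ≤ (T + 2) * (T + 2) := Nat.mul_le_mul b1 b1
        _ ≤ T ^ 3 := by nlinarith [pow_succ T 2]
    have b6 : 16 * T ^ 3 ≤ T ^ 4 := mul_pow_le hT
    have b7 : T ≤ T ^ 3 := Nat.le_self_pow (by omega) T
    by_cases hlt : s * s < k
    · simp only [zMul, zLt, zAdd, val_bind, cost_bind, hlt, decide_true, if_true]
      refine ⟨⟨by omega, by push_cast; omega, ?_⟩, by omega⟩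
      rcases h3 with h3 | h3
      · exact absurd hlt (not_lt.2 (by rw [← sq]; exact h3))
      · right; push_cast; omega
    · simp only [zMul, zLt, val_bind, cost_bind, hlt, decide_false, Bool.false_eq_true, if_false,
        val_pure, cost_pure]
      refine ⟨⟨h1, by push_cast; omega, Or.inl ?_⟩, by omega⟩
      rw [sq]; exact not_lt.1 hlt)
  rw [List.length_range] at h
  obtain ⟨⟨h1, h2, h3⟩, h4⟩ := h
  refine ⟨h1, h2, ?_, h4.trans (mul_succ_pow_le hT hk le_rfl)⟩
  rcases h3 with h3 | h3
  · exact h3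
  · have h5 : (ceilSqrt k).val = k := h3
    rw [h5]
    have : k ≤ k ^ 2 := Nat.le_self_pow (by omega) k
    exact_mod_cast this

/-! ### The lattice of the ELO algorithm -/

section Lattice

open Matrix

variable {n p : ℕ}

theorem sum_latticeBasis (m : ℤ) (mX : Fin n → Fin p → ℤ) (mY : Fin n → ℤ)
    (z : Fin (p + n + n) → ℤ) :
    (∀ i, (∑ r, z r • latticeBasis m mX mY r) (Fin.castAdd n (Fin.castAdd p i))
      = ∑ j, mX i j * z (Fin.castAdd n (Fin.castAdd n j)) + mY i * z (Fin.castAdd n (Fin.natAdd p i))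
        + m * z (Fin.natAdd (p + n) i)) ∧
    (∀ j, (∑ r, z r • latticeBasis m mX mY r) (Fin.castAdd n (Fin.natAdd n j))
      = z (Fin.castAdd n (Fin.castAdd n j))) ∧
    (∀ i, (∑ r, z r • latticeBasis m mX mY r) (Fin.natAdd (n + p) i)
      = z (Fin.natAdd (p + n) i)) := by
  refine ⟨fun i => ?_, fun j => ?_, fun i => ?_⟩ <;>
  · simp only [Finset.sum_apply, Pi.smul_apply, smul_eq_mul, Fin.sum_univ_add, latticeBasis,
      Fin.append_left, Fin.append_right, Pi.zero_apply, Pi.single_apply, mul_zero, mul_ite, mul_one,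
      Finset.sum_ite_eq, Finset.mem_univ, if_true, Finset.sum_const_zero, add_zero, zero_add]
    try simp only [mul_comm]

/-- The basis is linearly independent because the diagonal entries in its middle block do not vanish,
which is why the ELO algorithm keeps the observations away from zero. -/
theorem linearIndependent_latticeBasis {m : ℤ} (mX : Fin n → Fin p → ℤ) {mY : Fin n → ℤ}
    (hY : ∀ i, mY i ≠ 0) : LinearIndependent ℚ (ratBasis (latticeBasis m mX mY)) := by
  have hZ : LinearIndependent ℤ (latticeBasis m mX mY) := by
    rw [Fintype.linearIndependent_iff]
    intro z hz
    obtain ⟨h1, h2, h3⟩ := sum_latticeBasis m mX mY z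
    simp only [hz, Pi.zero_apply] at h1 h2 h3
    have h4 : ∀ i, z (Fin.castAdd n (Fin.natAdd p i)) = 0 := fun i => by
      have := h1 i
      simp only [← h2, ← h3, mul_zero, Finset.sum_const_zero, zero_add, add_zero] at this
      exact (mul_eq_zero.1 this.symm).resolve_left (hY i)
    refine Fin.addCases (Fin.addCases (fun j => (h2 j).symm) h4) fun i => (h3 i).symm
  let f : (Fin (n + p + n) → ℤ) →ₗ[ℤ] (Fin (n + p + n) → ℚ) :=
    { toFun := ratVec
      map_add' := fun x y => by ext t; simp [ratVec]
      map_smul' := fun a x => by ext t; simp [ratVec] }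
  have hf : LinearMap.ker f = ⊥ := by
    rw [LinearMap.ker_eq_bot]
    intro x y hxy
    ext t
    have := congrFun hxy t
    simpa [f, ratVec] using this
  exact (LinearIndependent.iff_fractionRing ℤ ℚ).1 (hZ.map' f hf)

theorem dot_self_le_of_abs_le {l E : ℕ} {v : Fin l → ℤ} (h : ∀ t, |v t| ≤ 2 ^ E) :
    v ⬝ᵥ v ≤ 2 ^ (2 * E + l) := by
  have h1 : v ⬝ᵥ v ≤ ∑ _t : Fin l, (2 : ℤ) ^ (2 * E) := by
    refine Finset.sum_le_sum fun t _ => ?_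
    rw [← abs_mul_abs_self, two_mul, pow_add]
    exact mul_le_mul (h t) (h t) (abs_nonneg _) (by positivity)
  rw [Finset.sum_const, Finset.card_univ, Fintype.card_fin, nsmul_eq_mul] at h1
  have h2 : (l : ℤ) ≤ 2 ^ l := by exact_mod_cast (Nat.lt_two_pow_self (n := l)).le
  refine h1.trans ?_
  rw [pow_add, mul_comm]
  exact mul_le_mul_of_nonneg_left h2 (by positivity)

theorem abs_le_of_dot_self_le {l E : ℕ} {v : Fin l → ℤ} (h : v ⬝ᵥ v ≤ 2 ^ E) (t : Fin l) :
    |v t| ≤ 2 ^ E := by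
  have h1 : v t * v t ≤ v ⬝ᵥ v :=
    Finset.single_le_sum (f := fun t => v t * v t) (fun _ _ => mul_self_nonneg _)
      (Finset.mem_univ t)
  rw [← Int.natAbs_mul_self' (v t)] at h1
  have h2 : ((v t).natAbs : ℤ) ≤ (v t).natAbs * (v t).natAbs := by
    exact_mod_cast Nat.le_mul_self _
  rw [Int.abs_eq_natAbs]
  omega

theorem abs_latticeBasis_le {m : ℤ} {mX : Fin n → Fin p → ℤ} {mY : Fin n → ℤ} {E : ℕ}
    (hm : |m| ≤ 2 ^ E) (hX : ∀ i j, |mX i j| ≤ 2 ^ E) (hY : ∀ i, |mY i| ≤ 2 ^ E) :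
    ∀ r t, |latticeBasis m mX mY r t| ≤ 2 ^ E := by
  have h0 : (0 : ℤ) ≤ 2 ^ E := by positivity
  have h1 : (1 : ℤ) ≤ 2 ^ E := one_le_pow₀ (by norm_num)
  refine Fin.addCases (Fin.addCases (fun j => ?_) fun i => ?_) fun i => ?_ <;>
  refine Fin.addCases (Fin.addCases (fun i' => ?_) fun j' => ?_) fun i' => ?_ <;>
  simp only [latticeBasis, Fin.append_left, Fin.append_right, Pi.zero_apply, Pi.single_apply,
    abs_zero, h0, hX] <;>
  split_ifs <;> simp [hm, hY, h0, h1]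

end Lattice


/-! ### Cost and result of the ELO algorithm -/

section ELO

open Matrix

@[simp] theorem val_zMul (x y : ℤ) : (zMul x y).val = x * y := rfl
@[simp] theorem val_zAdd (x y : ℤ) : (zAdd x y).val = x + y := rfl

theorem bitLen_le_cube {T c : ℕ} (hT : 16 ≤ T) (hc : c ≤ 255) {z : ℤ} (hz : |z| ≤ 2 ^ (c * T)) :
    bitLen z ≤ T ^ 3 := by
  have h1 := bitLen_le hz
  have h2 : c * T ≤ 255 * T := Nat.mul_le_mul_right _ hc
  have h3 : T ^ 3 = T * T * T := by ring
  have h4 : 16 * 16 ≤ T * T := Nat.mul_le_mul hT hT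
  have h5 : 256 * T ≤ T * T * T := Nat.mul_le_mul_right _ h4
  omega

theorem abs_mul_le_two_pow {x y : ℤ} {a b : ℕ} (hx : |x| ≤ 2 ^ a) (hy : |y| ≤ 2 ^ b) :
    |x * y| ≤ 2 ^ (a + b) := by
  rw [abs_mul, pow_add]
  exact mul_le_mul hx hy (abs_nonneg _) (by positivity)

theorem abs_add_le_two_pow {x y : ℤ} {a : ℕ} (hx : |x| ≤ 2 ^ a) (hy : |y| ≤ 2 ^ a) :
    |x + y| ≤ 2 ^ (a + 1) := by
  have := abs_add_le x y
  rw [pow_succ]; linarith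

theorem abs_le_two_pow_mono {x : ℤ} {a b : ℕ} (hx : |x| ≤ 2 ^ a) (h : a ≤ b) : |x| ≤ 2 ^ b :=
  hx.trans (two_pow_mono h)

theorem natCast_abs_le_two_pow {a T : ℕ} (h : a ≤ T) : |(a : ℤ)| ≤ 2 ^ T := by
  rw [Nat.abs_cast]
  exact_mod_cast h.trans (Nat.lt_two_pow_self (n := T)).le

theorem mul_le_pow_of_le {T a b x y : ℕ} (hx : x ≤ T ^ a) (hy : y ≤ T ^ b) :
    x * y ≤ T ^ (a + b) := by
  rw [pow_add]; exact Nat.mul_le_mul hx hy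

variable {n p : ℕ}

/-- The vector `Y₁ = Y + X Z` of the ELO algorithm. -/
def shiftedObs (Y : Fin n → ℤ) (X : Fin n → Fin p → ℤ) (Z : Fin p → ℤ) (i : Fin n) : ℤ :=
  Y i + ∑ j, X i j * Z j

/-- Numbers of absolute value less than `3` are replaced by `3`. -/
def awayFromZero (y : ℤ) : ℤ := if |y| < 3 then 3 else y

/-- The computation of one coordinate of `X Z`, added to an observation. -/
theorem shiftedObs_step_spec {T : ℕ} (hT : 16 ≤ T) (hpT : p ≤ T) {y : ℤ} {x z : Fin p → ℤ}
    (hy : |y| ≤ 2 ^ T) (hx : ∀ j, |x j| ≤ 2 ^ T) (hz : ∀ j, |z j| ≤ 2 ^ T) :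
    (loop (List.finRange p) y fun j s => do
      let t ← zMul (x j) (z j)
      zAdd s t).val = y + ∑ j, x j * z j ∧
    |y + ∑ j, x j * z j| ≤ 2 ^ (4 * T) ∧
    (loop (List.finRange p) y fun j s => do
      let t ← zMul (x j) (z j)
      zAdd s t).cost ≤ T ^ 9 := by
  have hprod : ∀ j, |x j * z j| ≤ 2 ^ (2 * T) := fun j => by
    rw [two_mul]; exact abs_mul_le_two_pow (hx j) (hz j)
  have hbound : ∀ t, t ≤ p → (t + 1 : ℤ) * 2 ^ (2 * T) ≤ 2 ^ (4 * T) := by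
    intro t ht
    have h1 : (t + 1 : ℤ) ≤ 2 ^ (2 * T) := by
      have h2 := Nat.lt_two_pow_self (n := t)
      have h3 : t ≤ 2 * T := by omega
      have h4 : (t + 1 : ℤ) ≤ 2 ^ t := by exact_mod_cast h2
      exact h4.trans (two_pow_mono h3)
    calc (t + 1 : ℤ) * 2 ^ (2 * T) ≤ 2 ^ (2 * T) * 2 ^ (2 * T) :=
          mul_le_mul_of_nonneg_right h1 (by positivity)
      _ = 2 ^ (4 * T) := by rw [← pow_add]; congr 1; ring
  have h := loop_finRange (k := p) (T ^ 7)
    (fun t (s : ℤ) => s = y + (∑ j : Fin p, if (j : ℕ) < t then x j * z j else 0) ∧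
      |s| ≤ (t + 1 : ℤ) * 2 ^ (2 * T))
    (fun j s => do
      let t ← zMul (x j) (z j)
      zAdd s t) y ⟨by simp, by
        simpa using abs_le_two_pow_mono hy (show T ≤ 2 * T by omega)⟩ (by
    rintro j s ⟨h1, h2⟩
    refine ⟨⟨?_, ?_⟩, ?_⟩
    · rw [sum_ite_lt_succ, ← add_assoc, ← h1]; rfl
    · simp only [val_bind, zMul, zAdd]
      have h3 := abs_add_le s (x j * z j)
      have h4 := hprod j
      push_cast
      linarith
    · have b1 := bitLen_le_cube (c := 1) hT (by norm_num) (by simpa using hx j)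
      have b2 := bitLen_le_cube (c := 1) hT (by norm_num) (by simpa using hz j)
      have b3 := bitLen_le_cube (c := 4) hT (by norm_num) (h2.trans (hbound j j.isLt.le))
      have b4 := bitLen_le_cube (c := 2) hT (by norm_num) (hprod j)
      have b5 : _ ≤ T ^ 6 := mul_le_pow_of_le b1 b2
      have b6 : T ^ 3 ≤ T ^ 6 := Nat.pow_le_pow_right (by omega) (by omega)
      have b7 : 16 * T ^ 6 ≤ T ^ 7 := mul_pow_le hT
      simp only [cost_bind, zMul, zAdd]
      omega)
  obtain ⟨⟨h1, h2⟩, h3⟩ := h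
  rw [sum_ite_lt_card] at h1
  refine ⟨h1, ?_, h3.trans (mul_succ_pow_le hT hpT le_rfl)⟩
  rw [← h1]
  exact h2.trans (hbound p le_rfl)

theorem val_awayFromZero (y : ℤ) : ((do
      let a ← zAbs y
      let small ← zLt a 3
      if small then pure 3 else pure y : Timed ℤ)).val = awayFromZero y := by
  simp only [val_bind, zAbs, zLt, awayFromZero]
  by_cases h : |y| < 3 <;> simp [h]

theorem cost_awayFromZero {T : ℕ} (hT : 16 ≤ T) {y : ℤ} (hy : |y| ≤ 2 ^ (4 * T)) : ((do
      let a ← zAbs y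
      let small ← zLt a 3
      if small then pure 3 else pure y : Timed ℤ)).cost ≤ T ^ 4 := by
  have b1 := bitLen_le_cube hT (by norm_num) hy
  have b2 := bitLen_le_cube (c := 4) (z := |y|) hT (by norm_num) (by rwa [abs_abs])
  have b3 : bitLen 3 ≤ T ^ 3 := bitLen_le_cube (c := 2) hT (by norm_num) (by
    have : (2 : ℤ) ^ 2 ≤ 2 ^ (2 * T) := two_pow_mono (by omega)
    norm_num at this ⊢
    omega)
  have b4 : 16 * T ^ 3 ≤ T ^ 4 := mul_pow_le hT
  simp only [cost_bind, zAbs, zLt]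
  by_cases h : |y| < 3
  · simp only [h, decide_true, if_true, cost_pure]; omega
  · simp only [h, decide_false, Bool.false_eq_true, if_false, cost_pure]; omega

theorem awayFromZero_ne_zero (y : ℤ) : awayFromZero y ≠ 0 := by
  unfold awayFromZero
  split_ifs with h
  · norm_num
  · rintro rfl; simp at h

theorem abs_awayFromZero_le {T : ℕ} (hT : 16 ≤ T) {y : ℤ} (hy : |y| ≤ 2 ^ (4 * T)) :
    |awayFromZero y| ≤ 2 ^ (4 * T) := by
  unfold awayFromZero
  split_ifs with h
  · have : (2 : ℤ) ^ 2 ≤ 2 ^ (4 * T) := two_pow_mono (by omega)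
    norm_num at this ⊢
    omega
  · exact hy

/-- The output of the ELO algorithm, given the coordinates `n + 1, …, n + p` of the first vector of
the reduced basis. -/
def eloOutput (x Z : Fin p → ℤ) : Fin p → ℤ :=
  if (gcdVec x).val ≠ 0 then fun j => x j / (gcdVec x).val - Z j else 0

/-- The middle block of a vector of the lattice of the ELO algorithm. -/
def middle (v : Fin (n + p + n) → ℤ) (j : Fin p) : ℤ := v (Fin.castAdd n (Fin.natAdd n j))

/-- The last steps of the ELO algorithm, after the lattice reduction. -/
theorem eloOutput_spec {T : ℕ} (hT : 16 ≤ T) (hp : 0 < p) (hpT : p ≤ T) {x Z : Fin p → ℤ}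
    (hx : ∀ j, |x j| ≤ 2 ^ (28 * T)) (hZ : ∀ j, |Z j| ≤ 2 ^ T) :
    ((do
      let g ← gcdVec x
      if g ≠ 0 then do
        let r ← buildVec fun j => do
          let q ← zDiv (x j) g
          zSub q (Z j)
        pure (some r)
      else pure (some 0) : Timed (Option (Fin p → ℤ)))).val = some (eloOutput x Z) ∧
    (∀ j, |eloOutput x Z j| ≤ 2 ^ (29 * T)) ∧
    ((do
      let g ← gcdVec x
      if g ≠ 0 then do
        let r ← buildVec fun j => do
          let q ← zDiv (x j) g
          zSub q (Z j)
        pure (some r)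
      else pure (some 0) : Timed (Option (Fin p → ℤ)))).cost ≤ T ^ 12 := by
  have hx' : ∀ j, |x j| < 2 ^ (28 * T + 1) := fun j =>
    (hx j).trans_lt (pow_lt_pow_right₀ (by norm_num) (Nat.lt_succ_self _))
  obtain ⟨-, hgabs, hgcost⟩ := gcdVec_spec hp hx'
  have hq : ∀ j, |x j / (gcdVec x).val| ≤ 2 ^ (28 * T) := fun j =>
    (by
      have h1 := Int.natAbs_ediv_le_natAbs (x j) (gcdVec x).val
      have h2 := hx j
      rw [Int.abs_eq_natAbs] at h2 ⊢
      omega)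
  have h29 : |(gcdVec x).val| ≤ 2 ^ (29 * T) := hgabs.le.trans (two_pow_mono (by omega))
  have hgc : (gcdVec x).cost ≤ T ^ 11 := by
    refine hgcost.trans ?_
    have h1 : 28 * T + 1 + 1 ≤ T ^ 3 := by
      have h3 : T ^ 3 = T * T * T := by ring
      have h4 : 16 * 16 ≤ T * T := Nat.mul_le_mul hT hT
      have h5 : 256 * T ≤ T * T * T := Nat.mul_le_mul_right _ h4
      omega
    have h2 : 2 * (28 * T + 1) + 1 ≤ T ^ 3 := by
      have h3 : T ^ 3 = T * T * T := by ring
      have h4 : 16 * 16 ≤ T * T := Nat.mul_le_mul hT hT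
      have h5 : 256 * T ≤ T * T * T := Nat.mul_le_mul_right _ h4
      omega
    have h3 : (2 * (28 * T + 1) + 1) * (28 * T + 1 + 1) ^ 2 ≤ T ^ 3 * (T ^ 3) ^ 2 :=
      Nat.mul_le_mul h2 (Nat.pow_le_pow_left h1 2)
    have h4 : T ^ 3 * (T ^ 3) ^ 2 = T ^ 9 := by ring
    have h5 : p * ((2 * (28 * T + 1) + 1) * (28 * T + 1 + 1) ^ 2 + 1) ≤ T * (T ^ 9 + 1) :=
      Nat.mul_le_mul hpT (by omega)
    have h6 : T * (T ^ 9 + 1) = T ^ 10 + T := by ring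
    have h7 : 16 * T ^ 10 ≤ T ^ 11 := mul_pow_le hT
    have h8 : T ^ 3 ≤ T ^ 10 := Nat.pow_le_pow_right (by omega) (by omega)
    omega
  refine ⟨?_, ?_, ?_⟩
  · simp only [val_bind, eloOutput]
    by_cases h : (gcdVec x).val = 0
    · simp [h]
    · simp [h, zDiv, zSub]
  · intro j
    unfold eloOutput
    split_ifs with h
    · have h1 := hq j
      have h2 := hZ j
      have h3 := abs_sub (x j / (gcdVec x).val) (Z j)
      have h4 : (2 : ℤ) ^ T ≤ 2 ^ (28 * T) := two_pow_mono (by omega)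
      have h5 : (2 : ℤ) ^ (28 * T + 1) ≤ 2 ^ (29 * T) := two_pow_mono (by omega)
      rw [pow_succ] at h5
      beta_reduce
      omega
    · simp
  · simp only [cost_bind]
    have h12 : 16 * T ^ 11 ≤ T ^ 12 := mul_pow_le hT
    by_cases h : (gcdVec x).val = 0
    · simp only [h, ne_eq, not_true_eq_false, if_false, cost_pure]; omega
    · simp only [h, ne_eq, not_false_eq_true, if_true, cost_bind, cost_pure]
      have hb : ∀ j, ((do
          let q ← zDiv (x j) (gcdVec x).val
          zSub q (Z j) : Timed ℤ)).cost ≤ T ^ 7 := by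
        intro j
        have b1 := bitLen_le_cube hT (by norm_num) (hx j)
        have b2 := bitLen_le_cube hT (by norm_num) h29
        have b3 := bitLen_le_cube hT (by norm_num) (hq j)
        have b4 := bitLen_le_cube (c := 1) hT (by norm_num) (by simpa using hZ j)
        have b5 : _ ≤ T ^ 6 := mul_le_pow_of_le b1 b2
        have b6 : T ^ 3 ≤ T ^ 6 := Nat.pow_le_pow_right (by omega) (by omega)
        have b7 : 16 * T ^ 6 ≤ T ^ 7 := mul_pow_le hT
        simp only [cost_bind, zDiv, zSub]
        omega
      have h1 : _ ≤ T ^ 9 := (cost_buildVec_le _ hb).trans (mul_succ_pow_le hT hpT le_rfl)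
      have h2 : T ^ 9 ≤ T ^ 11 := Nat.pow_le_pow_right (by omega) (by omega)
      omega

set_option maxHeartbeats 1000000 in
set_option exponentiation.threshold 400 in
/-- The ELO algorithm runs in polynomial time, and computes its output from a lattice vector that is
shortest up to an exponential factor. -/
theorem exists_elo_eq {T : ℕ} (hT : 16 ≤ T) (hp : 0 < p) (hn : 0 < n) (hnT : n ≤ T) (hpT : p ≤ T)
    {Y : Fin n → ℤ} {X : Fin n → Fin p → ℤ} {R W : ℤ} {Z : Fin p → ℤ}
    (hY : ∀ i, |Y i| ≤ 2 ^ T) (hX : ∀ i j, |X i j| ≤ 2 ^ T) (hZ : ∀ j, |Z j| ≤ 2 ^ T)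
    (hR : 0 < R) (hRT : |R| ≤ 2 ^ T) (hW : 0 ≤ W) (hWT : |W| ≤ 2 ^ T) :
    ∃ (fuel : ℕ) (m rp rn : ℤ) (v : Fin (n + p + n) → ℤ),
      0 ≤ rp ∧ (p : ℤ) ≤ rp ^ 2 ∧ 0 ≤ rn ∧ (n : ℤ) ≤ rn ^ 2 ∧
      m = 2 ^ (n + (p + 1) / 2 + 3) * p * (R * rp + W * rn) ∧ v ≠ 0 ∧
      v ∈ Submodule.span ℤ (Set.range (latticeBasis m (fun i j => m * X i j)
        fun i => -m * awayFromZero (shiftedObs Y X Z i))) ∧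
      (∀ u ∈ Submodule.span ℤ (Set.range (latticeBasis m (fun i j => m * X i j)
        fun i => -m * awayFromZero (shiftedObs Y X Z i))), u ≠ 0 →
        v ⬝ᵥ v ≤ 2 ^ (p + n + n - 1) * (u ⬝ᵥ u)) ∧
      (elo fuel Y X R W Z).val = some (eloOutput (middle v) Z) ∧
      (∀ j, |eloOutput (middle v) Z j| ≤ 2 ^ (29 * T)) ∧
      (elo fuel Y X R W Z).cost ≤ T ^ 397 := by
  have hT256 : 256 * T ≤ T ^ 3 := by
    have h3 : T ^ 3 = T * T * T := by ring
    have h4 : 16 * 16 ≤ T * T := Nat.mul_le_mul hT hT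
    rw [h3]; exact Nat.mul_le_mul_right _ h4
  have e34 : 16 * T ^ 3 ≤ T ^ 4 := mul_pow_le hT
  have e12 : 16 * T ≤ T ^ 2 := by rw [sq]; exact Nat.mul_le_mul_right _ hT
  have e46 : T ^ 4 ≤ T ^ 6 := Nat.pow_le_pow_right (by omega) (by omega)
  have e611 : T ^ 6 ≤ T ^ 11 := Nat.pow_le_pow_right (by omega) (by omega)
  -- the size of the random numbers
  have hdraw : p * bitLen (2 * R + Nat.log 2 p) ≤ T ^ 4 := by
    have h1 : |2 * R + (Nat.log 2 p : ℤ)| ≤ 2 ^ (3 * T) := by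
      have h2 : |2 * R| ≤ 2 ^ (2 * T) :=
        abs_le_two_pow_mono (abs_mul_le_two_pow (a := 1) (by norm_num) hRT) (by omega)
      have h3 : |(Nat.log 2 p : ℤ)| ≤ 2 ^ (2 * T) := natCast_abs_le_two_pow
        ((Nat.log_le_self 2 p).trans (by omega))
      exact abs_le_two_pow_mono (abs_add_le_two_pow h2 h3) (by omega)
    have h2 := bitLen_le_cube hT (by norm_num) h1
    calc p * bitLen (2 * R + Nat.log 2 p) ≤ T * T ^ 3 := Nat.mul_le_mul hpT h2
      _ = T ^ 4 := by ring
  -- the shifted observations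
  have hY1 := fun i => shiftedObs_step_spec hT hpT (hY i) (hX i) hZ
  have hY1v : (buildVec fun i => loop (List.finRange p) (Y i) fun j s => do
      let t ← zMul (X i j) (Z j)
      zAdd s t).val = shiftedObs Y X Z := by
    funext i; exact (hY1 i).1
  have hY1c : _ ≤ T ^ 11 := (cost_buildVec_le _ fun i => (hY1 i).2.2).trans
    (mul_succ_pow_le hT hnT le_rfl)
  have hY1b : ∀ i, |shiftedObs Y X Z i| ≤ 2 ^ (4 * T) := fun i => (hY1 i).2.1
  set Y₁ := shiftedObs Y X Z with hY₁
  have hY2v : (buildVec fun i => do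
      let a ← zAbs (Y₁ i)
      let small ← zLt a 3
      if small then pure 3 else pure (Y₁ i)).val = fun i => awayFromZero (Y₁ i) := by
    funext i; exact val_awayFromZero (Y₁ i)
  have hY2c : _ ≤ T ^ 6 := (cost_buildVec_le _ fun i => cost_awayFromZero hT (hY1b i)).trans
    (mul_succ_pow_le hT hnT le_rfl)
  -- the multiplier `m`
  obtain ⟨hev, hec⟩ := twoPow_spec (n + (p + 1) / 2 + 3)
  obtain ⟨rp0, rp1, rp2, rp3⟩ := ceilSqrt_spec hT hpT
  obtain ⟨rn0, rn1, rn2, rn3⟩ := ceilSqrt_spec hT hnT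
  set rp := (ceilSqrt p).val with hrp
  set rn := (ceilSqrt n).val with hrn
  have hexp : n + (p + 1) / 2 + 3 ≤ 3 * T := by omega
  have hec' : (twoPow (n + (p + 1) / 2 + 3)).cost ≤ T ^ 4 := by
    refine hec.trans ?_
    calc _ ≤ T ^ 2 * T ^ 2 := Nat.mul_le_mul (by omega) (by omega)
      _ = T ^ 4 := by ring
  have he : |(2 : ℤ) ^ (n + (p + 1) / 2 + 3)| ≤ 2 ^ (3 * T) := by
    rw [abs_of_pos (by positivity)]; exact two_pow_mono hexp
  set e : ℤ := 2 ^ (n + (p + 1) / 2 + 3) with he_def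
  have hpZ : |(p : ℤ)| ≤ 2 ^ T := natCast_abs_le_two_pow hpT
  have hnZ : |(n : ℤ)| ≤ 2 ^ T := natCast_abs_le_two_pow hnT
  have hrpZ : |rp| ≤ 2 ^ T := by
    rw [abs_of_nonneg rp0]; exact rp1.trans ((le_abs_self _).trans hpZ)
  have hrnZ : |rn| ≤ 2 ^ T := by
    rw [abs_of_nonneg rn0]; exact rn1.trans ((le_abs_self _).trans hnZ)
  have hu : |R * rp| ≤ 2 ^ (2 * T) := by rw [two_mul]; exact abs_mul_le_two_pow hRT hrpZ
  have hv : |W * rn| ≤ 2 ^ (2 * T) := by rw [two_mul]; exact abs_mul_le_two_pow hWT hrnZ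
  have hw : |R * rp + W * rn| ≤ 2 ^ (3 * T) :=
    abs_le_two_pow_mono (abs_add_le_two_pow hu hv) (by omega)
  have hep : |e * p| ≤ 2 ^ (4 * T) :=
    abs_le_two_pow_mono (abs_mul_le_two_pow he hpZ) (by omega)
  have hm : |e * p * (R * rp + W * rn)| ≤ 2 ^ (7 * T) :=
    abs_le_two_pow_mono (abs_mul_le_two_pow hep hw) (by omega)
  have hmpos : 0 < e * p * (R * rp + W * rn) := by
    have h1 : 0 < rp := by
      rcases lt_or_eq_of_le rp0 with h | h
      · exact h
      · rw [← h] at rp2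
        have : (0 : ℤ) < p := by exact_mod_cast hp
        norm_num at rp2
        omega
    have h2 : 0 < R * rp := mul_pos hR h1
    have h3 : 0 ≤ W * rn := mul_nonneg hW rn0
    have h4 : (0 : ℤ) < p := by exact_mod_cast hp
    have h5 : 0 < e := by rw [he_def]; positivity
    exact mul_pos (mul_pos h5 h4) (by linarith)
  set m := e * p * (R * rp + W * rn) with hm_def
  have hmX : ∀ i j, |m * X i j| ≤ 2 ^ (8 * T) := fun i j =>
    abs_le_two_pow_mono (abs_mul_le_two_pow hm (hX i j)) (by omega)
  have hY2b := fun i => abs_awayFromZero_le hT (hY1b i)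
  have hmn : |-m| ≤ 2 ^ (7 * T) := by rwa [abs_neg]
  have hmY : ∀ i, |-m * awayFromZero (Y₁ i)| ≤ 2 ^ (11 * T) := fun i =>
    abs_le_two_pow_mono (abs_mul_le_two_pow hmn (hY2b i)) (by omega)
  have bR := bitLen_le_cube (c := 1) hT (by norm_num) (by simpa using hRT)
  have bW := bitLen_le_cube (c := 1) hT (by norm_num) (by simpa using hWT)
  have brp := bitLen_le_cube (c := 1) hT (by norm_num) (by simpa using hrpZ)
  have brn := bitLen_le_cube (c := 1) hT (by norm_num) (by simpa using hrnZ)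
  have bp := bitLen_le_cube (c := 1) (z := (p : ℤ)) hT (by norm_num) (by simpa using hpZ)
  have be := bitLen_le_cube hT (by norm_num) he
  have bu := bitLen_le_cube hT (by norm_num) hu
  have bv := bitLen_le_cube hT (by norm_num) hv
  have bw := bitLen_le_cube hT (by norm_num) hw
  have bep := bitLen_le_cube hT (by norm_num) hep
  have bm := bitLen_le_cube hT (by norm_num) hm
  have bmn := bitLen_le_cube hT (by norm_num) hmn
  have cu : _ ≤ T ^ 6 := mul_le_pow_of_le bR brp
  have cv : _ ≤ T ^ 6 := mul_le_pow_of_le bW brn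
  have cep : _ ≤ T ^ 6 := mul_le_pow_of_le be bp
  have cm : _ ≤ T ^ 6 := mul_le_pow_of_le bep bw
  -- the matrix
  have cmX : (buildVec fun i => buildVec fun j => zMul m (X i j)).cost ≤ T ^ 11 := by
    have h1 : ∀ i, (buildVec fun j => zMul m (X i j)).cost ≤ T ^ 8 := fun i =>
      (cost_buildVec_le _ (C := T ^ 6) fun j => mul_le_pow_of_le bm
        (bitLen_le_cube (c := 1) hT (by norm_num) (by simpa using hX i j))).trans
        (mul_succ_pow_le hT hpT le_rfl)
    exact ((cost_buildVec_le _ h1).trans (mul_succ_pow_le hT hnT le_rfl)).trans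
      (Nat.pow_le_pow_right (by omega) (by omega))
  have cmY : (buildVec fun i => zMul (-m) (awayFromZero (Y₁ i))).cost ≤ T ^ 11 :=
    ((cost_buildVec_le _ (C := T ^ 6) fun i => mul_le_pow_of_le bmn
      (bitLen_le_cube hT (by norm_num) (hY2b i))).trans
      (mul_succ_pow_le hT hnT le_rfl)).trans (Nat.pow_le_pow_right (by omega) (by omega))
  have ctick : (n + p + n) * (n + p + n) ≤ T ^ 4 := by
    calc (n + p + n) * (n + p + n) ≤ T ^ 2 * T ^ 2 := Nat.mul_le_mul (by omega) (by omega)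
      _ = T ^ 4 := by ring
  have hmXv : (buildVec fun i => buildVec fun j => zMul m (X i j)).val = fun i j => m * X i j := rfl
  have hmYv : (buildVec fun i => zMul (-m) (awayFromZero (Y₁ i))).val
      = fun i => -m * awayFromZero (Y₁ i) := rfl
  -- lattice reduction
  set L := latticeBasis m (fun i j => m * X i j) fun i => -m * awayFromZero (Y₁ i) with hL
  have hLb : ∀ r t, |L r t| ≤ 2 ^ (11 * T) :=
    abs_latticeBasis_le (abs_le_two_pow_mono hm (by omega))
      (fun i j => abs_le_two_pow_mono (hmX i j) (by omega)) hmY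
  have hLn : ∀ r, L r ⬝ᵥ L r ≤ 2 ^ (25 * T) := fun r =>
    (dot_self_le_of_abs_le (hLb r)).trans (two_pow_mono (by omega))
  have hLi : LinearIndependent ℚ (ratBasis L) := linearIndependent_latticeBasis _ fun i =>
    mul_ne_zero (neg_ne_zero.2 hmpos.ne') (awayFromZero_ne_zero _)
  obtain ⟨fuel, o, ho, hoc, hv0, hvmem, hvb, hvs⟩ :=
    exists_lll_eq (U := T ^ 3) (by omega) hLi hLn (by omega)
  set v := o ⟨0, by omega⟩ with hv_def
  have hxb : ∀ j, |middle v j| ≤ 2 ^ (28 * T) := fun j =>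
    abs_le_two_pow_mono (abs_le_of_dot_self_le hvb _) (by omega)
  obtain ⟨out1, out2, out3⟩ := eloOutput_spec hT hp hpT hxb hZ
  have hrun : (elo fuel Y X R W Z).val = some (eloOutput (middle v) Z) := by
    simp only [elo, val_bind, hY1v, hY2v, hev, ← hrp, ← hrn, val_zMul, val_zAdd, ← hm_def, hmXv,
      hmYv, ← hL, ho]
    exact out1
  refine ⟨fuel, m, rp, rn, v, rp0, rp2, rn0, rn2, rfl, hv0, hvmem, hvs, hrun, out2, ?_⟩
  rw [← pow_mul, show 3 * 132 = 396 from rfl] at hoc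
  have f1 : 16 * T ^ 11 ≤ T ^ 12 := mul_pow_le hT
  have f2 : 16 * T ^ 12 ≤ T ^ 13 := mul_pow_le hT
  have f3 : T ^ 13 ≤ T ^ 396 := Nat.pow_le_pow_right (by omega) (by omega)
  have f4 : 16 * T ^ 396 ≤ T ^ 397 := mul_pow_le hT
  have hcost : (elo fuel Y X R W Z).cost
      ≤ T ^ 4 + (T ^ 11 + (T ^ 6 + (T ^ 4 + (T ^ 6 + (T ^ 6 + (T ^ 6 + (T ^ 6 + (2 * T ^ 6 +
        (T ^ 6 + (T ^ 6 + (T ^ 11 + (T ^ 11 + (T ^ 4 + (T ^ 396 + T ^ 12)))))))))))))) := by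
    simp only [elo, cost_bind, hY1v, hY2v, hev, ← hrp, ← hrn, val_zMul, val_zAdd, ← hm_def, hmXv,
      hmYv, ← hL, ho, cost_tick]
    refine Nat.add_le_add hdraw (Nat.add_le_add ?_ (Nat.add_le_add ?_ (Nat.add_le_add hec'
      (Nat.add_le_add rp3 (Nat.add_le_add rn3 (Nat.add_le_add cu (Nat.add_le_add cv
      (Nat.add_le_add ?_ (Nat.add_le_add cep (Nat.add_le_add cm (Nat.add_le_add ?_
      (Nat.add_le_add ?_ (Nat.add_le_add ctick (Nat.add_le_add hoc ?_))))))))))))))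
    · exact hY1c
    · exact hY2c
    · change bitLen (R * rp) + bitLen (W * rn) ≤ _
      omega
    · exact cmX
    · exact cmY
    · exact out3
  omega

end ELO


/-! ### Cost and result of the LBR algorithm -/

section LBR

open Matrix

theorem abs_truncInt_le (N : ℕ) (x : ℝ) : |(truncInt N x : ℝ)| ≤ 2 ^ N * |x| := by
  have h0 : (0 : ℝ) ≤ 2 ^ N * |x| := by positivity
  have h1 : |((SignType.sign x : ℤ) : ℝ)| ≤ 1 := by
    rcases lt_trichotomy x 0 with h | h | h <;> simp [h]
  have h2 : |((⌊2 ^ N * |x|⌋ : ℤ) : ℝ)| ≤ 2 ^ N * |x| := by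
    rw [abs_of_nonneg (by exact_mod_cast Int.floor_nonneg.2 h0)]
    exact Int.floor_le _
  unfold truncInt
  rw [Int.cast_mul, abs_mul]
  calc _ ≤ 1 * (2 ^ N * |x|) := mul_le_mul h1 h2 (abs_nonneg _) zero_le_one
    _ = _ := one_mul _

theorem abs_truncInt_le_two_pow {N T : ℕ} (hN : N ≤ T) {x : ℝ} (hx : |x| ≤ 2 ^ T) :
    |truncInt N x| ≤ 2 ^ (2 * T) := by
  have h1 := abs_truncInt_le N x
  have h2 : (2 : ℝ) ^ N * |x| ≤ 2 ^ T * 2 ^ T :=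
    mul_le_mul (pow_le_pow_right₀ (by norm_num) hN) hx (abs_nonneg _) (by positivity)
  rw [← pow_add, ← two_mul] at h2
  exact_mod_cast h1.trans h2

variable {n p : ℕ}

/-- The first argument with which LBR calls ELO. -/
noncomputable def lbrObs (N Q : ℕ) (Y : Fin n → ℝ) (i : Fin n) : ℤ := Q * truncInt N (Y i)

/-- The second argument with which LBR calls ELO. -/
noncomputable def lbrDesign (N : ℕ) (X : Fin n → Fin p → ℝ) (i : Fin n) (j : Fin p) : ℤ :=
  truncInt N (X i j)

/-- The last argument with which LBR calls ELO. -/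
noncomputable def lbrNoise (p N Q R : ℕ) (W : ℝ) : ℤ := 2 * Q * (⌈2 ^ N * W⌉ + R * p)

/-- The vectors of the lattice that LBR reduces. -/
noncomputable def lbrLattice (N Q : ℕ) (Y : Fin n → ℝ) (X : Fin n → Fin p → ℝ) (Z : Fin p → ℤ)
    (m : ℤ) : Submodule ℤ (Fin (n + p + n) → ℤ) :=
  Submodule.span ℤ (Set.range (latticeBasis m (fun i j => m * lbrDesign N X i j)
    fun i => -m * awayFromZero (shiftedObs (lbrObs N Q Y) (lbrDesign N X) Z i)))

set_option exponentiation.threshold 1000 in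
set_option maxHeartbeats 1000000 in
/-- LBR runs in polynomial time, and computes its output from a lattice vector that is shortest up
to an exponential factor. -/
theorem exists_lbr_eq {T : ℕ} (hT : 16 ≤ T) {N Q R : ℕ} {W : ℝ} {Y : Fin n → ℝ}
    {X : Fin n → Fin p → ℝ} {Z : Fin p → ℤ} (hn : 0 < n) (hp : 0 < p) (hQ : 0 < Q) (hR : 0 < R)
    (hW : 0 < W) (hnT : n ≤ T) (hpT : p ≤ T) (hNT : N ≤ T) (hQT : Q ≤ 2 ^ T) (hRT : R ≤ 2 ^ T)
    (hWT : W ≤ 2 ^ T) (hY : ∀ i, |Y i| ≤ 2 ^ T) (hX : ∀ i j, |X i j| ≤ 2 ^ T)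
    (hZ : ∀ j, Z j ∈ Set.Icc ((Q * R : ℤ) + 1) (2 * (Q * R : ℤ) + Nat.log 2 p)) :
    ∃ (m rp rn : ℤ) (v : Fin (n + p + n) → ℤ) (t : ℕ),
      0 ≤ rp ∧ (p : ℤ) ≤ rp ^ 2 ∧ 0 ≤ rn ∧ (n : ℤ) ≤ rn ^ 2 ∧
      m = 2 ^ (n + (p + 1) / 2 + 3) * p * (Q * R * rp + lbrNoise p N Q R W * rn) ∧
      v ≠ 0 ∧ v ∈ lbrLattice N Q Y X Z m ∧
      (∀ u ∈ lbrLattice N Q Y X Z m, u ≠ 0 → v ⬝ᵥ v ≤ 2 ^ (p + n + n - 1) * (u ⬝ᵥ u)) ∧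
      LBRReturns Y X N Q R W Z (fun j => (eloOutput (middle v) Z j : ℚ) / Q) t ∧
      t ≤ T ^ 800 := by
  have hQ2 : |(Q : ℤ)| ≤ 2 ^ T := by rw [Nat.abs_cast]; exact_mod_cast hQT
  have hR2 : |(R : ℤ)| ≤ 2 ^ T := by rw [Nat.abs_cast]; exact_mod_cast hRT
  have hp2 : |(p : ℤ)| ≤ 2 ^ T := natCast_abs_le_two_pow hpT
  have hYt := fun i => abs_truncInt_le_two_pow hNT (hY i)
  have hXt := fun i j => abs_truncInt_le_two_pow hNT (hX i j)
  have hY' : ∀ i, |lbrObs N Q Y i| ≤ 2 ^ (4 * T) := fun i =>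
    abs_le_two_pow_mono (abs_mul_le_two_pow hQ2 (hYt i)) (by omega)
  have hX' : ∀ i j, |lbrDesign N X i j| ≤ 2 ^ (4 * T) := fun i j =>
    abs_le_two_pow_mono (hXt i j) (by omega)
  have hQR : |(Q * R : ℤ)| ≤ 2 ^ (2 * T) := by
    rw [two_mul]; exact abs_mul_le_two_pow hQ2 hR2
  have hQRpos : (0 : ℤ) < Q * R := by positivity
  have hZ' : ∀ j, |Z j| ≤ 2 ^ (4 * T) := fun j => by
    have h1 := (hZ j).1
    have h2 := (hZ j).2
    have h3 : |(Nat.log 2 p : ℤ)| ≤ 2 ^ (2 * T) := natCast_abs_le_two_pow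
        ((Nat.log_le_self 2 p).trans (by omega))
    rw [Nat.abs_cast] at h3
    rw [abs_of_pos hQRpos] at hQR
    rw [abs_of_pos (by omega)]
    have h4 : (2 : ℤ) ^ (2 * T + 2) ≤ 2 ^ (4 * T) := two_pow_mono (by omega)
    rw [pow_add] at h4
    have h5 : (0 : ℤ) < 2 ^ (2 * T) := by positivity
    omega
  have hceil0 : 0 ≤ ⌈2 ^ N * W⌉ := Int.ceil_nonneg (by positivity)
  have hceil : |⌈2 ^ N * W⌉| ≤ 2 ^ (2 * T) := by
    rw [abs_of_nonneg hceil0, Int.ceil_le]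
    have h2 : (2 : ℝ) ^ N * W ≤ 2 ^ T * 2 ^ T :=
      mul_le_mul (pow_le_pow_right₀ (by norm_num) hNT) hWT hW.le (by positivity)
    rw [← pow_add, ← two_mul] at h2
    exact_mod_cast h2
  have hRp : |(R * p : ℤ)| ≤ 2 ^ (2 * T) := by
    rw [two_mul]; exact abs_mul_le_two_pow hR2 hp2
  have hv : |⌈2 ^ N * W⌉ + (R * p : ℤ)| ≤ 2 ^ (2 * T + 1) := abs_add_le_two_pow hceil hRp
  have h2Q : |(2 * Q : ℤ)| ≤ 2 ^ (1 + T) := abs_mul_le_two_pow (by norm_num) hQ2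
  have hW' : |lbrNoise p N Q R W| ≤ 2 ^ (4 * T) :=
    abs_le_two_pow_mono (abs_mul_le_two_pow h2Q hv) (by omega)
  have hW0 : 0 ≤ lbrNoise p N Q R W := by unfold lbrNoise; positivity
  have hT4 : 16 ≤ 4 * T := by omega
  obtain ⟨fuel, m, rp, rn, v, rp0, rp2, rn0, rn2, hm, hv0, hvmem, hvs, hrun, hout, hcost⟩ :=
    exists_elo_eq hT4 hp hn (by omega) (by omega) hY' hX' hZ' hQRpos
      (abs_le_two_pow_mono hQR (by omega)) hW0 hW'
  have hYv : (buildVec fun i => do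
      let y ← readReal N (Y i)
      zMul Q y).val = lbrObs N Q Y := rfl
  have hXv : (buildVec fun i => buildVec fun j => readReal N (X i j)).val = lbrDesign N X := rfl
  have hcv : (readRealUp N W).val = ⌈2 ^ N * W⌉ := rfl
  have hWv : 2 * (Q : ℤ) * (⌈2 ^ N * W⌉ + R * p) = lbrNoise p N Q R W := rfl
  set out := eloOutput (middle v) Z with hout_def
  refine ⟨m, rp, rn, v, (lbr fuel Y X N Q R W Z).cost, rp0, rp2, rn0, rn2, hm, hv0, hvmem, hvs,
    ⟨fuel, ?_⟩, ?_⟩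
  · have : (lbr fuel Y X N Q R W Z).val = some fun j => (out j : ℚ) / Q := by
      simp only [lbr, val_bind, hYv, hXv, hcv, val_zMul, val_zAdd, hWv, hrun]
      rfl
    conv_lhs => rw [Timed.eq_mk (lbr fuel Y X N Q R W Z), this]
  · have e34 : 16 * T ^ 3 ≤ T ^ 4 := mul_pow_le hT
    have e46 : T ^ 4 ≤ T ^ 6 := Nat.pow_le_pow_right (by omega) (by omega)
    have e67 : 16 * T ^ 6 ≤ T ^ 7 := mul_pow_le hT
    have hTc : T ≤ T ^ 3 := Nat.le_self_pow (by omega) T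
    have bQ := bitLen_le_cube (c := 1) (z := (Q : ℤ)) hT (by norm_num) (by simpa using hQ2)
    have bR := bitLen_le_cube (c := 1) (z := (R : ℤ)) hT (by norm_num) (by simpa using hR2)
    have bp := bitLen_le_cube (c := 1) (z := (p : ℤ)) hT (by norm_num) (by simpa using hp2)
    have b2 : bitLen 2 ≤ T ^ 3 := bitLen_le_cube (c := 1) hT (by norm_num) (by
      have := two_pow_mono (show 1 ≤ 1 * T by omega)
      simpa using this)
    have bY := fun i => bitLen_le_cube hT (by norm_num) (hYt i)
    have bX := fun i j => bitLen_le_cube hT (by norm_num) (hXt i j)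
    have bc := bitLen_le_cube hT (by norm_num) hceil
    have bRp := bitLen_le_cube hT (by norm_num) hRp
    have bv := bitLen_le_cube (c := 3) hT (by norm_num) (abs_le_two_pow_mono hv (by omega))
    have b2Q := bitLen_le_cube (c := 2) hT (by norm_num) (abs_le_two_pow_mono h2Q (by omega))
    have cQR : _ ≤ T ^ 6 := mul_le_pow_of_le bQ bR
    have cRp : _ ≤ T ^ 6 := mul_le_pow_of_le bR bp
    have c2Q : _ ≤ T ^ 6 := mul_le_pow_of_le b2 bQ
    have cW : _ ≤ T ^ 6 := mul_le_pow_of_le b2Q bv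
    have cY : (buildVec fun i => do
        let y ← readReal N (Y i)
        zMul Q y).cost ≤ T ^ 9 := by
      refine (cost_buildVec_le _ (C := T ^ 7) fun i => ?_).trans (mul_succ_pow_le hT hnT le_rfl)
      have h1 : _ ≤ T ^ 6 := mul_le_pow_of_le bQ (bY i)
      have h2 := bY i
      simp only [cost_bind, readReal, zMul]
      omega
    have cX : (buildVec fun i => buildVec fun j => readReal N (X i j)).cost ≤ T ^ 9 := by
      refine (cost_buildVec_le _ (C := T ^ 6) fun i => ?_).trans
        ((mul_succ_pow_le hT hnT le_rfl).trans
        (Nat.pow_le_pow_right (by omega) (by omega)))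
      refine (cost_buildVec_le _ (C := T ^ 4) fun j => ?_).trans (mul_succ_pow_le hT hpT le_rfl)
      have h2 := bX i j
      simp only [readReal]
      omega
    have cD : (buildVec fun j => qDiv (out j) Q).cost ≤ T ^ 11 := by
      refine (cost_buildVec_le _ (C := T ^ 9) fun j => ?_).trans (mul_succ_pow_le hT hpT le_rfl)
      have h1 : HeightLE (29 * (4 * T)) (out j : ℚ) := heightLE_intCast.2 (hout j)
      have h2 : HeightLE T ((Q : ℤ) : ℚ) := heightLE_intCast.2 hQ2
      rw [Int.cast_natCast] at h2
      have h3 := ratLen_le h1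
      have h4 := ratLen_le h2
      have h5 : 256 * T ≤ T ^ 3 := by
        have h3 : T ^ 3 = T * T * T := by ring
        have h4 : 16 * 16 ≤ T * T := Nat.mul_le_mul hT hT
        rw [h3]; exact Nat.mul_le_mul_right _ h4
      calc (qDiv (out j) Q).cost = (ratLen (out j : ℚ) + ratLen (Q : ℚ)) ^ 3 := rfl
        _ ≤ (T ^ 3) ^ 3 := Nat.pow_le_pow_left (by omega) 3
        _ = T ^ 9 := by ring
    have celo : (elo fuel (lbrObs N Q Y) (lbrDesign N X) (Q * R) (lbrNoise p N Q R W) Z).cost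
        ≤ T ^ 794 := by
      refine hcost.trans ?_
      calc (4 * T) ^ 397 ≤ (T ^ 2) ^ 397 :=
            Nat.pow_le_pow_left (by rw [sq]; exact Nat.mul_le_mul_right _ (by omega)) _
        _ = T ^ 794 := by rw [← pow_mul]
    have hc : (lbr fuel Y X N Q R W Z).cost ≤ T ^ 9 + (T ^ 9 + (T ^ 6 + (2 * T ^ 3 + (T ^ 6 +
        (2 * T ^ 3 + (T ^ 6 + (T ^ 6 + (T ^ 794 + T ^ 11)))))))) := by
      simp only [lbr, cost_bind, hYv, hXv, hcv, val_zMul, val_zAdd, hWv, hrun, cost_pure, add_zero]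
      refine Nat.add_le_add cY (Nat.add_le_add cX (Nat.add_le_add cQR (Nat.add_le_add ?_
        (Nat.add_le_add cRp (Nat.add_le_add ?_ (Nat.add_le_add c2Q (Nat.add_le_add cW
        (Nat.add_le_add celo cD))))))))
      · change N + bitLen ⌈2 ^ N * W⌉ ≤ _
        omega
      · change bitLen ⌈2 ^ N * W⌉ + bitLen (R * p) ≤ _
        omega
    have f1 : T ^ 11 ≤ T ^ 794 := Nat.pow_le_pow_right (by omega) (by omega)
    have f2 : T ^ 9 ≤ T ^ 794 := Nat.pow_le_pow_right (by omega) (by omega)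
    have f3 : T ^ 6 ≤ T ^ 794 := Nat.pow_le_pow_right (by omega) (by omega)
    have f5 : 16 * T ^ 794 ≤ T ^ 795 := mul_pow_le hT
    have f6 : T ^ 795 ≤ T ^ 800 := Nat.pow_le_pow_right (by omega) (by omega)
    omega

theorem natCast_le_two_pow_of_logb_le {Q T : ℕ} (hQ : 0 < Q) (h : Real.logb 2 Q ≤ T) :
    Q ≤ 2 ^ T := by
  have h1 : (Q : ℝ) ≤ 2 ^ (T : ℝ) :=
    (Real.logb_le_iff_le_rpow (by norm_num) (by exact_mod_cast hQ)).1 h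
  rw [Real.rpow_natCast] at h1
  exact_mod_cast h1

theorem le_two_pow_of_logb_le {x : ℝ} {T : ℕ} (hx : 0 < x) (h : Real.logb 2 x ≤ T) :
    x ≤ 2 ^ T := by
  have h1 : x ≤ 2 ^ (T : ℝ) := (Real.logb_le_iff_le_rpow (by norm_num) hx).1 h
  rwa [Real.rpow_natCast] at h1

theorem logb_natCast_nonneg (Q : ℕ) : 0 ≤ Real.logb 2 Q := by
  rcases Nat.eq_zero_or_pos Q with h | h
  · simp [h]
  · exact Real.logb_nonneg (by norm_num) (by exact_mod_cast h)

/-- LBR runs in polynomial time, in terms of the size parameter. -/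
theorem exists_lbr_eq_sizeParam : ∃ A D : ℕ, ∀ (n p N Q R : ℕ) (W B : ℝ) (Y : Fin n → ℝ)
    (X : Fin n → Fin p → ℝ) (Z : Fin p → ℤ),
    0 < n → 0 < p → 0 < N → 0 < Q → 0 < R → 0 < W → (∀ i, |Y i| ≤ B) → (∀ i j, |X i j| ≤ B) →
    (∀ j, Z j ∈ Set.Icc ((Q * R : ℤ) + 1) (2 * (Q * R : ℤ) + Nat.log 2 p)) →
    ∃ (m rp rn : ℤ) (v : Fin (n + p + n) → ℤ) (t : ℕ),
      0 ≤ rp ∧ (p : ℤ) ≤ rp ^ 2 ∧ 0 ≤ rn ∧ (n : ℤ) ≤ rn ^ 2 ∧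
      m = 2 ^ (n + (p + 1) / 2 + 3) * p * (Q * R * rp + lbrNoise p N Q R W * rn) ∧
      v ≠ 0 ∧ v ∈ lbrLattice N Q Y X Z m ∧
      (∀ u ∈ lbrLattice N Q Y X Z m, u ≠ 0 → v ⬝ᵥ v ≤ 2 ^ (p + n + n - 1) * (u ⬝ᵥ u)) ∧
      LBRReturns Y X N Q R W Z (fun j => (eloOutput (middle v) Z j : ℚ) / Q) t ∧
      (t : ℝ) ≤ A * (sizeParam n p N Q R W + Real.logb 2 (2 + B)) ^ D := by
  -- the parameter `T = 16 ⌈S⌉` of `exists_lbr_eq` is at most `32 S`, where `S` is the size parameter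
  refine ⟨32 ^ 800, 800, ?_⟩
  intro n p N Q R W B Y X Z hn hp hN hQ hR hW hY hX hZ
  have hB : 0 ≤ B := (abs_nonneg _).trans (hY ⟨0, hn⟩)
  set S := sizeParam n p N Q R W + Real.logb 2 (2 + B) with hS
  have h1 : (1 : ℝ) ≤ n := by exact_mod_cast hn
  have h2 : (1 : ℝ) ≤ p := by exact_mod_cast hp
  have h3 : (1 : ℝ) ≤ N := by exact_mod_cast hN
  have h4 := logb_natCast_nonneg Q
  have h5 := logb_natCast_nonneg R
  have h6 : 0 ≤ max 0 (Real.logb 2 W) := le_max_left _ _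
  have h6' : Real.logb 2 W ≤ max 0 (Real.logb 2 W) := le_max_right _ _
  have h7 : 0 ≤ Real.logb 2 (2 + B) := Real.logb_nonneg (by norm_num) (by linarith)
  have hSdef : S = n + p + N + Real.logb 2 Q + Real.logb 2 R + max 0 (Real.logb 2 W)
      + Real.logb 2 (2 + B) := rfl
  have hS1 : 1 ≤ S := by linarith
  have hceil := Nat.le_ceil S
  have hceil' := Nat.ceil_lt_add_one (show 0 ≤ S by linarith)
  set T := 16 * ⌈S⌉₊ with hT_def
  have hTS : S ≤ T := by
    rw [hT_def]; push_cast; linarith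
  have hTS' : (T : ℝ) ≤ 32 * S := by
    rw [hT_def]; push_cast; linarith
  have hT : 16 ≤ T := by
    have : 0 < ⌈S⌉₊ := Nat.ceil_pos.2 (by linarith)
    omega
  have hBT : B ≤ 2 ^ T := by
    have := le_two_pow_of_logb_le (x := 2 + B) (T := T) (by linarith) (by linarith)
    linarith
  obtain ⟨m, rp, rn, v, t, e1, e2, e3, e4, e5, e6, e7, e8, e9, e10⟩ :=
    exists_lbr_eq hT (N := N) (Q := Q) (R := R) (W := W) (Y := Y) (X := X) (Z := Z) hn hp hQ hR hW
    (by exact_mod_cast (show (n : ℝ) ≤ T by linarith))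
    (by exact_mod_cast (show (p : ℝ) ≤ T by linarith))
    (by exact_mod_cast (show (N : ℝ) ≤ T by linarith))
    (natCast_le_two_pow_of_logb_le hQ (by linarith))
    (natCast_le_two_pow_of_logb_le hR (by linarith))
    (le_two_pow_of_logb_le hW (by linarith))
    (fun i => (hY i).trans hBT) (fun i j => (hX i j).trans hBT) hZ
  refine ⟨m, rp, rn, v, t, e1, e2, e3, e4, e5, e6, e7, e8, e9, ?_⟩
  have hpow : ∀ D : ℕ, t ≤ T ^ D → (t : ℝ) ≤ ((32 ^ D : ℕ) : ℝ) * S ^ D := by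
    intro D hD
    have h9 : (t : ℝ) ≤ (T : ℝ) ^ D := by exact_mod_cast hD
    refine h9.trans ?_
    rw [Nat.cast_pow, ← mul_pow]
    exact pow_le_pow_left₀ (Nat.cast_nonneg _) (by exact_mod_cast hTS') D
  exact hpow 800 e10

end LBR


/-! ### Recovery of the regression vector from a short lattice vector -/

section Recovery

open Matrix

variable {n p : ℕ}

theorem abs_sub_truncInt_le (N : ℕ) (x : ℝ) : |2 ^ N * x - truncInt N x| ≤ 1 := by
  have h1 := Int.floor_le (2 ^ N * |x|)
  have h2 := Int.lt_floor_add_one (2 ^ N * |x|)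
  unfold truncInt
  rcases lt_trichotomy x 0 with h | h | h
  · rw [abs_of_neg h] at h1 h2
    rw [abs_of_neg h, sign_neg h, abs_le, SignType.coe_neg_one]
    push_cast
    constructor <;> linarith
  · simp [h]
  · rw [abs_of_pos h] at h1 h2
    rw [abs_of_pos h, sign_pos h, abs_le, SignType.coe_one]
    push_cast
    constructor <;> linarith

theorem abs_sum_mul_le {a : Fin p → ℝ} {b : Fin p → ℝ} {A B : ℝ} (ha : ∀ j, |a j| ≤ A)
    (hb : ∀ j, |b j| ≤ B) (hA : 0 ≤ A) : |∑ j, a j * b j| ≤ p * (A * B) := by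
  refine (Finset.abs_sum_le_sum_abs _ _).trans ?_
  have : ∑ j, |a j * b j| ≤ ∑ _j : Fin p, A * B := Finset.sum_le_sum fun j _ => by
    rw [abs_mul]; exact mul_le_mul (ha j) (hb j) (abs_nonneg _) hA
  simpa using this

/-- The difference between the linear forms given by the truncated and the exact design. -/
theorem abs_sum_truncInt_sub_le (N : ℕ) (x y : Fin p → ℝ) {B : ℝ} (hy : ∀ j, |y j| ≤ B) :
    |2 ^ N * ∑ j, x j * y j - ∑ j, (truncInt N (x j) : ℝ) * y j| ≤ p * B := by
  have h1 : 2 ^ N * ∑ j, x j * y j - ∑ j, (truncInt N (x j) : ℝ) * y j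
      = ∑ j, (2 ^ N * x j - truncInt N (x j)) * y j := by
    rw [Finset.mul_sum, ← Finset.sum_sub_distrib]
    exact Finset.sum_congr rfl fun j _ => by ring
  rw [h1]
  have := abs_sum_mul_le (fun j => abs_sub_truncInt_le N (x j)) hy zero_le_one
  rwa [one_mul] at this

/-- The noise in the integer regression problem. -/
theorem abs_lbrObs_sub_le {N Q R : ℕ} {σ w y : ℝ} {x β : Fin p → ℝ} (hp : 0 < p) (hR : 0 < R)
    (hβ : ∀ j, |β j| ≤ R) (hw : |w| ≤ σ) (hy : y = ∑ j, x j * β j + w) :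
    |(Q : ℝ) * truncInt N y - ∑ j, (truncInt N (x j) : ℝ) * (Q * β j)|
      ≤ 2 * Q * (2 ^ N * σ + R * p) := by
  have h1 := abs_sub_truncInt_le N y
  have h2 := abs_sum_truncInt_sub_le N x β hβ
  have h3 : (Q : ℝ) * truncInt N y - ∑ j, (truncInt N (x j) : ℝ) * (Q * β j)
      = Q * (2 ^ N * w - (2 ^ N * y - truncInt N y) +
        (2 ^ N * ∑ j, x j * β j - ∑ j, (truncInt N (x j) : ℝ) * β j)) := by
    have h4 : ∑ j, (truncInt N (x j) : ℝ) * (Q * β j)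
        = Q * ∑ j, (truncInt N (x j) : ℝ) * β j := by
      rw [Finset.mul_sum]; exact Finset.sum_congr rfl fun j _ => by ring
    rw [h4, hy]; ring
  have h5 : (1 : ℝ) ≤ R * p := by exact_mod_cast Nat.mul_pos hR hp
  have h6 : |(2 : ℝ) ^ N * w| ≤ 2 ^ N * σ := by
    rw [abs_mul, abs_of_pos (by positivity)]
    exact mul_le_mul_of_nonneg_left hw (by positivity)
  have h0 : 0 ≤ (2 : ℝ) ^ N * σ := (abs_nonneg _).trans h6
  rw [h3, abs_mul, Nat.abs_cast, mul_comm 2, mul_assoc]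
  refine mul_le_mul_of_nonneg_left ?_ (Nat.cast_nonneg _)
  rw [abs_le] at h1 h2 h6 ⊢
  constructor <;> linarith

/-- If no integer vector of norm at most `M₀` that is not a multiple of the primitive vector `γ`
solves the regression equations `X' x = λ y - w` with integers `λ_i` and short `w`, then the short
lattice vector found by the algorithm reveals `γ`. -/
theorem eloOutput_eq_sub (hp : 0 < p) {X' : Fin n → Fin p → ℤ} {Y' : Fin n → ℤ} {Z γ : Fin p → ℤ}
    {η : Fin n → ℤ} {m : ℤ} {Γ W₀ M₀ : ℝ} {v : Fin (n + p + n) → ℤ}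
    (hobs : ∀ i, shiftedObs Y' X' Z i = ∑ j, X' i j * γ j + η i)
    (hγ : ∀ j, 0 < γ j) (hγΓ : ∀ j, (γ j : ℝ) ≤ Γ)
    (hgcd : (Finset.univ.gcd fun j => (γ j).natAbs) = 1) (hη : ∀ i, |(η i : ℝ)| ≤ W₀)
    (hm0 : 0 < m) (hM0 : 0 ≤ M₀)
    (hm : 2 ^ (p + n + n - 1) * (p * Γ ^ 2 + n * W₀ ^ 2) < (m : ℝ) ^ 2)
    (hM : 2 ^ (p + n + n - 1) * (p * Γ ^ 2 + n * W₀ ^ 2) ≤ M₀ ^ 2)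
    (hy3 : ∀ i, 3 ≤ |shiftedObs Y' X' Z i|) (hyM : ∀ i, M₀ < |(shiftedObs Y' X' Z i : ℝ)|)
    (hgood : ∀ x : Fin p → ℤ, (∀ j, |(x j : ℝ)| ≤ M₀) → (∀ a : ℤ, x ≠ a • γ) →
      ¬ ∀ i, ∃ lam w : ℤ, |(w : ℝ)| ≤ M₀ ∧
        ∑ j, X' i j * x j = lam * shiftedObs Y' X' Z i - w)
    (hv0 : v ≠ 0)
    (hv : v ∈ Submodule.span ℤ (Set.range (latticeBasis m (fun i j => m * X' i j)
      fun i => -m * awayFromZero (shiftedObs Y' X' Z i))))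
    (hshort : ∀ u ∈ Submodule.span ℤ (Set.range (latticeBasis m (fun i j => m * X' i j)
      fun i => -m * awayFromZero (shiftedObs Y' X' Z i))), u ≠ 0 →
        v ⬝ᵥ v ≤ 2 ^ (p + n + n - 1) * (u ⬝ᵥ u)) :
    eloOutput (middle v) Z = fun j => γ j - Z j := by
  set y := shiftedObs Y' X' Z with hy
  have haway : ∀ i, awayFromZero (y i) = y i := fun i => if_neg (not_lt.2 (hy3 i))
  simp only [haway] at hv hshort
  set L := latticeBasis m (fun i j => m * X' i j) fun i => -m * y i with hL
  -- the lattice vector given by `γ`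
  let zu : Fin (p + n + n) → ℤ := Fin.append (Fin.append γ fun _ => 1) η
  obtain ⟨u1, u2, u3⟩ := sum_latticeBasis m (fun i j => m * X' i j) (fun i => -m * y i) zu
  set u := ∑ r, zu r • latticeBasis m (fun i j => m * X' i j) (fun i => -m * y i) r with hu
  simp only [zu, Fin.append_left, Fin.append_right] at u1 u2 u3
  have humem : u ∈ Submodule.span ℤ (Set.range L) :=
    (Submodule.mem_span_range_iff_exists_fun ℤ).2 ⟨zu, rfl⟩
  have hu1 : ∀ i, u (Fin.castAdd n (Fin.castAdd p i)) = 0 := fun i => by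
    rw [u1, hobs i]
    have : ∑ j, m * X' i j * γ j = m * ∑ j, X' i j * γ j := by
      rw [Finset.mul_sum]; exact Finset.sum_congr rfl fun j _ => by ring
    rw [this]; ring
  have hu0 : u ≠ 0 := by
    intro h
    have h1 := u2 ⟨0, hp⟩
    rw [h] at h1
    exact (hγ ⟨0, hp⟩).ne h1
  have huu : ((u ⬝ᵥ u : ℤ) : ℝ) ≤ p * Γ ^ 2 + n * W₀ ^ 2 := by
    have h1 : u ⬝ᵥ u = ∑ j, γ j ^ 2 + ∑ i, η i ^ 2 := by
      rw [dotProduct, Fin.sum_univ_add, Fin.sum_univ_add]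
      simp only [hu1, u2, u3, mul_zero, Finset.sum_const_zero, zero_add, sq]
    rw [h1]
    push_cast
    have h2 : ∑ j, (γ j : ℝ) ^ 2 ≤ ∑ _j : Fin p, Γ ^ 2 := Finset.sum_le_sum fun j _ =>
      pow_le_pow_left₀ (by exact_mod_cast (hγ j).le) (hγΓ j) 2
    have h3 : ∑ i, (η i : ℝ) ^ 2 ≤ ∑ _i : Fin n, W₀ ^ 2 := Finset.sum_le_sum fun i _ => by
      rw [← sq_abs]; exact pow_le_pow_left₀ (abs_nonneg _) (hη i) 2
    simp only [Finset.sum_const, Finset.card_univ, Fintype.card_fin, nsmul_eq_mul] at h2 h3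
    linarith
  -- hence all coordinates of `v` are at most `M₀` and less than `m`
  have hvv : ((v ⬝ᵥ v : ℤ) : ℝ) ≤ 2 ^ (p + n + n - 1) * (p * Γ ^ 2 + n * W₀ ^ 2) := by
    have h1 : ((v ⬝ᵥ v : ℤ) : ℝ) ≤ 2 ^ (p + n + n - 1) * ((u ⬝ᵥ u : ℤ) : ℝ) := by
      exact_mod_cast hshort u humem hu0
    exact h1.trans (mul_le_mul_of_nonneg_left huu (by positivity))
  have hcoord : ∀ t, (v t : ℝ) ^ 2 ≤ ((v ⬝ᵥ v : ℤ) : ℝ) := by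
    intro t
    have h1 : v t * v t ≤ v ⬝ᵥ v :=
      Finset.single_le_sum (f := fun t => v t * v t) (fun _ _ => mul_self_nonneg _)
        (Finset.mem_univ t)
    rw [sq]; exact_mod_cast h1
  have hcM : ∀ t, |(v t : ℝ)| ≤ M₀ := fun t =>
    abs_le_of_sq_le_sq ((hcoord t).trans (hvv.trans hM)) hM0
  have hcm : ∀ t, |v t| < m := fun t => by
    have h1 : |(v t : ℝ)| < m :=
      abs_lt_of_sq_lt_sq ((hcoord t).trans_lt (hvv.trans_lt hm)) (by exact_mod_cast hm0.le)
    exact_mod_cast h1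
  -- the equations satisfied by the lattice vector found
  obtain ⟨z, rfl⟩ := (Submodule.mem_span_range_iff_exists_fun ℤ).1 hv
  obtain ⟨v1, v2, v3⟩ := sum_latticeBasis m (fun i j => m * X' i j) (fun i => -m * y i) z
  set v := ∑ r, z r • L r with hvdef
  set lam : Fin n → ℤ := fun i => z (Fin.castAdd n (Fin.natAdd p i)) with hlam
  set w : Fin n → ℤ := fun i => z (Fin.natAdd (p + n) i) with hw
  have heq : ∀ i, ∑ j, X' i j * middle v j = lam i * y i - w i := by
    intro i
    have h1 := v1 i
    have h2 := hcm (Fin.castAdd n (Fin.castAdd p i))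
    have h3 : ∑ j, m * X' i j * z (Fin.castAdd n (Fin.castAdd n j))
        = m * ∑ j, X' i j * middle v j := by
      rw [Finset.mul_sum]
      refine Finset.sum_congr rfl fun j _ => ?_
      rw [middle, v2 j, mul_assoc]
    have h4 : v (Fin.castAdd n (Fin.castAdd p i))
        = m * (∑ j, X' i j * middle v j - lam i * y i + w i) := by
      refine h1.trans ?_
      rw [h3]; ring
    -- a multiple of `m` that is less than `m` in absolute value vanishes
    have h5 := Int.eq_zero_of_abs_lt_dvd ⟨_, h4⟩ h2
    rw [h5] at h4
    have h6 := (mul_eq_zero.1 h4.symm).resolve_left hm0.ne'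
    linarith
  have hwM : ∀ i, |(w i : ℝ)| ≤ M₀ := fun i => by
    have := hcM (Fin.natAdd (n + p) i)
    rwa [v3 i] at this
  have hmul : ∃ a : ℤ, middle v = a • γ := by
    by_contra! hne
    exact hgood (middle v) (fun j => hcM _) hne fun i => ⟨lam i, w i, hwM i, heq i⟩
  obtain ⟨a, ha⟩ := hmul
  -- if the middle block were zero, then `λ = 0`, since the observations are larger than `w`, and so
  -- `v = 0`
  have ha0 : a ≠ 0 := by
    rintro rfl
    rw [zero_smul] at ha
    have hlam0 : ∀ i, lam i = 0 := fun i => by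
      by_contra hne
      have h1 := heq i
      simp only [ha, Pi.zero_apply, mul_zero, Finset.sum_const_zero] at h1
      have h2 : (w i : ℝ) = lam i * y i := by
        have : w i = lam i * y i := by linarith
        exact_mod_cast this
      have h3 := hwM i
      rw [h2, abs_mul] at h3
      have h4 : (1 : ℝ) ≤ |(lam i : ℝ)| := by exact_mod_cast Int.one_le_abs hne
      have h5 := hyM i
      nlinarith [abs_nonneg (y i : ℝ)]
    have hw0 : ∀ i, w i = 0 := fun i => by
      have h1 := heq i
      simp only [ha, Pi.zero_apply, mul_zero, Finset.sum_const_zero, hlam0 i, zero_mul] at h1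
      linarith
    apply hv0
    rw [hvdef]
    refine Finset.sum_eq_zero fun r _ => ?_
    have hz : z r = 0 := by
      refine Fin.addCases (motive := fun r => z r = 0) (Fin.addCases (fun j => ?_) hlam0) hw0 r
      rw [← v2 j]
      exact congrFun ha j
    rw [hz, zero_smul]
  have hg : (gcdVec (middle v)).val = a := by
    rw [ha]; exact val_gcdVec_mul hp (hγ _) hgcd a
  rw [eloOutput, hg, if_pos ha0, ha]
  funext j
  rw [Pi.smul_apply, smul_eq_mul, Int.mul_ediv_cancel_left _ ha0]

end Recovery


/-! ### The deterministic conditions for recovery -/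

section Conditions

open Matrix

variable {n p : ℕ}

/-- A bound for the noise in the integer regression problem that LBR passes to ELO. -/
noncomputable def noiseBound (p N Q R : ℕ) (σ : ℝ) : ℝ := 2 * Q * (2 ^ N * σ + R * p)

/-- A bound for the coordinates of the short lattice vector found by the LLL algorithm. -/
noncomputable def coordBound (n p N Q R : ℕ) (σ : ℝ) : ℝ :=
  2 ^ (n + (p + 1) / 2) * (p * (4 * Q * R * p) + n * noiseBound p N Q R σ)

/-- A bound for the coefficients of the columns of the lattice basis that carry the observations. -/
noncomputable def multBound (n p N Q R : ℕ) (σ : ℝ) : ℝ :=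
  4 * (n * p) ^ 4 * coordBound n p N Q R σ

/-- A bound for the linear forms in the rows of the design whose coefficients come from a short
lattice vector. -/
noncomputable def formBound (n p N Q R : ℕ) (σ : ℝ) : ℝ :=
  2 * multBound n p N Q R σ * coordBound n p N Q R σ / 2 ^ N

/-- There is a short integer vector `z`, not a multiple of `γ`, such that each row of `x` is almost
orthogonal to the sum of `z` and some multiple of `γ`. -/
def HasSpurious (γ : Fin p → ℤ) (M₀ Λ t : ℝ) (x : Fin n → Fin p → ℝ) : Prop :=
  ∃ z : Fin p → ℤ, (∀ j, |(z j : ℝ)| ≤ M₀) ∧ (∀ a : ℤ, z ≠ a • γ) ∧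
    ∀ i, ∃ lam : ℤ, |(lam : ℝ)| ≤ Λ ∧ |∑ j, x i j * ((z - lam • γ) j : ℤ)| ≤ t

theorem one_le_mul_self_of_pos {n p : ℕ} (hn : 0 < n) (hp : 0 < p) : (1 : ℝ) ≤ n * p := by
  exact_mod_cast Nat.mul_pos hn hp

theorem noiseBound_pos {p N Q R : ℕ} {σ : ℝ} (hp : 0 < p) (hQ : 0 < Q) (hR : 0 < R) (hσ : 0 ≤ σ) :
    2 ≤ noiseBound p N Q R σ := by
  have h1 : (1 : ℝ) ≤ Q := by exact_mod_cast hQ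
  have h2 : (1 : ℝ) ≤ R * p := by exact_mod_cast Nat.mul_pos hR hp
  have h3 : 0 ≤ (2 : ℝ) ^ N * σ := by positivity
  have h4 : (1 : ℝ) ≤ Q * (2 ^ N * σ + R * p) := by nlinarith
  unfold noiseBound
  linarith

theorem add_le_coordBound {n p N Q R : ℕ} {σ : ℝ} (hn : 0 < n) (hp : 0 < p) (hQ : 0 < Q)
    (hR : 0 < R) (hσ : 0 ≤ σ) :
    (p * (4 * Q * R * p) + noiseBound p N Q R σ : ℝ) ≤ coordBound n p N Q R σ := by
  have h0 := noiseBound_pos (N := N) hp hQ hR hσ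
  have h1 : (1 : ℝ) ≤ n := by exact_mod_cast hn
  have h2 : (1 : ℝ) ≤ 2 ^ (n + (p + 1) / 2) := one_le_pow₀ (by norm_num)
  have h3 : (0 : ℝ) ≤ p * (4 * Q * R * p) := by positivity
  have h4 : (p * (4 * Q * R * p) + noiseBound p N Q R σ : ℝ)
      ≤ p * (4 * Q * R * p) + n * noiseBound p N Q R σ := by nlinarith
  refine h4.trans ?_
  unfold coordBound
  exact le_mul_of_one_le_left (by positivity) h2

/-- The square of `coordBound` bounds the squared norm of the vector found by the LLL algorithm. -/
theorem le_coordBound_sq {n p N Q R : ℕ} {σ : ℝ} (hn : 0 < n) (hp : 0 < p) (hQ : 0 < Q)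
    (hR : 0 < R) (hσ : 0 ≤ σ) :
    2 ^ (p + n + n - 1) * (p * (4 * Q * R * p : ℝ) ^ 2 + n * noiseBound p N Q R σ ^ 2)
      ≤ coordBound n p N Q R σ ^ 2 := by
  have h0 := noiseBound_pos (N := N) hp hQ hR hσ
  have h1 : (1 : ℝ) ≤ n := by exact_mod_cast hn
  have h2 : (1 : ℝ) ≤ p := by exact_mod_cast hp
  unfold coordBound
  rw [mul_pow (2 ^ (n + (p + 1) / 2) : ℝ), ← pow_mul]
  refine mul_le_mul (pow_le_pow_right₀ (by norm_num) (by omega)) ?_ (by positivity) (by positivity)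
  set a : ℝ := 4 * Q * R * p
  set b := noiseBound p N Q R σ
  have ha : 0 ≤ a := by positivity
  have e1 : p * a ^ 2 ≤ (p * a) ^ 2 := by
    rw [mul_pow (p : ℝ) a]
    exact mul_le_mul_of_nonneg_right (by nlinarith) (sq_nonneg _)
  have e2 : n * b ^ 2 ≤ (n * b) ^ 2 := by
    rw [mul_pow (n : ℝ) b]
    exact mul_le_mul_of_nonneg_right (by nlinarith) (sq_nonneg _)
  have e3 : 0 ≤ (p * a) * (n * b) := by positivity
  nlinarith

/-- The multiplier `m` of the algorithm exceeds the norm of the vector found. -/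
theorem lt_multiplier_sq {n p N Q R : ℕ} {σ W : ℝ} (hn : 0 < n) (hp : 0 < p) (hQ : 0 < Q)
    (hR : 0 < R) (hσ : 0 ≤ σ) (hσW : σ ≤ W) {rp rn : ℤ} (hrp0 : 0 ≤ rp) (hrp : (p : ℤ) ≤ rp ^ 2)
    (hrn0 : 0 ≤ rn) (hrn : (n : ℤ) ≤ rn ^ 2) :
    2 ^ (p + n + n - 1) * (p * (4 * Q * R * p : ℝ) ^ 2 + n * noiseBound p N Q R σ ^ 2)
      < (((2 ^ (n + (p + 1) / 2 + 3) * p * (Q * R * rp + lbrNoise p N Q R W * rn) : ℤ)) : ℝ)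
        ^ 2 := by
  have h0 := noiseBound_pos (N := N) hp hQ hR hσ
  have h1 : (1 : ℝ) ≤ n := by exact_mod_cast hn
  have h2 : (1 : ℝ) ≤ p := by exact_mod_cast hp
  have h3 : (1 : ℝ) ≤ Q * R := by exact_mod_cast Nat.mul_pos hQ hR
  have hrp' : (p : ℝ) ≤ (rp : ℝ) ^ 2 := by exact_mod_cast hrp
  have hrn' : (n : ℝ) ≤ (rn : ℝ) ^ 2 := by exact_mod_cast hrn
  have hrp0' : (0 : ℝ) ≤ rp := by exact_mod_cast hrp0
  have hrn0' : (0 : ℝ) ≤ rn := by exact_mod_cast hrn0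
  have hnoise : noiseBound p N Q R σ ≤ (lbrNoise p N Q R W : ℝ) := by
    unfold noiseBound lbrNoise
    push_cast
    have h4 : (2 : ℝ) ^ N * σ ≤ ⌈2 ^ N * W⌉ :=
      (mul_le_mul_of_nonneg_left hσW (by positivity)).trans (Int.le_ceil _)
    exact mul_le_mul_of_nonneg_left (by linarith) (by positivity)
  push_cast
  set b := noiseBound p N Q R σ
  set c : ℝ := (lbrNoise p N Q R W : ℝ)
  set a : ℝ := Q * R with ha
  have e1 : a ^ 2 * p + b ^ 2 * n ≤ (a * rp + c * rn) ^ 2 := by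
    have e2 : a ^ 2 * p ≤ (a * rp) ^ 2 := by
      rw [mul_pow a]; exact mul_le_mul_of_nonneg_left hrp' (sq_nonneg _)
    have e3 : b ^ 2 * n ≤ (c * rn) ^ 2 := by
      rw [mul_pow c]
      exact mul_le_mul (pow_le_pow_left₀ (by linarith) hnoise 2) hrn' (by positivity) (sq_nonneg _)
    have e4 : 0 ≤ (a * rp) * (c * rn) :=
      mul_nonneg (mul_nonneg (by linarith) hrp0') (mul_nonneg (by linarith) hrn0')
    nlinarith
  have e5 : p * (4 * Q * R * p : ℝ) ^ 2 + n * b ^ 2 ≤ 16 * (p ^ 2 * (a ^ 2 * p + b ^ 2 * n)) := by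
    have e6 : p * (4 * Q * R * p : ℝ) ^ 2 = 16 * (p ^ 2 * (a ^ 2 * p)) := by rw [ha]; ring
    have e7 : n * b ^ 2 ≤ p ^ 2 * (b ^ 2 * n) := by
      rw [mul_comm (n : ℝ)]
      exact le_mul_of_one_le_left (by positivity) (by nlinarith)
    have e8 : 0 ≤ (p : ℝ) ^ 2 * (b ^ 2 * n) := by positivity
    rw [e6]
    linarith
  have epos : 0 < (p : ℝ) ^ 2 * (a ^ 2 * p + b ^ 2 * n) := by
    have : 0 < a := by linarith
    positivity
  have e9 : (2 : ℝ) ^ (p + n + n - 1) ≤ (2 ^ (n + (p + 1) / 2)) ^ 2 := by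
    rw [← pow_mul]; exact pow_le_pow_right₀ (by norm_num) (by omega)
  have epow : (0 : ℝ) < 2 ^ (p + n + n - 1) := by positivity
  calc 2 ^ (p + n + n - 1) * (p * (4 * Q * R * p : ℝ) ^ 2 + n * b ^ 2)
      ≤ 2 ^ (p + n + n - 1) * (16 * (p ^ 2 * (a ^ 2 * p + b ^ 2 * n))) :=
        mul_le_mul_of_nonneg_left e5 epow.le
    _ < 2 ^ (p + n + n - 1) * (64 * (p ^ 2 * (a ^ 2 * p + b ^ 2 * n))) :=
        mul_lt_mul_of_pos_left (by linarith) epow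
    _ ≤ (2 ^ (n + (p + 1) / 2)) ^ 2 * (64 * (p ^ 2 * (a * rp + c * rn) ^ 2)) := by
        refine mul_le_mul e9 ?_ (by positivity) (by positivity)
        exact mul_le_mul_of_nonneg_left (mul_le_mul_of_nonneg_left e1 (sq_nonneg _)) (by norm_num)
    _ = (2 ^ (n + (p + 1) / 2 + 3) * p * (a * rp + c * rn)) ^ 2 := by
        rw [pow_add]; ring

/-- If a linear form is not too small, then neither is the corresponding observation in the integer
problem. -/
theorem le_abs_observation {N : ℕ} {x : Fin p → ℝ} {γ : Fin p → ℤ} {y η Γ W₀ D : ℝ}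
    (hγ : ∀ j, |(γ j : ℝ)| ≤ Γ) (hη : |η| ≤ W₀)
    (hy : y = ∑ j, (truncInt N (x j) : ℝ) * (γ j : ℝ) + η) (hD : p * Γ + W₀ ≤ D)
    (hform : 2 * D ≤ 2 ^ N * |∑ j, x j * (γ j : ℝ)|) : D ≤ |y| := by
  have h1 := abs_sum_truncInt_sub_le N x (fun j => (γ j : ℝ)) hγ
  have h4 : 2 * D ≤ |2 ^ N * ∑ j, x j * (γ j : ℝ)| := by
    rwa [abs_mul, abs_of_pos (by positivity : (0 : ℝ) < 2 ^ N)]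
  set A := 2 ^ N * ∑ j, x j * (γ j : ℝ)
  set B := ∑ j, (truncInt N (x j) : ℝ) * (γ j : ℝ)
  have h6 : A = y + ((A - B) - η) := by rw [hy]; ring
  have h7 := abs_add_le y ((A - B) - η)
  have h8 := abs_sub (A - B) η
  rw [← h6] at h7
  linarith

/-- The coefficient of a large observation in a relation between short vectors is not too large. -/
theorem abs_coeff_le {N : ℕ} {x : Fin p → ℝ} {z : Fin p → ℤ} {q y lam w M₀ : ℝ} (hp : 0 < p)
    (hn : 0 < n) (hq : q = n * p) (hx : ∀ j, |x j| ≤ q ^ 2) (hz : ∀ j, |(z j : ℝ)| ≤ M₀)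
    (hM : 0 ≤ M₀) (hw : |w| ≤ M₀) (hy : 2 ^ N / (2 * (n * q)) ≤ |y|)
    (heq : ∑ j, (truncInt N (x j) : ℝ) * (z j : ℝ) = lam * y - w) :
    |lam| ≤ 4 * q ^ 4 * M₀ := by
  have hq1 : 1 ≤ q := hq ▸ one_le_mul_self_of_pos hn hp
  have hn1 : (1 : ℝ) ≤ n := by exact_mod_cast hn
  have hp1 : (1 : ℝ) ≤ p := by exact_mod_cast hp
  have hNpos : (0 : ℝ) < 2 ^ N := by positivity
  have h1 : |∑ j, (truncInt N (x j) : ℝ) * (z j : ℝ)| ≤ p * (2 ^ N * q ^ 2 * M₀) := by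
    refine abs_sum_mul_le (fun j => ?_) hz (by positivity)
    exact (abs_truncInt_le N _).trans (mul_le_mul_of_nonneg_left (hx j) hNpos.le)
  have h2 : |lam| * |y| ≤ p * (2 ^ N * q ^ 2 * M₀) + M₀ := by
    have h3 : lam * y = ∑ j, (truncInt N (x j) : ℝ) * (z j : ℝ) + w := by
      rw [heq]; ring
    rw [← abs_mul, h3]
    exact (abs_add_le _ _).trans (add_le_add h1 hw)
  have h3 : |lam| * (2 ^ N / (2 * (n * q))) ≤ 2 * (p * (2 ^ N * q ^ 2 * M₀)) := by
    have h4 := mul_le_mul_of_nonneg_left hy (abs_nonneg lam)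
    have h5 : M₀ ≤ p * (2 ^ N * q ^ 2 * M₀) := by
      have h6 : (1 : ℝ) ≤ 2 ^ N := one_le_pow₀ (by norm_num)
      have h7 : 1 ≤ q ^ 2 := one_le_pow₀ hq1
      have h8 : 1 ≤ p * (2 ^ N * q ^ 2) :=
        one_le_mul_of_one_le_of_one_le hp1 (one_le_mul_of_one_le_of_one_le h6 h7)
      calc M₀ ≤ p * (2 ^ N * q ^ 2) * M₀ := le_mul_of_one_le_left hM h8
        _ = _ := by ring
    linarith
  rw [mul_div_assoc', div_le_iff₀ (by positivity)] at h3
  have h4 : 2 * (p * (2 ^ N * q ^ 2 * M₀)) * (2 * (n * q)) = 4 * q ^ 4 * M₀ * 2 ^ N := by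
    have : q ^ 4 = q ^ 3 * (n * p) := by rw [← hq]; ring
    rw [this]; ring
  rw [h4] at h3
  exact le_of_mul_le_mul_right h3 hNpos

/-- A relation between short vectors in the integer problem gives a small linear form in a row of the
exact design. -/
theorem abs_form_le {N : ℕ} {x : Fin p → ℝ} {γ z : Fin p → ℤ} {y η w Γ W₀ M₀ Λ : ℝ} {lam : ℤ}
    (hγ : ∀ j, |(γ j : ℝ)| ≤ Γ) (hη : |η| ≤ W₀)
    (hy : y = ∑ j, (truncInt N (x j) : ℝ) * (γ j : ℝ) + η) (hsum : p * Γ + W₀ ≤ M₀)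
    (hM : 0 ≤ M₀) (hz : ∀ j, |(z j : ℝ)| ≤ M₀) (hw : |w| ≤ M₀) (hpΛ : 1 + p ≤ Λ)
    (hlam : |(lam : ℝ)| ≤ Λ) (heq : ∑ j, (truncInt N (x j) : ℝ) * (z j : ℝ) = lam * y - w) :
    |∑ j, x j * ((z - lam • γ) j : ℤ)| ≤ 2 * Λ * M₀ / 2 ^ N := by
  have hNpos : (0 : ℝ) < 2 ^ N := by positivity
  have hΛ1 : 0 ≤ Λ := (abs_nonneg _).trans hlam
  have hcast : ∀ j, (((z - lam • γ) j : ℤ) : ℝ) = (z j : ℝ) - lam * (γ j : ℝ) := fun j => by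
    simp
  simp only [hcast]
  have hB : ∀ j, |(z j : ℝ) - lam * (γ j : ℝ)| ≤ M₀ + Λ * Γ := fun j => by
    refine (abs_sub _ _).trans (add_le_add (hz j) ?_)
    rw [abs_mul]
    exact mul_le_mul hlam (hγ j) (abs_nonneg _) hΛ1
  have h1 := abs_sum_truncInt_sub_le N x (fun j => (z j : ℝ) - lam * (γ j : ℝ)) hB
  have h2 : ∑ j, (truncInt N (x j) : ℝ) * ((z j : ℝ) - lam * (γ j : ℝ)) = lam * η - w := by
    have h3 : ∑ j, (truncInt N (x j) : ℝ) * ((z j : ℝ) - lam * (γ j : ℝ))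
        = ∑ j, (truncInt N (x j) : ℝ) * (z j : ℝ)
          - lam * ∑ j, (truncInt N (x j) : ℝ) * (γ j : ℝ) := by
      rw [Finset.mul_sum, ← Finset.sum_sub_distrib]
      exact Finset.sum_congr rfl fun j _ => by ring
    rw [h3, heq, hy]; ring
  rw [h2] at h1
  have h3 : |(lam : ℝ) * η - w| ≤ Λ * W₀ + M₀ := by
    refine (abs_sub _ _).trans (add_le_add ?_ hw)
    rw [abs_mul]
    exact mul_le_mul hlam hη (abs_nonneg _) hΛ1
  set F := ∑ j, x j * ((z j : ℝ) - lam * (γ j : ℝ))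
  have h5 := abs_add_le (2 ^ N * F - (lam * η - w)) (lam * η - w)
  rw [sub_add_cancel, abs_mul, abs_of_pos hNpos] at h5
  have h7 : Λ * (p * Γ + W₀) ≤ Λ * M₀ := mul_le_mul_of_nonneg_left hsum hΛ1
  have h8 : (1 + p) * M₀ ≤ Λ * M₀ := mul_le_mul_of_nonneg_right hpΛ hM
  have h9 : p * (M₀ + Λ * Γ) + (Λ * W₀ + M₀) = Λ * (p * Γ + W₀) + (1 + p) * M₀ := by ring
  rw [le_div_iff₀ hNpos]
  linarith

/-- On the event that the entries of the design are not too large, the exact linear forms given by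
`γ` are not too small, `γ` is primitive and there is no spurious vector, LBR recovers the regression
vector. -/
theorem eloOutput_eq_of_good {N Q R : ℕ} {σ W : ℝ} (hn : 0 < n) (hp : 0 < p) (hQ : 0 < Q)
    (hR : 0 < R) (hσ : 0 ≤ σ) (hσW : σ ≤ W) {X : Fin n → Fin p → ℝ} {Y w : Fin n → ℝ}
    {β : Fin p → ℝ} {a Z : Fin p → ℤ} (ha : ∀ j, (a j : ℝ) = Q * β j) (hβ : ∀ j, |β j| ≤ R)
    (hw : ∀ i, |w i| ≤ σ) (hY : ∀ i, Y i = ∑ j, X i j * β j + w i)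
    (hZ : ∀ j, Z j ∈ Set.Icc ((Q * R : ℤ) + 1) (2 * (Q * R : ℤ) + Nat.log 2 p))
    (hbig : coordBound n p N Q R σ < 2 ^ N / (2 * (n * (n * p))))
    (hX : ∀ i j, |X i j| ≤ (n * p) ^ 2)
    (hform : ∀ i, 1 / (n * (n * p)) ≤ |∑ j, X i j * ((a + Z) j : ℤ)|)
    (hgcd : (Finset.univ.gcd fun j => ((a + Z) j).natAbs) = 1)
    (hgood : ¬ HasSpurious (a + Z) (coordBound n p N Q R σ) (multBound n p N Q R σ)
      (formBound n p N Q R σ) X)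
    {m rp rn : ℤ} {v : Fin (n + p + n) → ℤ} (hrp0 : 0 ≤ rp) (hrp : (p : ℤ) ≤ rp ^ 2)
    (hrn0 : 0 ≤ rn) (hrn : (n : ℤ) ≤ rn ^ 2)
    (hm : m = 2 ^ (n + (p + 1) / 2 + 3) * p * (Q * R * rp + lbrNoise p N Q R W * rn))
    (hv0 : v ≠ 0) (hv : v ∈ lbrLattice N Q Y X Z m)
    (hshort : ∀ u ∈ lbrLattice N Q Y X Z m, u ≠ 0 →
      v ⬝ᵥ v ≤ 2 ^ (p + n + n - 1) * (u ⬝ᵥ u)) :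
    eloOutput (middle v) Z = a := by
  set q : ℝ := n * p with hq
  set M₀ := coordBound n p N Q R σ with hM₀
  set W₀ := noiseBound p N Q R σ with hW₀
  set Γ : ℝ := 4 * Q * R * p with hΓ
  set Λ := multBound n p N Q R σ with hΛ
  set γ := a + Z with hγdef
  have hq1 : 1 ≤ q := one_le_mul_self_of_pos hn hp
  have hn1 : (1 : ℝ) ≤ n := by exact_mod_cast hn
  have hp1 : (1 : ℝ) ≤ p := by exact_mod_cast hp
  have hQR1 : (1 : ℝ) ≤ Q * R := by exact_mod_cast Nat.mul_pos hQ hR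
  have hW2 : 2 ≤ W₀ := noiseBound_pos hp hQ hR hσ
  have hsum : p * Γ + W₀ ≤ M₀ := add_le_coordBound hn hp hQ hR hσ
  have hΓ4 : 4 ≤ Γ := by rw [hΓ]; nlinarith
  have hpΓ : 4 ≤ p * Γ := by nlinarith
  have hM6 : 6 ≤ M₀ := by linarith
  have hΛdef : Λ = 4 * q ^ 4 * M₀ := rfl
  have hD : (0 : ℝ) < 2 ^ N / (2 * (n * q)) := by positivity
  have hNpos : (0 : ℝ) < 2 ^ N := by positivity
  -- the primitive vector
  have habs : ∀ j, |(a j : ℝ)| ≤ Q * R := fun j => by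
    rw [ha j, abs_mul, Nat.abs_cast]
    exact mul_le_mul_of_nonneg_left (hβ j) (Nat.cast_nonneg _)
  have hγ0 : ∀ j, 0 < γ j := fun j => by
    have h1 := (hZ j).1
    have h2 := habs j
    have h3 : |a j| ≤ Q * R := by exact_mod_cast h2
    have h4 := neg_abs_le (a j)
    rw [hγdef, Pi.add_apply]
    linarith
  have hγΓ : ∀ j, (γ j : ℝ) ≤ Γ := fun j => by
    have h1 : (Z j : ℝ) ≤ 2 * (Q * R) + Nat.log 2 p := by exact_mod_cast (hZ j).2
    have h2 := (le_abs_self _).trans (habs j)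
    have h3 : (Nat.log 2 p : ℝ) ≤ p := by exact_mod_cast Nat.log_le_self 2 p
    rw [hγdef, Pi.add_apply, hΓ]
    push_cast
    nlinarith
  have hγabs : ∀ j, |(γ j : ℝ)| ≤ Γ := fun j => by
    rw [abs_of_pos (by exact_mod_cast hγ0 j)]; exact hγΓ j
  -- the noise
  set η : Fin n → ℤ := fun i => lbrObs N Q Y i - ∑ j, lbrDesign N X i j * a j with hη
  have hηW : ∀ i, |(η i : ℝ)| ≤ W₀ := fun i => by
    have h1 := abs_lbrObs_sub_le (Q := Q) (N := N) hp hR hβ (hw i) (hY i)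
    have h2 : (η i : ℝ) = (Q : ℝ) * truncInt N (Y i)
        - ∑ j, (truncInt N (X i j) : ℝ) * (Q * β j) := by
      simp only [hη, lbrObs, lbrDesign]
      push_cast
      simp only [ha]
    rw [h2]; exact h1
  have hobs : ∀ i, shiftedObs (lbrObs N Q Y) (lbrDesign N X) Z i
      = ∑ j, lbrDesign N X i j * γ j + η i := fun i => by
    simp only [shiftedObs, hη, hγdef, Pi.add_apply, mul_add, Finset.sum_add_distrib]
    ring
  set y := shiftedObs (lbrObs N Q Y) (lbrDesign N X) Z with hy
  have hyreal : ∀ i, (y i : ℝ) = ∑ j, (truncInt N (X i j) : ℝ) * (γ j : ℝ) + η i := fun i => by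
    rw [hobs i]; push_cast; rfl
  -- the observations are large
  have hyD : ∀ i, 2 ^ N / (2 * (n * q)) ≤ |(y i : ℝ)| := fun i => by
    refine le_abs_observation hγabs (hηW i) (hyreal i) (hsum.trans hbig.le) ?_
    have h5 : 2 * ((2 : ℝ) ^ N / (2 * (n * q))) = 2 ^ N * (1 / (n * q)) := by field_simp
    rw [h5]
    exact mul_le_mul_of_nonneg_left (hform i) hNpos.le
  have hyM : ∀ i, M₀ < |(y i : ℝ)| := fun i => hbig.trans_le (hyD i)
  have hy3 : ∀ i, 3 ≤ |y i| := fun i => by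
    have : (3 : ℝ) ≤ |(y i : ℝ)| := by linarith [hyM i]
    exact_mod_cast this
  -- the multiplier
  have hmsq := lt_multiplier_sq (N := N) hn hp hQ hR hσ hσW hrp0 hrp hrn0 hrn
  rw [← hm] at hmsq
  have hm0 : 0 < m := by
    have h1 : 0 ≤ m := by
      have hW0 : 0 ≤ lbrNoise p N Q R W := by
        have h2 : 0 ≤ ⌈2 ^ N * W⌉ := Int.ceil_nonneg (mul_nonneg hNpos.le (hσ.trans hσW))
        unfold lbrNoise; positivity
      rw [hm]; positivity
    rcases h1.eq_or_lt with h | h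
    · rw [← h] at hmsq
      have : (0 : ℝ) ≤ 2 ^ (p + n + n - 1) * (p * Γ ^ 2 + n * W₀ ^ 2) := by positivity
      norm_num at hmsq
      linarith
    · exact h
  have key := eloOutput_eq_sub (X' := lbrDesign N X) (Y' := lbrObs N Q Y) (Z := Z) (γ := γ)
    (η := η) (m := m) (Γ := Γ) (W₀ := W₀) (M₀ := M₀) (v := v) hp hobs hγ0 hγΓ hgcd hηW hm0
    (by linarith) hmsq (le_coordBound_sq hn hp hQ hR hσ) hy3 hyM ?_ hv0 hv hshort
  · rw [key]
    funext j
    rw [hγdef, Pi.add_apply, add_sub_cancel_right]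
  -- a spurious solution of the integer problem gives one of the real problem
  intro x hxM hxne hall
  refine hgood ⟨x, hxM, hxne, fun i => ?_⟩
  obtain ⟨lam, w', hw', heq⟩ := hall i
  have heqr : ∑ j, (truncInt N (X i j) : ℝ) * (x j : ℝ) = lam * y i - w' := by
    have := congrArg (Int.cast : ℤ → ℝ) heq
    push_cast at this
    exact this
  have hlam : |(lam : ℝ)| ≤ Λ :=
    abs_coeff_le hp hn hq (hX i) hxM (by linarith) hw' (hyD i) heqr
  refine ⟨lam, hlam, abs_form_le hγabs (hηW i) (hyreal i) hsum (by linarith) hxM hw' ?_ hlam heqr⟩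
  have h9 : (p : ℝ) ≤ q := by rw [hq]; exact le_mul_of_one_le_left (by linarith) hn1
  have h10 : q ≤ q ^ 4 := le_self_pow₀ hq1 (by norm_num)
  have h11 : 6 * q ^ 4 ≤ M₀ * q ^ 4 := mul_le_mul_of_nonneg_right hM6 (by positivity)
  have h12 : Λ = 4 * (M₀ * q ^ 4) := by rw [hΛdef]; ring
  exact (by linarith : 1 + (p : ℝ) ≤ 4 * (M₀ * q ^ 4)).trans_eq h12.symm

end Conditions


/-! ### Consequences of the lower bound for the precision -/

section Precision

variable {n p : ℕ}

/-- The hypothesis that the precision `N` is large enough. -/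
def PrecisionLarge (n p N Q R : ℕ) (σ c : ℝ) : Prop :=
  (N : ℝ) > 1 / 2 * (2 * n + p) * (2 * n + p + 10 * Real.logb 2 Q
    + 10 * Real.logb 2 (2 ^ N * σ + R * p) + 20 * Real.logb 2 (3 * (1 + c) * n * p))

theorem coordBound_pos {n p N Q R : ℕ} {σ : ℝ} (hn : 0 < n) (hp : 0 < p) (hQ : 0 < Q) (hR : 0 < R)
    (hσ : 0 ≤ σ) : 1 ≤ coordBound n p N Q R σ := by
  have h1 := add_le_coordBound (N := N) hn hp hQ hR hσ
  have h2 := noiseBound_pos (N := N) hp hQ hR hσ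
  have h3 : (0 : ℝ) ≤ p * (4 * Q * R * p) := by positivity
  linarith

theorem three_halves_le_logb {c : ℝ} (hn : 0 < n) (hp : 0 < p) (hc : 0 < c) :
    3 / 2 ≤ Real.logb 2 (3 * (1 + c) * n * p) := by
  have h1 := one_le_mul_self_of_pos hn hp
  have h2 : (3 : ℝ) ≤ 3 * (1 + c) * n * p := by nlinarith
  have h3 : Real.logb 2 3 ≤ Real.logb 2 (3 * (1 + c) * n * p) :=
    Real.logb_le_logb_of_le (by norm_num) (by norm_num) h2
  have h4 : Real.logb 2 8 ≤ Real.logb 2 (3 ^ 2) :=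
    Real.logb_le_logb_of_le (by norm_num) (by norm_num) (by norm_num)
  have h5 : Real.logb 2 8 = 3 := by
    rw [show (8 : ℝ) = 2 ^ (3 : ℝ) by norm_num]
    exact Real.logb_rpow (by norm_num) (by norm_num)
  rw [Real.logb_pow, h5] at h4
  push_cast at h4
  linarith

/-- In terms of `L = 2 n + p`, `H = 3 (1 + c) n p` and `P = Q (2 ^ N σ + R p)`, the coordinates of the
short lattice vector are at most `2 ^ (L / 2) H ^ 2 P`. -/
theorem logb_coordBound_le {N Q R : ℕ} {σ c : ℝ} (hn : 0 < n) (hp : 0 < p) (hQ : 0 < Q) (hR : 0 < R)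
    (hσ : 0 ≤ σ) (hc : 0 < c) :
    Real.logb 2 (coordBound n p N Q R σ) ≤ (2 * n + p : ℝ) / 2
      + 2 * Real.logb 2 (3 * (1 + c) * n * p)
      + (Real.logb 2 Q + Real.logb 2 (2 ^ N * σ + R * p)) := by
  have hlh := three_halves_le_logb hn hp hc
  have hn1 : (1 : ℝ) ≤ n := by exact_mod_cast hn
  have hp1 : (1 : ℝ) ≤ p := by exact_mod_cast hp
  have hQ1 : (1 : ℝ) ≤ Q := by exact_mod_cast hQ
  have hq := one_le_mul_self_of_pos hn hp
  have hRp : (1 : ℝ) ≤ R * p := by exact_mod_cast Nat.mul_pos hR hp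
  have hσN : 0 ≤ 2 ^ N * σ := by positivity
  set S := 2 ^ N * σ + R * p with hS
  have hS1 : 1 ≤ S := by linarith
  have h1 : coordBound n p N Q R σ
      ≤ 2 ^ (n + (p + 1) / 2) * (2 * (3 * (1 + c) * n * p) * (Q * S)) := by
    unfold coordBound
    refine mul_le_mul_of_nonneg_left ?_ (by positivity)
    have e1 : (p * (4 * Q * R * p) : ℝ) ≤ p * (4 * (Q * S)) := by
      have : (R * p : ℝ) ≤ S := by linarith
      calc (p * (4 * Q * R * p) : ℝ) = p * (4 * (Q * (R * p))) := by ring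
        _ ≤ _ := by gcongr
    have e2 : (n * noiseBound p N Q R σ : ℝ) = n * (2 * (Q * S)) := by
      rw [noiseBound, hS]; ring
    have e3 : (p : ℝ) ≤ n * p := le_mul_of_one_le_left (by linarith) hn1
    have e4 : (n : ℝ) ≤ n * p := le_mul_of_one_le_right (by linarith) hp1
    have e5 : 0 ≤ c * (n * p) := by positivity
    have e6 : 0 < Q * S := by positivity
    calc (p * (4 * Q * R * p) + n * noiseBound p N Q R σ : ℝ)
        ≤ (4 * p + 2 * n) * (Q * S) := by rw [e2]; linarith
      _ ≤ 2 * (3 * (1 + c) * n * p) * (Q * S) :=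
          mul_le_mul_of_nonneg_right (by linarith) e6.le
  have h2 := Real.logb_le_logb_of_le one_lt_two
    (by linarith [coordBound_pos (N := N) hn hp hQ hR hσ]) h1
  have hH : 0 < 3 * (1 + c) * n * p := by positivity
  generalize 3 * (1 + c) * n * p = H at h2 hH hlh ⊢
  rw [Real.logb_mul (by positivity) (by positivity), Real.logb_mul (by positivity) (by positivity),
    Real.logb_mul (by positivity) (by positivity), Real.logb_mul (by positivity) (by positivity),
    Real.logb_pow, Real.logb_self_eq_one one_lt_two] at h2
  have h3 : ((n + (p + 1) / 2 : ℕ) : ℝ) ≤ (2 * n + p) / 2 + 1 / 2 := by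
    have : ((2 * (n + (p + 1) / 2) : ℕ) : ℝ) ≤ ((2 * n + p + 1 : ℕ) : ℝ) := by
      exact_mod_cast (by omega)
    push_cast at this ⊢
    linarith
  linarith

/-- The coordinates of the short lattice vector are smaller than the typical observations. -/
theorem PrecisionLarge.coordBound_lt {N Q R : ℕ} {σ c : ℝ} (hN : PrecisionLarge n p N Q R σ c)
    (hn : 0 < n) (hp : 0 < p) (hQ : 0 < Q) (hR : 0 < R) (hσ : 0 ≤ σ) (hc : 0 < c) :
    coordBound n p N Q R σ < 2 ^ N / (2 * (n * (n * p))) := by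
  have hlh := three_halves_le_logb hn hp hc
  have hM := logb_coordBound_le (N := N) hn hp hQ hR hσ hc
  have hM1 := coordBound_pos (N := N) hn hp hQ hR hσ
  unfold PrecisionLarge at hN
  have hn1 : (1 : ℝ) ≤ n := by exact_mod_cast hn
  have hp1 : (1 : ℝ) ≤ p := by exact_mod_cast hp
  have hq := one_le_mul_self_of_pos hn hp
  have hlQ := logb_natCast_nonneg Q
  have hlS : 0 ≤ Real.logb 2 (2 ^ N * σ + R * p) := by
    have h1 : (1 : ℝ) ≤ R * p := by exact_mod_cast Nat.mul_pos hR hp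
    have h2 : 0 ≤ 2 ^ N * σ := by positivity
    exact Real.logb_nonneg one_lt_two (by linarith)
  have hH : (n * p : ℝ) ≤ 3 * (1 + c) * n * p := by
    have : 0 < c * (n * p) := by positivity
    linarith
  have hlq : Real.logb 2 (n * p) ≤ Real.logb 2 (3 * (1 + c) * n * p) :=
    Real.logb_le_logb_of_le one_lt_two (by linarith) hH
  have hln : Real.logb 2 n ≤ Real.logb 2 (3 * (1 + c) * n * p) :=
    Real.logb_le_logb_of_le one_lt_two (by linarith)
      ((le_mul_of_one_le_right (by linarith) hp1).trans hH)
  rw [lt_div_iff₀ (by positivity), ← Real.logb_lt_logb_iff one_lt_two (by positivity) (by positivity),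
    Real.logb_mul (by positivity) (by positivity), Real.logb_mul (by positivity) (by positivity),
    Real.logb_mul (by positivity) (by positivity), Real.logb_pow, Real.logb_self_eq_one one_lt_two]
  set lh := Real.logb 2 (3 * (1 + c) * n * p)
  set lQ := Real.logb 2 (Q : ℝ)
  set lS := Real.logb 2 (2 ^ N * σ + R * p)
  set L : ℝ := 2 * n + p with hL
  have hL3 : 3 ≤ L := by linarith
  have h1 : L / 2 ≤ 1 / 2 * L * L := by nlinarith
  have h2 : 5 * lh ≤ 10 * L * lh := mul_le_mul_of_nonneg_right (by linarith) (by linarith)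
  have h3 : 1 * (lQ + lS) ≤ 5 * L * (lQ + lS) :=
    mul_le_mul_of_nonneg_right (by linarith) (by linarith)
  linarith

/-- The union bound over the short vectors: there are at most `(2 M₀ + 1) ^ p` of them, each of which
is spurious with probability at most `((2 Λ + 1) (2 c t)) ^ n`. -/
theorem PrecisionLarge.union_bound {N Q R : ℕ} {σ c : ℝ} (hN : PrecisionLarge n p N Q R σ c)
    (hn : 0 < n) (hp : 0 < p) (hQ : 0 < Q) (hR : 0 < R) (hσ : 0 ≤ σ) (hc : 0 < c) :
    (2 * coordBound n p N Q R σ + 1) ^ p *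
      ((2 * multBound n p N Q R σ + 1) * (2 * c * formBound n p N Q R σ)) ^ n ≤ 1 / (n * p) := by
  have hlh := three_halves_le_logb hn hp hc
  have hM := logb_coordBound_le (N := N) hn hp hQ hR hσ hc
  have hM1 := coordBound_pos (N := N) hn hp hQ hR hσ
  unfold PrecisionLarge at hN
  have hn1 : (1 : ℝ) ≤ n := by exact_mod_cast hn
  have hp1 : (1 : ℝ) ≤ p := by exact_mod_cast hp
  have hq := one_le_mul_self_of_pos hn hp
  have hlQ := logb_natCast_nonneg Q
  have hlS : 0 ≤ Real.logb 2 (2 ^ N * σ + R * p) := by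
    have h1 : (1 : ℝ) ≤ R * p := by exact_mod_cast Nat.mul_pos hR hp
    have h2 : 0 ≤ 2 ^ N * σ := by positivity
    exact Real.logb_nonneg one_lt_two (by linarith)
  have hcq : 0 < c * (n * p) := by positivity
  have hH : (n * p : ℝ) ≤ 3 * (1 + c) * n * p := by linarith
  have hH3 : (3 : ℝ) ≤ 3 * (1 + c) * n * p := by linarith
  have hlq : Real.logb 2 (n * p) ≤ Real.logb 2 (3 * (1 + c) * n * p) :=
    Real.logb_le_logb_of_le one_lt_two (by linarith) hH
  have hl3 : Real.logb 2 3 ≤ Real.logb 2 (3 * (1 + c) * n * p) :=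
    Real.logb_le_logb_of_le one_lt_two (by norm_num) hH3
  set M₀ := coordBound n p N Q R σ with hM₀
  set H := 3 * (1 + c) * n * p with hHdef
  have hΛ : multBound n p N Q R σ = 4 * (n * p) ^ 4 * M₀ := rfl
  have ht : formBound n p N Q R σ = 2 * multBound n p N Q R σ * M₀ / 2 ^ N := rfl
  have hΛ1 : 1 ≤ multBound n p N Q R σ := by
    rw [hΛ]
    have : (1 : ℝ) ≤ (n * p) ^ 4 := one_le_pow₀ hq
    nlinarith
  have hA : 2 * M₀ + 1 ≤ 3 * M₀ := by linarith
  have hB : (2 * multBound n p N Q R σ + 1) * (2 * c * formBound n p N Q R σ)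
      ≤ H ^ 8 * M₀ ^ 3 / 2 ^ N := by
    have h1 : (2 * multBound n p N Q R σ + 1) * (2 * c * formBound n p N Q R σ)
        ≤ 3 * multBound n p N Q R σ * (2 * c * formBound n p N Q R σ) := by
      refine mul_le_mul_of_nonneg_right (by linarith) ?_
      rw [ht]; positivity
    have h2 : 3 * multBound n p N Q R σ * (2 * c * formBound n p N Q R σ)
        = 192 * c * (n * p) ^ 8 * M₀ ^ 3 / 2 ^ N := by rw [ht, hΛ]; ring
    have h3 : 192 * c * (n * p : ℝ) ^ 8 ≤ H ^ 8 := by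
      have e1 : H ^ 8 = 6561 * (1 + c) ^ 8 * (n * p) ^ 8 := by rw [hHdef]; ring
      rw [e1]
      refine mul_le_mul_of_nonneg_right ?_ (by positivity)
      have e2 : 1 + (8 : ℕ) * c ≤ (1 + c) ^ 8 := one_add_mul_le_pow (by linarith) 8
      push_cast at e2
      linarith
    rw [h2] at h1
    refine h1.trans ?_
    gcongr
  have hH0 : 0 < H := by linarith
  have hM0 : 0 < M₀ := by linarith
  have hfin : (3 * M₀) ^ p * (H ^ 8 * M₀ ^ 3 / 2 ^ N) ^ n ≤ 1 / (n * p) := by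
    rw [← Real.logb_le_logb one_lt_two (by positivity) (by positivity),
      Real.logb_mul (by positivity) (by positivity), Real.logb_pow, Real.logb_pow,
      Real.logb_div (by positivity) (by positivity), Real.logb_mul (by positivity) (by positivity),
      Real.logb_mul (by positivity) (by positivity), Real.logb_pow, Real.logb_pow, Real.logb_pow,
      Real.logb_self_eq_one one_lt_two, one_div, Real.logb_inv]
    set lM := Real.logb 2 M₀
    set l3 := Real.logb 2 3
    set lh := Real.logb 2 H
    set lP := Real.logb 2 (Q : ℝ) + Real.logb 2 (2 ^ N * σ + R * p) with hlP
    set L : ℝ := 2 * n + p with hL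
    have hlP0 : 0 ≤ lP := by linarith
    have hN' : 1 / 2 * L * (L + 10 * lP + 20 * lh) ≤ N := by
      rw [hlP]; linarith
    have h1 : p * (l3 + lM) ≤ p * (L / 2 + 3 * lh + lP) :=
      mul_le_mul_of_nonneg_left (by linarith) (by linarith)
    have h2 : n * ((8 : ℕ) * lh + (3 : ℕ) * lM - N * 1)
        ≤ n * (14 * lh + 3 * (L / 2) + 3 * lP - 1 / 2 * L * (L + 10 * lP + 20 * lh)) := by
      refine mul_le_mul_of_nonneg_left ?_ (by linarith)
      push_cast
      linarith
    -- the exponents of `P`, of `2 ^ (L / 2)` and of `H` are compared one after the other, where the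
    -- surplus of `2 ^ (L / 2)` in the case `n = 1` is absorbed by `H`
    have hnn : (n : ℝ) ≤ n * n := le_mul_of_one_le_left (by linarith) hn1
    have hpn : (p : ℝ) ≤ n * p := le_mul_of_one_le_left (by linarith) hn1
    have hnL : n * L = 2 * (n * n) + n * p := by rw [hL]; ring
    have h3 : (p + 3 * n) * lP ≤ 5 * (n * L) * lP :=
      mul_le_mul_of_nonneg_right (by linarith) hlP0
    have h4 : (p + 3 * n - n * L) * (L / 2) ≤ 1 * (L / 2) := by
      refine mul_le_mul_of_nonneg_right ?_ (by linarith)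
      have : 0 ≤ ((n : ℝ) - 1) * (2 * n - 1) := mul_nonneg (by linarith) (by linarith)
      linarith
    have h5 : 1 * (L / 2) ≤ lh * (L / 2) := mul_le_mul_of_nonneg_right (by linarith) (by linarith)
    have h6 : (L / 2 + 3 * p + 14 * n + 1) * lh ≤ 10 * (n * L) * lh :=
      mul_le_mul_of_nonneg_right (by linarith) (by linarith)
    push_cast at h2 ⊢
    linarith
  refine le_trans ?_ hfin
  have h0 : 0 ≤ (2 * multBound n p N Q R σ + 1) * (2 * c * formBound n p N Q R σ) := by
    rw [ht]; positivity
  exact mul_le_mul (pow_le_pow_left₀ (by positivity) hA p) (pow_le_pow_left₀ h0 hB n)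
    (by positivity) (by positivity)

end Precision


/-! ### Anticoncentration of linear forms in the design -/

section Anticoncentration

variable {n p : ℕ}

/-- The measure `ν` is absolutely continuous with density at most `c`. -/
def DensityLE (ν : Measure ℝ) (c : ℝ) : Prop :=
  ∀ s, MeasurableSet s → ν s ≤ ENNReal.ofReal c * volume s

theorem densityLE_withDensity {f : ℝ → ℝ} {c : ℝ} (hf : ∀ᵐ x, f x ≤ c) :
    DensityLE (volume.withDensity fun x => ENNReal.ofReal (f x)) c := fun s hs => by
  rw [withDensity_apply _ hs, ← setLIntegral_const]
  exact lintegral_mono_ae (ae_restrict_of_ae (hf.mono fun x hx => ENNReal.ofReal_le_ofReal hx))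

theorem DensityLE.measure_abs_add_mul_le {ν : Measure ℝ} {c : ℝ} (hν : DensityLE ν c) (hc : 0 ≤ c)
    {a : ℝ} (ha : 1 ≤ |a|) (u t : ℝ) : ν {x | |u + x * a| ≤ t} ≤ ENNReal.ofReal (2 * c * t) := by
  have ha0 : a ≠ 0 := by rintro rfl; norm_num at ha
  have h1 : {x : ℝ | |u + x * a| ≤ t} ⊆ Metric.closedBall (-u / a) t := fun x hx => by
    rw [Metric.mem_closedBall, Real.dist_eq]
    have h2 : u + x * a = (x - -u / a) * a := by field_simp; ring
    rw [Set.mem_ofPred_eq, h2, abs_mul] at hx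
    exact (le_mul_of_one_le_right (abs_nonneg _) ha).trans hx
  calc ν {x | |u + x * a| ≤ t} ≤ ν (Metric.closedBall (-u / a) t) := measure_mono h1
    _ ≤ ENNReal.ofReal c * volume (Metric.closedBall (-u / a) t) :=
        hν _ Metric.isClosed_closedBall.measurableSet
    _ = ENNReal.ofReal (2 * c * t) := by
        rw [Real.volume_closedBall, ← ENNReal.ofReal_mul hc]
        congr 1
        ring

/-- A linear form in independent random variables with bounded densities one of whose coefficients is
at least 1 in absolute value has a bounded density, too. -/
theorem DensityLE.pi_abs_sum_le {ν : Measure ℝ} [IsProbabilityMeasure ν] {c : ℝ}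
    (hν : DensityLE ν c) (hc : 0 ≤ c) {v : Fin p → ℝ} {k : Fin p} (hk : 1 ≤ |v k|) (t : ℝ) :
    Measure.pi (fun _ : Fin p => ν) {x | |∑ j, x j * v j| ≤ t} ≤ ENNReal.ofReal (2 * c * t) := by
  set P := Measure.pi (fun _ : Fin p => ν)
  set F : Fin p → (Fin p → ℝ) → ℝ := fun j x => x j * v j with hF
  have hFm : ∀ j, Measurable (F j) := fun j => by fun_prop
  have hind : iIndepFun F P :=
    iIndepFun_pi (μ := fun _ : Fin p => ν) (X := fun j y => y * v j) fun j => by fun_prop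
  have h1 := hind.indepFun_finsetSum_of_notMem hFm (Finset.notMem_erase k Finset.univ)
  set U : (Fin p → ℝ) → ℝ := ∑ j ∈ Finset.univ.erase k, F j with hU
  have hUm : Measurable U := by
    rw [hU, Finset.sum_fn]; exact Finset.measurable_sum _ fun j _ => hFm j
  have h2 := h1.map_prod_eq_prod_map_map hUm.aemeasurable (hFm k).aemeasurable
  have hset : MeasurableSet {w : ℝ × ℝ | |w.1 + w.2| ≤ t} :=
    measurableSet_le (by fun_prop) (by fun_prop)
  have h3 : {x : Fin p → ℝ | |∑ j, x j * v j| ≤ t}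
      = (fun x => (U x, F k x)) ⁻¹' {w : ℝ × ℝ | |w.1 + w.2| ≤ t} := by
    ext x
    have : ∑ j, x j * v j = U x + F k x := by
      rw [hU, Finset.sum_apply, Finset.sum_erase_add _ _ (Finset.mem_univ k)]
    simp [this]
  have hprob : IsProbabilityMeasure (P.map U) := Measure.isProbabilityMeasure_map hUm.aemeasurable
  have hprob' : IsProbabilityMeasure (P.map (F k)) :=
    Measure.isProbabilityMeasure_map (hFm k).aemeasurable
  rw [h3, ← Measure.map_apply (hUm.prodMk (hFm k)) hset, h2, Measure.prod_apply hset]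
  have h4 : ∀ u, P.map (F k) (Prod.mk u ⁻¹' {w : ℝ × ℝ | |w.1 + w.2| ≤ t})
      ≤ ENNReal.ofReal (2 * c * t) := fun u => by
    have h5 : MeasurableSet {y : ℝ | |u + y| ≤ t} := measurableSet_le (by fun_prop) (by fun_prop)
    have h6 : MeasurableSet {y : ℝ | |u + y * v k| ≤ t} :=
      measurableSet_le (by fun_prop) (by fun_prop)
    have h7 := (measurePreserving_eval (fun _ : Fin p => ν) k).measure_preimage h6.nullMeasurableSet
    change P.map (F k) {y : ℝ | |u + y| ≤ t} ≤ _
    rw [Measure.map_apply (hFm k) h5]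
    exact h7.trans_le (hν.measure_abs_add_mul_le hc hk u t)
  calc ∫⁻ u, P.map (F k) (Prod.mk u ⁻¹' {w : ℝ × ℝ | |w.1 + w.2| ≤ t}) ∂(P.map U)
      ≤ ∫⁻ _u, ENNReal.ofReal (2 * c * t) ∂(P.map U) := lintegral_mono h4
    _ = _ := by simp

/-- The law of the design under the assumption that its entries are independent with law `ν`. -/
theorem map_design {Ω : Type*} [MeasurableSpace Ω] {μ : Measure Ω} [IsProbabilityMeasure μ]
    {X : Ω → Fin n → Fin p → ℝ} {ν : Measure ℝ} [IsProbabilityMeasure ν]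
    (hm : ∀ i j, Measurable fun ω => X ω i j)
    (hind : iIndepFun (fun (ij : Fin n × Fin p) ω => X ω ij.1 ij.2) μ)
    (hlaw : ∀ i j, μ.map (fun ω => X ω i j) = ν) :
    μ.map X = Measure.pi fun _ : Fin n => Measure.pi fun _ : Fin p => ν := by
  set P := Measure.pi fun _ : Fin n => Measure.pi fun _ : Fin p => ν
  have h1 := hind.map_fun_eq_pi_map fun ij : Fin n × Fin p =>
    (hm ij.1 ij.2).aemeasurable
  simp only [hlaw] at h1
  have hun : Measurable fun (x : Fin n → Fin p → ℝ) (ij : Fin n × Fin p) => x ij.1 ij.2 := by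
    fun_prop
  have hcur : Measurable fun (y : Fin n × Fin p → ℝ) i j => y (i, j) := by fun_prop
  have h2 : Measure.pi (fun _ : Fin n × Fin p => ν)
      = P.map fun x (ij : Fin n × Fin p) => x ij.1 ij.2 := by
    refine Measure.pi_eq fun s hs => ?_
    rw [Measure.map_apply hun (MeasurableSet.univ_pi hs)]
    have h3 : (fun (x : Fin n → Fin p → ℝ) (ij : Fin n × Fin p) => x ij.1 ij.2) ⁻¹' Set.univ.pi s
        = Set.univ.pi fun i => Set.univ.pi fun j => s (i, j) := by
      ext x
      simp [Set.mem_pi]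
    rw [h3, Measure.pi_pi, Fintype.prod_prod_type]
    simp only [Measure.pi_pi]
  have hflat : Measurable fun ω (ij : Fin n × Fin p) => X ω ij.1 ij.2 :=
    measurable_pi_iff.mpr fun ij => hm ij.1 ij.2
  have h4 : μ.map X = (μ.map fun ω (ij : Fin n × Fin p) => X ω ij.1 ij.2).map
      fun y i j => y (i, j) := by
    rw [Measure.map_map hcur hflat]
    rfl
  rw [h4, h1, h2, Measure.map_map hcur hun]
  exact Measure.map_id

/-- Markov's inequality for the law with density `f`. -/
theorem measure_lt_abs_le {f : ℝ → ℝ} {M r : ℝ} (hr : 0 < r) (hfm : Measurable f)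
    (hf0 : ∀ x, 0 ≤ f x) (hint : Integrable fun x => |x| * f x) (hM : ∫ x, |x| * f x ≤ M) :
    (volume.withDensity fun x => ENNReal.ofReal (f x)) {x | r < |x|} ≤ ENNReal.ofReal (M / r) := by
  set ν := volume.withDensity fun x => ENNReal.ofReal (f x)
  have h1 : ∫⁻ x, ENNReal.ofReal |x| ∂ν ≤ ENNReal.ofReal M := by
    rw [lintegral_withDensity_eq_lintegral_mul _ (by fun_prop) (by fun_prop)]
    refine le_trans (le_of_eq ?_) (ENNReal.ofReal_le_ofReal hM)
    rw [ofReal_integral_eq_lintegral_ofReal hint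
      (Filter.Eventually.of_forall fun x => mul_nonneg (abs_nonneg x) (hf0 x))]
    refine lintegral_congr fun x => ?_
    rw [Pi.mul_apply, mul_comm, ENNReal.ofReal_mul (abs_nonneg x)]
  have h2 := mul_meas_ge_le_lintegral (μ := ν) (f := fun x => ENNReal.ofReal |x|) (by fun_prop)
    (ENNReal.ofReal r)
  have h3 : {x : ℝ | r < |x|} ⊆ {x | ENNReal.ofReal r ≤ ENNReal.ofReal |x|} := fun x hx =>
    ENNReal.ofReal_le_ofReal (le_of_lt hx)
  rw [ENNReal.ofReal_div_of_pos hr, ENNReal.le_div_iff_mul_le (Or.inl (by simpa using hr))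
    (Or.inl ENNReal.ofReal_ne_top), mul_comm]
  exact ((mul_le_mul_right (measure_mono h3) _).trans h2).trans h1

theorem card_Icc_floor_le {B : ℝ} (hB : 0 ≤ B) :
    ((Finset.Icc (-(⌊B⌋₊ : ℤ)) ⌊B⌋₊).card : ℝ) ≤ 2 * B + 1 := by
  have h1 := Nat.floor_le hB
  rw [Int.card_Icc]
  have h2 : ((⌊B⌋₊ : ℤ) + 1 - -(⌊B⌋₊ : ℤ)).toNat = 2 * ⌊B⌋₊ + 1 := by omega
  rw [h2]
  push_cast
  linarith

theorem mem_Icc_floor {B : ℝ} {a : ℤ} (h : |(a : ℝ)| ≤ B) :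
    a ∈ Finset.Icc (-(⌊B⌋₊ : ℤ)) ⌊B⌋₊ := by
  have h1 : (a.natAbs : ℝ) ≤ B := by rwa [Nat.cast_natAbs, Int.cast_abs]
  have h2 := Nat.le_floor h1
  rw [Finset.mem_Icc]
  omega

/-- The union bound over the vectors `z` and, in each row, over the multiples of `γ`. -/
theorem DensityLE.measure_hasSpurious_le {ν : Measure ℝ} [IsProbabilityMeasure ν] {c : ℝ}
    (hν : DensityLE ν c) (hc : 0 ≤ c) (γ : Fin p → ℤ) {M₀ Λ t : ℝ} (hM : 0 ≤ M₀) (hΛ : 0 ≤ Λ)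
    (ht : 0 ≤ t) :
    Measure.pi (fun _ : Fin n => Measure.pi fun _ : Fin p => ν) {x | HasSpurious γ M₀ Λ t x}
      ≤ ENNReal.ofReal ((2 * M₀ + 1) ^ p * ((2 * Λ + 1) * (2 * c * t)) ^ n) := by
  set P := Measure.pi fun _ : Fin p => ν with hP
  let zs : Finset (Fin p → ℤ) := Fintype.piFinset fun _ => Finset.Icc (-(⌊M₀⌋₊ : ℤ)) ⌊M₀⌋₊
  let ls : Finset ℤ := Finset.Icc (-(⌊Λ⌋₊ : ℤ)) ⌊Λ⌋₊
  let S : (Fin p → ℤ) → Set (Fin p → ℝ) := fun z =>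
    {y | (∀ a : ℤ, z ≠ a • γ) ∧ ∃ lam ∈ ls, |∑ j, y j * ((z - lam • γ) j : ℤ)| ≤ t}
  have hS : ∀ z, P (S z) ≤ ENNReal.ofReal ((2 * Λ + 1) * (2 * c * t)) := fun z => by
    by_cases hz : ∀ a : ℤ, z ≠ a • γ
    · have h1 : S z ⊆ ⋃ lam ∈ ls, {y | |∑ j, y j * ((z - lam • γ) j : ℤ)| ≤ t} := fun y hy => by
        obtain ⟨-, lam, hlam, h⟩ := hy
        exact Set.mem_biUnion hlam h
      have h2 : ∀ lam ∈ ls, P {y | |∑ j, y j * ((z - lam • γ) j : ℤ)| ≤ t}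
          ≤ ENNReal.ofReal (2 * c * t) := fun lam _ => by
        obtain ⟨k, hk⟩ := Function.ne_iff.mp (sub_ne_zero.mpr (hz lam))
        refine hν.pi_abs_sum_le hc (v := fun j => (((z - lam • γ) j : ℤ) : ℝ)) (k := k) ?_ t
        exact_mod_cast Int.one_le_abs hk
      calc P (S z) ≤ ∑ lam ∈ ls, P {y | |∑ j, y j * ((z - lam • γ) j : ℤ)| ≤ t} :=
            (measure_mono h1).trans (measure_biUnion_finset_le _ _)
        _ ≤ ∑ _lam ∈ ls, ENNReal.ofReal (2 * c * t) := Finset.sum_le_sum h2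
        _ = ENNReal.ofReal (ls.card * (2 * c * t)) := by
            rw [Finset.sum_const, nsmul_eq_mul, ENNReal.ofReal_mul (Nat.cast_nonneg _),
              ENNReal.ofReal_natCast]
        _ ≤ _ := ENNReal.ofReal_le_ofReal
            (mul_le_mul_of_nonneg_right (card_Icc_floor_le hΛ) (by positivity))
    · have h1 : S z = ∅ := Set.eq_empty_of_forall_notMem fun y hy => hz hy.1
      rw [h1, measure_empty]
      exact zero_le
  have hsub : {x : Fin n → Fin p → ℝ | HasSpurious γ M₀ Λ t x}
      ⊆ ⋃ z ∈ zs, Set.univ.pi fun _ => S z := fun x hx => by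
    obtain ⟨z, hz, hzγ, h⟩ := hx
    refine Set.mem_biUnion (Fintype.mem_piFinset.mpr fun j => mem_Icc_floor (hz j)) ?_
    intro i _
    obtain ⟨lam, hlam, h'⟩ := h i
    exact ⟨hzγ, lam, mem_Icc_floor hlam, h'⟩
  have hcard : (zs.card : ℝ) ≤ (2 * M₀ + 1) ^ p := by
    have : zs.card = (Finset.Icc (-(⌊M₀⌋₊ : ℤ)) ⌊M₀⌋₊).card ^ p := by
      simp [zs, Fintype.card_piFinset]
    rw [this, Nat.cast_pow]
    exact pow_le_pow_left₀ (Nat.cast_nonneg _) (card_Icc_floor_le hM) p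
  have hε : 0 ≤ (2 * Λ + 1) * (2 * c * t) := by positivity
  calc Measure.pi (fun _ : Fin n => P) {x | HasSpurious γ M₀ Λ t x}
      ≤ ∑ z ∈ zs, Measure.pi (fun _ : Fin n => P) (Set.univ.pi fun _ => S z) :=
        (measure_mono hsub).trans (measure_biUnion_finset_le _ _)
    _ ≤ ∑ _z ∈ zs, ENNReal.ofReal (((2 * Λ + 1) * (2 * c * t)) ^ n) := by
        refine Finset.sum_le_sum fun z _ => ?_
        rw [Measure.pi_pi, Finset.prod_const, Finset.card_univ, Fintype.card_fin,
          ENNReal.ofReal_pow hε]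
        gcongr
        exact hS z
    _ = ENNReal.ofReal (zs.card * ((2 * Λ + 1) * (2 * c * t)) ^ n) := by
        rw [Finset.sum_const, nsmul_eq_mul, ENNReal.ofReal_mul (Nat.cast_nonneg _),
          ENNReal.ofReal_natCast]
    _ ≤ _ := ENNReal.ofReal_le_ofReal (mul_le_mul_of_nonneg_right hcard (by positivity))

/-- All linear forms given by `γ` are rarely small. -/
theorem DensityLE.measure_abs_form_lt_le {ν : Measure ℝ} [IsProbabilityMeasure ν] {c : ℝ}
    (hν : DensityLE ν c) (hc : 0 ≤ c) {γ : Fin p → ℤ} {k : Fin p} (hk : γ k ≠ 0) (t : ℝ) :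
    Measure.pi (fun _ : Fin n => Measure.pi fun _ : Fin p => ν)
      {x | ∃ i, |∑ j, x i j * (γ j : ℝ)| < t} ≤ ENNReal.ofReal (n * (2 * c * t)) := by
  set P := Measure.pi fun _ : Fin p => ν with hP
  have h1 : {x : Fin n → Fin p → ℝ | ∃ i, |∑ j, x i j * (γ j : ℝ)| < t}
      ⊆ ⋃ i, Function.eval i ⁻¹' {y | |∑ j, y j * (γ j : ℝ)| ≤ t} := fun x hx => by
    obtain ⟨i, hi⟩ := hx
    exact Set.mem_iUnion.mpr ⟨i, hi.le⟩
  have hm : MeasurableSet {y : Fin p → ℝ | |∑ j, y j * (γ j : ℝ)| ≤ t} :=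
    measurableSet_le (by fun_prop) (by fun_prop)
  calc Measure.pi (fun _ : Fin n => P) {x | ∃ i, |∑ j, x i j * (γ j : ℝ)| < t}
      ≤ ∑ i : Fin n, Measure.pi (fun _ : Fin n => P)
          (Function.eval i ⁻¹' {y | |∑ j, y j * (γ j : ℝ)| ≤ t}) :=
        (measure_mono h1).trans (measure_iUnion_fintype_le _ _)
    _ ≤ ∑ _i : Fin n, ENNReal.ofReal (2 * c * t) := by
        refine Finset.sum_le_sum fun i _ => ?_
        rw [(measurePreserving_eval (fun _ : Fin n => P) i).measure_preimage hm.nullMeasurableSet]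
        exact hν.pi_abs_sum_le hc (v := fun j => (γ j : ℝ)) (k := k)
          (by exact_mod_cast Int.one_le_abs hk) t
    _ = _ := by
        rw [Finset.sum_const, nsmul_eq_mul, Finset.card_univ, Fintype.card_fin,
          ENNReal.ofReal_mul (Nat.cast_nonneg _), ENNReal.ofReal_natCast]

theorem measure_exists_lt_abs_le {ν : Measure ℝ} [IsProbabilityMeasure ν] {r : ℝ} {ε : ℝ}
    (h : ν {x | r < |x|} ≤ ENNReal.ofReal ε) :
    Measure.pi (fun _ : Fin n => Measure.pi fun _ : Fin p => ν) {x | ∃ i j, r < |x i j|}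
      ≤ ENNReal.ofReal (n * p * ε) := by
  set P := Measure.pi fun _ : Fin p => ν with hP
  have h1 : {x : Fin n → Fin p → ℝ | ∃ i j, r < |x i j|}
      ⊆ ⋃ ij : Fin n × Fin p, Function.eval ij.1 ⁻¹' (Function.eval ij.2 ⁻¹' {y | r < |y|}) :=
    fun x hx => by
      obtain ⟨i, j, hij⟩ := hx
      exact Set.mem_iUnion.mpr ⟨(i, j), hij⟩
  have hm : MeasurableSet {y : ℝ | r < |y|} := measurableSet_lt (by fun_prop) (by fun_prop)
  calc Measure.pi (fun _ : Fin n => P) {x | ∃ i j, r < |x i j|}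
      ≤ ∑ ij : Fin n × Fin p, Measure.pi (fun _ : Fin n => P)
          (Function.eval ij.1 ⁻¹' (Function.eval ij.2 ⁻¹' {y | r < |y|})) :=
        (measure_mono h1).trans (measure_iUnion_fintype_le _ _)
    _ ≤ ∑ _ij : Fin n × Fin p, ENNReal.ofReal ε := by
        refine Finset.sum_le_sum fun ij _ => ?_
        rw [(measurePreserving_eval (fun _ : Fin n => P) ij.1).measure_preimage
            ((measurable_pi_apply ij.2) hm).nullMeasurableSet,
          (measurePreserving_eval (fun _ : Fin p => ν) ij.2).measure_preimage hm.nullMeasurableSet]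
        exact h
    _ = _ := by
        rw [Finset.sum_const, nsmul_eq_mul, Finset.card_univ, Fintype.card_prod, Fintype.card_fin,
          Fintype.card_fin, ENNReal.ofReal_mul (by positivity), Nat.cast_mul,
          ENNReal.ofReal_mul (Nat.cast_nonneg _), ENNReal.ofReal_natCast, ENNReal.ofReal_natCast]

end Anticoncentration


/-! ### Primitivity of the shifted regression vector -/

section Seed

variable {p : ℕ}

/-- The number of multiples of `l` among consecutive integers. -/
theorem card_filter_dvd_mul_le {A B : ℤ} (hAB : A ≤ B) (a : ℤ) {l : ℕ} (hl : 0 < l) :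
    (((Finset.Ioc A B).filter fun z => (l : ℤ) ∣ a + z).card : ℤ) * l ≤ B - A + l - 1 := by
  have h0 : (0 : ℤ) < l := by exact_mod_cast hl
  have h1 : ((Finset.Ioc A B).filter fun z => (l : ℤ) ∣ a + z).card
      = ((Finset.Ioc (a + A) (a + B)).filter fun z => (l : ℤ) ∣ z).card := by
    refine Finset.card_nbij' (fun z => a + z) (fun z => z - a) ?_ ?_ ?_ ?_
    · intro z hz
      simp only [Finset.coe_filter, Finset.mem_Ioc, Set.mem_ofPred_eq] at hz ⊢
      exact ⟨⟨by linarith, by linarith⟩, hz.2⟩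
    · intro z hz
      simp only [Finset.coe_filter, Finset.mem_Ioc, Set.mem_ofPred_eq] at hz ⊢
      exact ⟨⟨by linarith, by linarith⟩, by rw [add_sub_cancel]; exact hz.2⟩
    · intro z _; ring
    · intro z _; ring
  rw [h1, Int.Ioc_filter_dvd_card _ _ h0, Int.cast_natCast, Rat.floor_intCast_div_natCast,
    Rat.floor_intCast_div_natCast]
  have h2 := Int.ediv_mul_le (a + B) h0.ne'
  have h3 := Int.lt_ediv_add_one_mul_self (a + A) h0
  rcases max_choice ((a + B) / (l : ℤ) - (a + A) / (l : ℤ)) 0 with h | h <;> rw [h]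
  · rw [sub_mul]; linarith
  · linarith

/-- The proportion of the integers drawn by the algorithm that complete a given integer to a multiple
of `l` is at most `4 / l` and at most `3 / 4`. -/
theorem uniformOn_dvd_le {A B : ℤ} (hAB : A + 2 ≤ B) (a : ℤ) {l : ℕ} (hl : 2 ≤ l)
    (hlB : (l : ℤ) ≤ 3 * (B - A)) :
    uniformOn (Set.Icc (A + 1) B) {z : ℤ | (l : ℤ) ∣ a + z}
      ≤ ENNReal.ofReal (min (3 / 4) (4 / l)) := by
  have h1 : Set.Icc (A + 1) B = ((Finset.Ioc A B : Finset ℤ) : Set ℤ) := by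
    ext z; simp
  have h2 : uniformOn (Set.Icc (A + 1) B) {z : ℤ | (l : ℤ) ∣ a + z}
      = uniformOn ((Finset.Ioc A B : Finset ℤ) : Set ℤ)
          (((Finset.Ioc A B).filter fun z => (l : ℤ) ∣ a + z : Finset ℤ) : Set ℤ) := by
    rw [h1, ← uniformOn_inter_self (Finset.finite_toSet _)]
    congr 1
    ext z
    simp
  have h3 := card_filter_dvd_mul_le (by linarith : A ≤ B) a (by omega : 0 < l)
  have h4 : ((Finset.Ioc A B).card : ℤ) = B - A := by
    rw [Int.card_Ioc, Int.toNat_of_nonneg (by linarith)]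
  rw [h2, uniformOn_apply_finset, Finset.inter_eq_right.mpr (Finset.filter_subset _ _)]
  set k := ((Finset.Ioc A B).filter fun z => (l : ℤ) ∣ a + z).card
  set d := (Finset.Ioc A B).card
  have hd : 2 ≤ d := by omega
  rw [← h4] at h3 hlB
  have h3' : (k : ℝ) * l ≤ d + l - 1 := by exact_mod_cast h3
  have hl' : (l : ℝ) ≤ 3 * d := by exact_mod_cast hlB
  have hd' : (2 : ℝ) ≤ d := by exact_mod_cast hd
  have hl2 : (2 : ℝ) ≤ l := by exact_mod_cast hl
  rw [← ENNReal.ofReal_natCast k, ← ENNReal.ofReal_natCast d,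
    ← ENNReal.ofReal_div_of_pos (by linarith)]
  refine ENNReal.ofReal_le_ofReal (le_min ?_ ?_)
  · rw [div_le_div_iff₀ (by linarith) (by norm_num)]
    have : (k : ℝ) * 4 * l ≤ 3 * d * l := by nlinarith
    exact le_of_mul_le_mul_right this (by linarith)
  · rw [div_le_div_iff₀ (by linarith) (by linarith)]
    linarith

theorem sum_sq_inv_le (G : ℕ) :
    ∑ l ∈ Finset.Icc 2 (G + 1), (1 : ℝ) / (l : ℝ) ^ 2 ≤ 1 - 1 / (G + 1) := by
  induction G with
  | zero => simp
  | succ G ih =>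
    rw [Finset.sum_Icc_succ_top (by omega)]
    have h1 : (0 : ℝ) < G + 1 := by positivity
    have h2 : (1 : ℝ) / ((G + 1 + 1 : ℕ) : ℝ) ^ 2 ≤ 1 / (G + 1) - 1 / (G + 1 + 1) := by
      push_cast
      rw [div_sub_div _ _ (by positivity) (by positivity), div_le_div_iff₀ (by positivity)
        (by positivity)]
      nlinarith
    push_cast at h2 ⊢
    linarith

/-- The bound `4 / l` for two of the factors makes the sum converge, and the other factors are bounded
by `3 / 4`. -/
theorem sum_min_pow_le {p : ℕ} (hp : 2 ≤ p) (G : ℕ) :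
    ∑ l ∈ Finset.Icc 2 G, min (3 / 4 : ℝ) (4 / l) ^ p ≤ 29 * (3 / 4) ^ p := by
  obtain ⟨k, rfl⟩ := Nat.exists_eq_add_of_le hp
  have h1 : ∀ l ∈ Finset.Icc 2 G,
      min (3 / 4 : ℝ) (4 / l) ^ (2 + k) ≤ 16 * (3 / 4) ^ k * (1 / (l : ℝ) ^ 2) := fun l _ => by
    have h0 : (0 : ℝ) ≤ min (3 / 4 : ℝ) (4 / l) := le_min (by norm_num) (by positivity)
    rw [pow_add]
    calc min (3 / 4 : ℝ) (4 / l) ^ 2 * min (3 / 4 : ℝ) (4 / l) ^ k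
        ≤ (4 / l) ^ 2 * (3 / 4) ^ k :=
          mul_le_mul (pow_le_pow_left₀ h0 (min_le_right _ _) 2)
            (pow_le_pow_left₀ h0 (min_le_left _ _) k) (by positivity) (by positivity)
      _ = _ := by rw [div_pow]; ring
  have h2 : ∑ l ∈ Finset.Icc 2 G, (1 : ℝ) / (l : ℝ) ^ 2 ≤ 1 := by
    have h3 : Finset.Icc 2 G ⊆ Finset.Icc 2 (G + 1) := Finset.Icc_subset_Icc_right (by omega)
    have h4 := Finset.sum_le_sum_of_subset_of_nonneg h3
      (f := fun l : ℕ => (1 : ℝ) / (l : ℝ) ^ 2) fun _ _ _ => by positivity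
    have h5 := sum_sq_inv_le G
    have h6 : (0 : ℝ) ≤ 1 / (G + 1) := by positivity
    linarith
  calc ∑ l ∈ Finset.Icc 2 G, min (3 / 4 : ℝ) (4 / l) ^ (2 + k)
      ≤ ∑ l ∈ Finset.Icc 2 G, 16 * (3 / 4) ^ k * (1 / (l : ℝ) ^ 2) := Finset.sum_le_sum h1
    _ = 16 * (3 / 4) ^ k * ∑ l ∈ Finset.Icc 2 G, (1 : ℝ) / (l : ℝ) ^ 2 := by rw [Finset.mul_sum]
    _ ≤ 16 * (3 / 4) ^ k * 1 := mul_le_mul_of_nonneg_left h2 (by positivity)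
    _ ≤ 29 * (3 / 4) ^ (2 + k) := by
        rw [pow_add]
        have : (0 : ℝ) < (3 / 4) ^ k := by positivity
        linarith

theorem finite_nonempty_Icc_seed (p : ℕ) {R : ℤ} (hR : 0 < R) :
    (Set.Icc (R + 1) (2 * R + Nat.log 2 p)).Finite ∧
      (Set.Icc (R + 1) (2 * R + Nat.log 2 p)).Nonempty :=
  ⟨Set.finite_Icc _ _, Set.nonempty_Icc.mpr (by linarith [Int.natCast_nonneg (Nat.log 2 p)])⟩

theorem isProbabilityMeasure_seedLaw (p : ℕ) {R : ℤ} (hR : 0 < R) :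
    IsProbabilityMeasure (seedLaw p R) := by
  have := isProbabilityMeasure_uniformOn (finite_nonempty_Icc_seed p hR).1
    (finite_nonempty_Icc_seed p hR).2
  unfold seedLaw
  infer_instance

theorem seedLaw_notMem_eq_zero (p : ℕ) {R : ℤ} (hR : 0 < R) :
    seedLaw p R {Z | ¬ ∀ j, Z j ∈ Set.Icc (R + 1) (2 * R + Nat.log 2 p)} = 0 := by
  set I := Set.Icc (R + 1) (2 * R + (Nat.log 2 p : ℤ)) with hI
  obtain ⟨hfin, hne⟩ := finite_nonempty_Icc_seed p hR
  have := isProbabilityMeasure_uniformOn hfin hne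
  have := isProbabilityMeasure_seedLaw p hR
  have h1 : seedLaw p R (Set.univ.pi fun _ => I) = 1 := by
    unfold seedLaw
    rw [Measure.pi_pi]
    have h0 : uniformOn I I = 1 := uniformOn_self hfin hne
    simp [← hI, h0]
  have h2 : {Z : Fin p → ℤ | ¬ ∀ j, Z j ∈ I} = (Set.univ.pi fun _ => I)ᶜ := by
    ext Z; simp [Set.mem_pi]
  rw [h2, prob_compl_eq_zero_iff (Set.to_countable _).measurableSet, h1]

/-- The shifted vector is primitive with high probability: a common divisor `l ≥ 2` occurs with
probability at most `min (3 / 4) (4 / l) ^ p`. -/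
theorem seedLaw_gcd_ne_one_le (hp : 0 < p) {R : ℤ} (hR : 0 < R) {a : Fin p → ℤ}
    (ha : ∀ j, |a j| ≤ R) :
    seedLaw p R {Z | (∀ j, Z j ∈ Set.Icc (R + 1) (2 * R + Nat.log 2 p)) ∧
      (Finset.univ.gcd fun j => ((a + Z) j).natAbs) ≠ 1} ≤ ENNReal.ofReal (29 * (3 / 4) ^ p) := by
  have hprob := isProbabilityMeasure_seedLaw p hR
  rcases (by omega : p = 1 ∨ 2 ≤ p) with rfl | hp2
  · refine prob_le_one.trans ?_
    rw [← ENNReal.ofReal_one]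
    exact ENNReal.ofReal_le_ofReal (by norm_num)
  set len : ℤ := R + Nat.log 2 p with hlen
  have hlog : 1 ≤ Nat.log 2 p := Nat.log_pos one_lt_two hp2
  set B : ℤ := 2 * R + Nat.log 2 p with hB
  have hfin := isProbabilityMeasure_uniformOn (finite_nonempty_Icc_seed p hR).1
    (finite_nonempty_Icc_seed p hR).2
  have hsub : {Z : Fin p → ℤ | (∀ j, Z j ∈ Set.Icc (R + 1) B) ∧
      (Finset.univ.gcd fun j => ((a + Z) j).natAbs) ≠ 1}
      ⊆ ⋃ l ∈ Finset.Icc 2 (3 * len).toNat,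
          Set.univ.pi fun j => {z : ℤ | ((l : ℕ) : ℤ) ∣ a j + z} := fun Z hZ => by
    obtain ⟨hZ, hg⟩ := hZ
    set l := Finset.univ.gcd fun j => ((a + Z) j).natAbs with hl
    have hdvd : ∀ j, (l : ℤ) ∣ a j + Z j := fun j =>
      Int.natCast_dvd.mpr (Finset.gcd_dvd (Finset.mem_univ j))
    have h1 := (abs_le.mp (ha ⟨0, hp⟩))
    have h2 := hZ ⟨0, hp⟩
    have h3 : 0 < a ⟨0, hp⟩ + Z ⟨0, hp⟩ := by linarith [h1.1, h2.1]
    have h4 : (l : ℤ) ≤ 3 * len := by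
      have h5 := Int.le_of_dvd h3 (hdvd ⟨0, hp⟩)
      have h6 := h2.2
      have h7 : (0 : ℤ) ≤ Nat.log 2 p := Int.natCast_nonneg _
      linarith [h1.2]
    have h5 : l ≠ 0 := fun h => by
      have h6 := hdvd ⟨0, hp⟩
      rw [h, Nat.cast_zero, zero_dvd_iff] at h6
      linarith
    refine Set.mem_biUnion (x := l) (Finset.mem_Icc.mpr ⟨by omega, by omega⟩) ?_
    exact fun j _ => hdvd j
  have hterm : ∀ l ∈ Finset.Icc 2 (3 * len).toNat,
      seedLaw p R (Set.univ.pi fun j => {z : ℤ | ((l : ℕ) : ℤ) ∣ a j + z})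
        ≤ ENNReal.ofReal (min (3 / 4 : ℝ) (4 / l) ^ p) := fun l hl => by
    rw [Finset.mem_Icc] at hl
    have hmin : 0 ≤ min (3 / 4 : ℝ) (4 / l) := le_min (by norm_num) (by positivity)
    unfold seedLaw
    rw [Measure.pi_pi, ENNReal.ofReal_pow hmin]
    have h1 : ∀ j, uniformOn (Set.Icc (R + 1) B) {z : ℤ | ((l : ℕ) : ℤ) ∣ a j + z}
        ≤ ENNReal.ofReal (min (3 / 4 : ℝ) (4 / l)) := fun j =>
      uniformOn_dvd_le (by omega) (a j) hl.1 (by omega)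
    calc ∏ j, uniformOn (Set.Icc (R + 1) B) {z : ℤ | ((l : ℕ) : ℤ) ∣ a j + z}
        ≤ ∏ _j : Fin p, ENNReal.ofReal (min (3 / 4 : ℝ) (4 / l)) :=
          Finset.prod_le_prod' fun j _ => h1 j
      _ = _ := by rw [Finset.prod_const, Finset.card_univ, Fintype.card_fin]
  calc seedLaw p R {Z : Fin p → ℤ | (∀ j, Z j ∈ Set.Icc (R + 1) B) ∧
        (Finset.univ.gcd fun j => ((a + Z) j).natAbs) ≠ 1} ≤ ∑ l ∈ Finset.Icc 2 (3 * len).toNat,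
        seedLaw p R (Set.univ.pi fun j => {z : ℤ | ((l : ℕ) : ℤ) ∣ a j + z}) :=
        (measure_mono hsub).trans (measure_biUnion_finset_le _ _)
    _ ≤ ∑ l ∈ Finset.Icc 2 (3 * len).toNat, ENNReal.ofReal (min (3 / 4 : ℝ) (4 / l) ^ p) :=
        Finset.sum_le_sum hterm
    _ = ENNReal.ofReal (∑ l ∈ Finset.Icc 2 (3 * len).toNat, min (3 / 4 : ℝ) (4 / l) ^ p) :=
        (ENNReal.ofReal_sum_of_nonneg fun l _ =>
          pow_nonneg (le_min (by norm_num) (by positivity)) p).symm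
    _ ≤ _ := ENNReal.ofReal_le_ofReal (sum_min_pow_le hp2 _)

/-- A subset of a product with a countable space all of whose sections have small measure. -/
theorem prod_le_of_section_le {Ω S : Type*} [MeasurableSpace Ω] [MeasurableSpace S] [Countable S]
    [MeasurableSingletonClass S] {μ : Measure Ω} {ν : Measure S} [SFinite μ] [SFinite ν]
    [IsProbabilityMeasure ν] {s : Set (Ω × S)} {ε : ENNReal}
    (h : ∀ z, μ {ω | (ω, z) ∈ s} ≤ ε) : (μ.prod ν) s ≤ ε := by
  have h1 : s ⊆ ⋃ z, {ω | (ω, z) ∈ s} ×ˢ {z} := fun x hx =>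
    Set.mem_iUnion.mpr ⟨x.2, hx, rfl⟩
  calc (μ.prod ν) s ≤ ∑' z, (μ.prod ν) ({ω | (ω, z) ∈ s} ×ˢ {z}) :=
        (measure_mono h1).trans (measure_iUnion_le _)
    _ ≤ ∑' z, ε * ν {z} := ENNReal.tsum_le_tsum fun z => by
        rw [Measure.prod_prod]; gcongr; exact h z
    _ = ε := by
        rw [ENNReal.tsum_mul_left]
        have h2 : ∑' z, ν {z} = 1 := by
          have := measure_iUnion (μ := ν) (f := fun z : S => ({z} : Set S))
            (fun a b hab => by simpa using hab) fun z => measurableSet_singleton z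
          rw [← this, Set.iUnion_of_singleton, measure_univ]
        rw [h2, mul_one]

end Seed


/-! ### Failure is rare -/

section Main

open Matrix

variable {n p : ℕ}

theorem logb_natCast_le (n : ℕ) : Real.logb 2 n ≤ n := by
  rcases Nat.eq_zero_or_pos n with rfl | h
  · simp
  · have h1 : (n : ℝ) ≤ 2 ^ n := by exact_mod_cast Nat.lt_two_pow_self.le
    have h2 := Real.logb_le_logb_of_le one_lt_two (by exact_mod_cast h) h1
    rwa [Real.logb_pow, Real.logb_self_eq_one one_lt_two, mul_one] at h2

theorem sizeParam_nonneg (n p N Q R : ℕ) (W : ℝ) : 0 ≤ sizeParam n p N Q R W := by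
  have h1 := logb_natCast_nonneg Q
  have h2 := logb_natCast_nonneg R
  have h3 : 0 ≤ max 0 (Real.logb 2 W) := le_max_left _ _
  unfold sizeParam
  positivity

/-- If the entries of the design are not too large, then the sizes of the entries of the data are
controlled by the other parameters. -/
theorem logb_two_add_le (N : ℕ) {n p Q R : ℕ} {W : ℝ} (hn : 0 < n) (hp : 0 < p) (hR : 0 < R)
    (hW : 0 < W) :
    Real.logb 2 (2 + (p * ((n * p) ^ 2 * R) + W)) ≤ 4 * sizeParam n p N Q R W := by
  have hq := one_le_mul_self_of_pos hn hp
  have hn1 : (1 : ℝ) ≤ n := by exact_mod_cast hn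
  have hp1 : (1 : ℝ) ≤ p := by exact_mod_cast hp
  have hR1 : (1 : ℝ) ≤ R := by exact_mod_cast hR
  set w := max 1 W with hw
  have hw1 : 1 ≤ w := le_max_left _ _
  have hWw : W ≤ w := le_max_right _ _
  have hlw : Real.logb 2 w = max 0 (Real.logb 2 W) := by
    rcases le_total W 1 with h | h
    · rw [hw, max_eq_left h, Real.logb_one, max_eq_left (Real.logb_nonpos one_lt_two hW.le h)]
    · rw [hw, max_eq_right h, max_eq_right (Real.logb_nonneg one_lt_two h)]
  set x : ℝ := p * ((n * p) ^ 2 * R) with hx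
  have hx1 : 1 ≤ x := one_le_mul_of_one_le_of_one_le hp1
    (one_le_mul_of_one_le_of_one_le (one_le_pow₀ hq) hR1)
  have h1 : 2 + (x + W) ≤ 2 ^ 2 * (x * w) := by
    have h2 : x ≤ x * w := le_mul_of_one_le_right (by linarith) hw1
    have h3 : w ≤ x * w := le_mul_of_one_le_left (by linarith) hx1
    linarith
  have h2 := Real.logb_le_logb_of_le one_lt_two (by positivity) h1
  rw [Real.logb_mul (by positivity) (by positivity), Real.logb_mul (by positivity) (by positivity),
    hlw, hx, Real.logb_mul (by positivity) (by positivity),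
    Real.logb_mul (by positivity) (by positivity), Real.logb_pow, Real.logb_pow,
    Real.logb_mul (by positivity) (by positivity), Real.logb_self_eq_one one_lt_two] at h2
  push_cast at h2
  have h3 := logb_natCast_le n
  have h4 := logb_natCast_le p
  have h5 := logb_natCast_nonneg Q
  have h6 := logb_natCast_nonneg R
  have h7 : 0 ≤ max 0 (Real.logb 2 W) := le_max_left _ _
  have h8 : (0 : ℝ) ≤ N := Nat.cast_nonneg N
  unfold sizeParam
  linarith

/-- LBR returns the regression vector within `A * sizeParam ^ D` bit operations whenever the entries
of the design are not too large, the linear forms given by the integer vector `γ = a + Z` with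
`a = Q β` are not too small, `γ` is primitive and there is no spurious vector. -/
def RecoversWithin (A D : ℕ) : Prop :=
  ∀ (n p N Q R : ℕ) (σ W : ℝ) (X : Fin n → Fin p → ℝ) (Y w : Fin n → ℝ) (β : Fin p → ℝ)
    (a Z : Fin p → ℤ),
    0 < n → 0 < p → 0 < N → 0 < Q → 0 < R → 0 ≤ σ → 0 < W → σ ≤ W →
    (∀ j, (a j : ℝ) = Q * β j) → (∀ j, |β j| ≤ R) → (∀ i, |w i| ≤ σ) →
    (∀ i, Y i = ∑ j, X i j * β j + w i) →
    (∀ j, Z j ∈ Set.Icc ((Q * R : ℤ) + 1) (2 * (Q * R : ℤ) + Nat.log 2 p)) →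
    coordBound n p N Q R σ < 2 ^ N / (2 * (n * (n * p))) →
    (∀ i j, |X i j| ≤ (n * p) ^ 2) →
    (∀ i, 1 / (n * (n * p)) ≤ |∑ j, X i j * ((a + Z) j : ℤ)|) →
    (Finset.univ.gcd fun j => ((a + Z) j).natAbs) = 1 →
    (¬ HasSpurious (a + Z) (coordBound n p N Q R σ) (multBound n p N Q R σ)
      (formBound n p N Q R σ) X) →
    ∃ (out : Fin p → ℚ) (t : ℕ), LBRReturns Y X N Q R W Z out t ∧
      (∀ j, (out j : ℝ) = β j) ∧ (t : ℝ) ≤ A * sizeParam n p N Q R W ^ D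

/-- The algorithm always terminates in polynomial time, and it returns the regression vector in
polynomial time under deterministic conditions on the design and the random vector `Z`. -/
theorem exists_lbr_recovery : ∃ A D : ℕ,
    (∀ (n p N Q R : ℕ) (W B : ℝ) (Y : Fin n → ℝ) (X : Fin n → Fin p → ℝ) (Z : Fin p → ℤ),
      0 < n → 0 < p → 0 < N → 0 < Q → 0 < R → 0 < W → (∀ i, |Y i| ≤ B) → (∀ i j, |X i j| ≤ B) →
      (∀ j, Z j ∈ Set.Icc ((Q * R : ℤ) + 1) (2 * (Q * R : ℤ) + Nat.log 2 p)) →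
      ∃ (out : Fin p → ℚ) (t : ℕ), LBRReturns Y X N Q R W Z out t ∧
        (t : ℝ) ≤ A * (sizeParam n p N Q R W + Real.logb 2 (2 + B)) ^ D) ∧
    RecoversWithin A D := by
  obtain ⟨A, D, h⟩ := exists_lbr_eq_sizeParam
  refine ⟨A * 5 ^ D, D, ?_, ?_⟩
  · intro n p N Q R W B Y X Z hn hp hN hQ hR hW hY hX hZ
    obtain ⟨m, rp, rn, v, t, -, -, -, -, -, -, -, -, hret, ht⟩ :=
      h n p N Q R W B Y X Z hn hp hN hQ hR hW hY hX hZ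
    refine ⟨_, t, hret, ht.trans ?_⟩
    have hB : 0 ≤ B := (abs_nonneg _).trans (hY ⟨0, hn⟩)
    have h1 : 0 ≤ Real.logb 2 (2 + B) := Real.logb_nonneg one_lt_two (by linarith)
    have h2 := sizeParam_nonneg n p N Q R W
    push_cast
    refine mul_le_mul_of_nonneg_right ?_ (by positivity)
    exact le_mul_of_one_le_right (Nat.cast_nonneg _) (one_le_pow₀ (by norm_num))
  · intro n p N Q R σ W X Y w β a Z hn hp hN hQ hR hσ hW hσW ha hβ hw hY hZ hbig hX hform hgcd hgood
    have hR1 : (1 : ℝ) ≤ R := by exact_mod_cast hR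
    have hp1 : (1 : ℝ) ≤ p := by exact_mod_cast hp
    -- the data are bounded in terms of the other parameters, so the time is, too
    have hYB : ∀ i, |Y i| ≤ p * ((n * p) ^ 2 * R) + W := fun i => by
      rw [hY i]
      exact (abs_add_le _ _).trans (add_le_add (abs_sum_mul_le (hX i) hβ (by positivity))
        ((hw i).trans hσW))
    have hXB : ∀ i j, |X i j| ≤ p * ((n * p) ^ 2 * R) + W := fun i j => by
      have h1 : (n * p : ℝ) ^ 2 ≤ (n * p) ^ 2 * R := le_mul_of_one_le_right (by positivity) hR1
      have h2 : (n * p : ℝ) ^ 2 * R ≤ p * ((n * p) ^ 2 * R) :=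
        le_mul_of_one_le_left (by positivity) hp1
      linarith [hX i j]
    obtain ⟨m, rp, rn, v, t, hrp0, hrp, hrn0, hrn, hm, hv0, hv, hshort, hret, ht⟩ :=
      h n p N Q R W _ Y X Z hn hp hN hQ hR hW hYB hXB hZ
    refine ⟨_, t, hret, fun j => ?_, ht.trans ?_⟩
    · rw [eloOutput_eq_of_good hn hp hQ hR hσ hσW ha hβ hw hY hZ hbig hX hform hgcd hgood hrp0 hrp
        hrn0 hrn hm hv0 hv hshort]
      have hQ0 : (Q : ℝ) ≠ 0 := by exact_mod_cast hQ.ne'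
      push_cast
      rw [ha j, mul_div_cancel_left₀ _ hQ0]
    · have h1 := logb_two_add_le N (Q := Q) hn hp hR hW
      have h2 := sizeParam_nonneg n p N Q R W
      have h3 : 0 ≤ Real.logb 2 (2 + (p * ((n * p) ^ 2 * R) + W)) :=
        Real.logb_nonneg one_lt_two (by
          have : (0 : ℝ) ≤ p * ((n * p) ^ 2 * R) := by positivity
          linarith)
      push_cast
      rw [mul_assoc, ← mul_pow]
      refine mul_le_mul_of_nonneg_left ?_ (Nat.cast_nonneg _)
      exact pow_le_pow_left₀ (by linarith) (by linarith) D

theorem exists_int_eq_mul_of_qRational {β : Fin p → ℝ} {Q Q' : ℕ} (h : QRational Q β) (hQ : 0 < Q)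
    (hdvd : Q ∣ Q') : ∃ a : Fin p → ℤ, ∀ j, (a j : ℝ) = Q' * β j := by
  choose k hk using h
  obtain ⟨d, rfl⟩ := hdvd
  refine ⟨fun j => k j * d, fun j => ?_⟩
  have hQ0 : (Q : ℝ) ≠ 0 := by exact_mod_cast hQ.ne'
  rw [hk j]
  push_cast
  field_simp

/-- The failure of one of the conditions on the design is improbable for each value of `Z`. -/
theorem measure_bad_design_le {Ω : Type*} [MeasurableSpace Ω] {μ : Measure Ω}
    [IsProbabilityMeasure μ] {X : Ω → Fin n → Fin p → ℝ} {f : ℝ → ℝ} {c M σ : ℝ} {N Q R : ℕ}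
    (hX : IsDesign μ X f c M) (hn : 0 < n) (hp : 0 < p) (hQ : 0 < Q) (hR : 0 < R) (hσ : 0 ≤ σ)
    (hc : 0 < c) (hN : PrecisionLarge n p N Q R σ c) {γ : Fin p → ℤ} (hγ : ∀ j, 0 < γ j) :
    μ {ω | ¬ ((∀ i j, |X ω i j| ≤ (n * p) ^ 2) ∧
        (∀ i, 1 / (n * (n * p)) ≤ |∑ j, X ω i j * (γ j : ℝ)|) ∧
        ¬ HasSpurious γ (coordBound n p N Q R σ) (multBound n p N Q R σ)
          (formBound n p N Q R σ) (X ω))} ≤ ENNReal.ofReal ((max M 0 + 2 * c + 1) / (n * p)) := by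
  have hn1 : (1 : ℝ) ≤ n := by exact_mod_cast hn
  have hp1 : (1 : ℝ) ≤ p := by exact_mod_cast hp
  have hq := one_le_mul_self_of_pos hn hp
  have hM1 := coordBound_pos (n := n) (N := N) hn hp hQ hR hσ
  have hΛ : 0 ≤ multBound n p N Q R σ := by unfold multBound; positivity
  have ht : 0 ≤ formBound n p N Q R σ := by unfold formBound; positivity
  set ν := volume.withDensity fun x => ENNReal.ofReal (f x) with hν
  have hνp : IsProbabilityMeasure ν := by
    rw [hν, ← hX.law ⟨0, hn⟩ ⟨0, hp⟩]
    exact Measure.isProbabilityMeasure_map (hX.measurable _ _).aemeasurable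
  have hνc : DensityLE ν c := densityLE_withDensity hX.bounded
  have hXm : Measurable X := measurable_pi_iff.mpr fun i => measurable_pi_iff.mpr (hX.measurable i)
  have hlaw := map_design hX.measurable hX.indep hX.law
  set P := Measure.pi fun _ : Fin n => Measure.pi fun _ : Fin p => ν with hP
  set B₁ : Set (Fin n → Fin p → ℝ) := {x | ∃ i j, (n * p : ℝ) ^ 2 < |x i j|}
  set B₂ : Set (Fin n → Fin p → ℝ) :=
    {x | ∃ i, |∑ j, x i j * (γ j : ℝ)| < 1 / (n * (n * p))}
  set B₃ : Set (Fin n → Fin p → ℝ) := {x | HasSpurious γ (coordBound n p N Q R σ)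
    (multBound n p N Q R σ) (formBound n p N Q R σ) x}
  have h1 : P B₁ ≤ ENNReal.ofReal (max M 0 / (n * p)) := by
    have e1 : ν {x | (n * p : ℝ) ^ 2 < |x|} ≤ ENNReal.ofReal (M / (n * p) ^ 2) :=
      measure_lt_abs_le (by positivity) hX.measurable_density hX.nonneg hX.integrable hX.moment_le
    refine (measure_exists_lt_abs_le e1).trans (ENNReal.ofReal_le_ofReal ?_)
    have e2 : (n * p : ℝ) * (M / (n * p) ^ 2) = M / (n * p) := by field_simp
    rw [e2]
    gcongr
    exact le_max_left _ _
  have h2 : P B₂ ≤ ENNReal.ofReal (2 * c / (n * p)) := by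
    refine (hνc.measure_abs_form_lt_le hc.le (hγ ⟨0, hp⟩).ne' _).trans_eq ?_
    congr 1
    field_simp
  have h3 : P B₃ ≤ ENNReal.ofReal (1 / (n * p)) :=
    (hνc.measure_hasSpurious_le hc.le γ (by linarith) hΛ ht).trans
      (ENNReal.ofReal_le_ofReal (hN.union_bound hn hp hQ hR hσ hc))
  have hsub : {ω | ¬ ((∀ i j, |X ω i j| ≤ (n * p) ^ 2) ∧
        (∀ i, 1 / (n * (n * p)) ≤ |∑ j, X ω i j * (γ j : ℝ)|) ∧
        ¬ HasSpurious γ (coordBound n p N Q R σ) (multBound n p N Q R σ)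
          (formBound n p N Q R σ) (X ω))} ⊆ X ⁻¹' (B₁ ∪ B₂ ∪ B₃) := fun ω hω => by
    by_contra hcon
    simp only [Set.mem_preimage, Set.mem_union, not_or] at hcon
    obtain ⟨⟨c1, c2⟩, c3⟩ := hcon
    refine hω ⟨fun i j => ?_, fun i => ?_, c3⟩
    · exact not_lt.mp fun h => c1 ⟨i, j, h⟩
    · exact not_lt.mp fun h => c2 ⟨i, h⟩
  calc _ ≤ μ (X ⁻¹' (B₁ ∪ B₂ ∪ B₃)) := measure_mono hsub
    _ ≤ P (B₁ ∪ B₂ ∪ B₃) := by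
        rw [← hlaw]; exact Measure.le_map_apply hXm.aemeasurable _
    _ ≤ P B₁ + P B₂ + P B₃ :=
        (measure_union_le _ _).trans (add_le_add_left (measure_union_le _ _) _)
    _ ≤ ENNReal.ofReal (max M 0 / (n * p)) + ENNReal.ofReal (2 * c / (n * p))
        + ENNReal.ofReal (1 / (n * p)) := by gcongr
    _ = _ := by
        rw [← ENNReal.ofReal_add (by positivity) (by positivity),
          ← ENNReal.ofReal_add (by positivity) (by positivity), ← add_div, ← add_div]

/-- The bound for the probability of failure from which both bounds in the theorem follow. -/
theorem prod_failure_le {A D : ℕ}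
    (h : RecoversWithin A D)
    {Ω : Type*} [MeasurableSpace Ω] {μ : Measure Ω} [IsProbabilityMeasure μ] {N Q R : ℕ}
    {c M σ W : ℝ} {β : Fin p → ℝ} {f : ℝ → ℝ} {X : Ω → Fin n → Fin p → ℝ} {w Y : Ω → Fin n → ℝ}
    {a : Fin p → ℤ} (hX : IsDesign μ X f c M) (hn : 0 < n) (hp : 0 < p) (hN0 : 0 < N) (hQ : 0 < Q)
    (hR : 0 < R) (hσ : 0 ≤ σ) (hW : 0 < W) (hσW : σ ≤ W) (hc : 0 < c)
    (ha : ∀ j, (a j : ℝ) = Q * β j) (hβ : ∀ j, |β j| ≤ R) (hw : ∀ ω i, |w ω i| ≤ σ)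
    (hY : ∀ ω i, Y ω i = ∑ j, X ω i j * β j + w ω i) (hN : PrecisionLarge n p N Q R σ c) :
    (μ.prod (seedLaw p (Q * R))) (failure Y X N Q R W β (A * sizeParam n p N Q R W ^ D))
      ≤ ENNReal.ofReal ((max M 0 + 2 * c + 1) / (n * p) + 29 * (3 / 4) ^ p) := by
  have hQR : (0 : ℤ) < Q * R := by exact_mod_cast Nat.mul_pos hQ hR
  have haR : ∀ j, |a j| ≤ (Q * R : ℤ) := fun j => by
    have h1 : |(a j : ℝ)| ≤ Q * R := by
      rw [ha j, abs_mul, Nat.abs_cast]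
      exact mul_le_mul_of_nonneg_left (hβ j) (Nat.cast_nonneg _)
    exact_mod_cast h1
  have hprob := isProbabilityMeasure_seedLaw p hQR
  set ν := seedLaw p (Q * R) with hν
  set I : Set (Fin p → ℤ) :=
    {Z | ∀ j, Z j ∈ Set.Icc ((Q * R : ℤ) + 1) (2 * (Q * R : ℤ) + Nat.log 2 p)} with hI
  set G : Set (Fin p → ℤ) := {Z | Z ∈ I ∧ (Finset.univ.gcd fun j => ((a + Z) j).natAbs) ≠ 1}
  set F := failure Y X N Q R W β (A * sizeParam n p N Q R W ^ D)
  have h1 : (μ.prod ν) (Set.univ ×ˢ Iᶜ) = 0 := by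
    rw [Measure.prod_prod]
    have : ν Iᶜ = 0 := seedLaw_notMem_eq_zero p hQR
    rw [this, mul_zero]
  have h2 : (μ.prod ν) (Set.univ ×ˢ G) ≤ ENNReal.ofReal (29 * (3 / 4) ^ p) := by
    rw [Measure.prod_prod, measure_univ, one_mul]
    exact seedLaw_gcd_ne_one_le hp hQR haR
  have h3 : (μ.prod ν) {x | x ∈ F ∧ x.2 ∈ I ∧ x.2 ∉ G}
      ≤ ENNReal.ofReal ((max M 0 + 2 * c + 1) / (n * p)) := by
    refine prod_le_of_section_le fun Z => ?_
    by_cases hZ : Z ∈ I ∧ Z ∉ G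
    · have hγ : ∀ j, 0 < (a + Z) j := fun j => by
        have e1 := (hZ.1 j).1
        have e2 := (abs_le.mp (haR j)).1
        rw [Pi.add_apply]
        linarith
      have hgcd : (Finset.univ.gcd fun j => ((a + Z) j).natAbs) = 1 := by
        by_contra hne
        exact hZ.2 ⟨hZ.1, hne⟩
      refine (measure_mono fun ω hω => ?_).trans
        (measure_bad_design_le hX hn hp hQ hR hσ hc hN hγ)
      intro hgood
      exact hω.1 (h n p N Q R σ W (X ω) (Y ω) (w ω) β a Z hn hp hN0 hQ hR hσ hW hσW ha hβ (hw ω)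
        (hY ω) hZ.1 (hN.coordBound_lt hn hp hQ hR hσ hc) hgood.1 hgood.2.1 hgcd hgood.2.2)
    · have : {ω | (ω, Z) ∈ {x : Ω × (Fin p → ℤ) | x ∈ F ∧ x.2 ∈ I ∧ x.2 ∉ G}} = ∅ :=
        Set.eq_empty_of_forall_notMem fun ω hω => hZ hω.2
      rw [this, measure_empty]
      exact zero_le
  -- the seed is out of range, or `γ` is not primitive, or the design is bad for the given seed
  have hsub : F ⊆ (Set.univ ×ˢ Iᶜ) ∪ (Set.univ ×ˢ G) ∪ {x | x ∈ F ∧ x.2 ∈ I ∧ x.2 ∉ G} :=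
    fun x hx => by
      by_cases e1 : x.2 ∈ I
      · by_cases e2 : x.2 ∈ G
        · exact Or.inl (Or.inr ⟨trivial, e2⟩)
        · exact Or.inr ⟨hx, e1, e2⟩
      · exact Or.inl (Or.inl ⟨trivial, e1⟩)
  calc (μ.prod ν) F ≤ (μ.prod ν) (Set.univ ×ˢ Iᶜ) + (μ.prod ν) (Set.univ ×ˢ G)
        + (μ.prod ν) {x | x ∈ F ∧ x.2 ∈ I ∧ x.2 ∉ G} :=
        (measure_mono hsub).trans
          ((measure_union_le _ _).trans (add_le_add_left (measure_union_le _ _) _))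
    _ ≤ 0 + ENNReal.ofReal (29 * (3 / 4) ^ p)
        + ENNReal.ofReal ((max M 0 + 2 * c + 1) / (n * p)) := by
        rw [h1]; gcongr
    _ = _ := by
        have hc' : 0 ≤ max M 0 := le_max_right _ _
        rw [zero_add, add_comm, ← ENNReal.ofReal_add (by positivity) (by positivity)]

theorem three_quarters_pow_le (p : ℕ) : (3 / 4 : ℝ) ^ p ≤ Real.exp (-(1 / 8) * p) ^ 2 := by
  have h1 : (3 / 4 : ℝ) ≤ Real.exp (-(1 / 4)) := by
    have := Real.add_one_le_exp (-(1 / 4) : ℝ)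
    linarith
  refine (pow_le_pow_left₀ (by norm_num) h1 p).trans_eq ?_
  rw [← Real.exp_nat_mul, ← Real.exp_nat_mul]
  congr 1
  push_cast
  ring

theorem exp_neg_sq_le {n p : ℕ} (hn : 0 < n) (hp : 0 < p) (h : (n : ℝ) ≤ Real.exp (1 / 8 * p)) :
    Real.exp (-(1 / 8) * p) ^ 2 ≤ 8 / (n * p) := by
  have hn0 : (0 : ℝ) < n := by exact_mod_cast hn
  have hp0 : (0 : ℝ) < p := by exact_mod_cast hp
  have h1 : (p : ℝ) / 8 ≤ Real.exp (1 / 8 * p) := by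
    have := Real.add_one_le_exp (1 / 8 * p : ℝ)
    linarith
  have h2 : (n : ℝ) * (p / 8) ≤ Real.exp (1 / 8 * p) ^ 2 := by
    rw [sq]; exact mul_le_mul h h1 (by positivity) (Real.exp_pos _).le
  rw [neg_mul, Real.exp_neg, inv_pow, inv_eq_one_div, div_le_div_iff₀ (by positivity) (by positivity)]
  linarith

end Main

end LatticeRegression

theorem mainTheorem2 :
    ∃ (κ : ℝ) (A D : ℕ), 0 < κ ∧
      -- on every input the algorithm terminates in polynomial time
      (∀ (n p N Qhat Rhat : ℕ) (What B : ℝ) (Y : Fin n → ℝ) (X : Fin n → Fin p → ℝ)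
          (Z : Fin p → ℤ),
        0 < n → 0 < p → 0 < N → 0 < Qhat → 0 < Rhat → 0 < What →
        (∀ i, |Y i| ≤ B) → (∀ i j, |X i j| ≤ B) →
        (∀ j, Z j ∈ Set.Icc ((Qhat * Rhat : ℤ) + 1) (2 * (Qhat * Rhat : ℤ) + Nat.log 2 p)) →
        ∃ (out : Fin p → ℚ) (t : ℕ),
          LatticeRegression.LBRReturns Y X N Qhat Rhat What Z out t ∧
          (t : ℝ) ≤ A * (LatticeRegression.sizeParam n p N Qhat Rhat What
            + Real.logb 2 (2 + B)) ^ D) ∧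
      -- recovery in polynomial time with high probability
      ∀ (c M : ℝ), 0 < c → ∃ K : ℝ,
        ∀ (n p Q N Qhat Rhat : ℕ) (R σ What : ℝ) (β : Fin p → ℝ) (f : ℝ → ℝ)
          (Ω : Type*) [MeasurableSpace Ω] (μ : MeasureTheory.Measure Ω)
          [MeasureTheory.IsProbabilityMeasure μ]
          (X : Ω → Fin n → Fin p → ℝ) (W Y : Ω → Fin n → ℝ),
        0 < n → 0 < p → 0 < Q → 0 < N → 0 < Qhat → 0 < Rhat → 0 < R → 0 ≤ σ → 0 < What →
        LatticeRegression.IsDesign μ X f c M →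
        (∀ j, β j ∈ Set.Icc (-R) R) → LatticeRegression.QRational Q β →
        (∀ ω i, W ω i ∈ Set.Icc (-σ) σ) →
        (∀ ω i, Y ω i = ∑ j, X ω i j * β j + W ω i) →
        Q ∣ Qhat → R ≤ Rhat →
        (N : ℝ) > 1 / 2 * (2 * n + p) * (2 * n + p + 10 * Real.logb 2 Qhat
          + 10 * Real.logb 2 (2 ^ N * σ + Rhat * p)
          + 20 * Real.logb 2 (3 * (1 + c) * n * p)) →
        σ ≤ What →
        (μ.prod (LatticeRegression.seedLaw p (Qhat * Rhat)))
            (LatticeRegression.failure Y X N Qhat Rhat What β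
              (A * LatticeRegression.sizeParam n p N Qhat Rhat What ^ D))
          ≤ ENNReal.ofReal (K * (1 / (n * p) + Real.exp (-κ * p))) ∧
        ((n : ℝ) ≤ Real.exp (κ * p) →
          (μ.prod (LatticeRegression.seedLaw p (Qhat * Rhat)))
            (LatticeRegression.failure Y X N Qhat Rhat What β
              (A * LatticeRegression.sizeParam n p N Qhat Rhat What ^ D))
          ≤ ENNReal.ofReal (K / (n * p))) := by
  obtain ⟨A, D, hA, hB⟩ := LatticeRegression.exists_lbr_recovery
  -- since `3 / 4 ≤ e ^ (-1 / 4)`, the choice `κ = 1 / 8` leaves a factor `e ^ (-κ p) ≤ 8 / p` for the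
  -- second bound; `233 = 1 + 29 * 8`
  refine ⟨1 / 8, A, D, by norm_num, hA, fun c M hc => ⟨max M 0 + 2 * c + 233, ?_⟩⟩
  intro n p Q N Qhat Rhat R σ What β f Ω _ μ _ X W Y hn hp hQ hN0 hQh hRh hR hσ hWh hX hβ hQβ hW hY
    hdvd hRR hN hσW
  obtain ⟨a, ha⟩ := LatticeRegression.exists_int_eq_mul_of_qRational hQβ hQ hdvd
  have hfail := LatticeRegression.prod_failure_le hB hX hn hp hN0 hQh hRh hσ hWh hσW hc ha
    (fun j => (abs_le.mpr (hβ j)).trans hRR) (fun ω i => abs_le.mpr (hW ω i)) hY hN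
  have hM : 0 ≤ max M 0 := le_max_right _ _
  have hn0 : (0 : ℝ) < n := by exact_mod_cast hn
  have hp0 : (0 : ℝ) < p := by exact_mod_cast hp
  have h34 := LatticeRegression.three_quarters_pow_le p
  have hexp := Real.exp_pos (-(1 / 8) * (p : ℝ))
  have hq : 0 < 1 / ((n : ℝ) * p) := by positivity
  rw [div_eq_mul_one_div] at hfail
  constructor
  · refine hfail.trans (ENNReal.ofReal_le_ofReal ?_)
    have h1 : Real.exp (-(1 / 8) * (p : ℝ)) ^ 2 ≤ Real.exp (-(1 / 8) * (p : ℝ)) := by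
      refine pow_le_of_le_one hexp.le (Real.exp_le_one_iff.mpr ?_) two_ne_zero
      linarith
    have h2 : 0 ≤ (max M 0 + 2 * c) * Real.exp (-(1 / 8) * (p : ℝ)) := by positivity
    linarith
  · intro hnp
    refine hfail.trans (ENNReal.ofReal_le_ofReal ?_)
    have h1 := LatticeRegression.exp_neg_sq_le hn hp hnp
    rw [div_eq_mul_one_div (8 : ℝ)] at h1
    rw [div_eq_mul_one_div (max M 0 + 2 * c + 233)]
    linarith
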